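/- **Lemma (Efficiency).** Setting. Let $d\in\{2,3\}$ and let $\Omega\subset\mathbb R^d$ be a bounded open set with Lipschitz boundary, $\partial\Omega=\Gamma_D\cup\Gamma_N$ with $\Gamma_D,\Gamma_N$ closed, $|\Gamma_D|>0$ and $|\Gamma_D\cap\Gamma_N|=0$. Let $E$ be measurable with $0<E_{\min}\le E\le E_{\max}$ on $\Omega$, let $0<\nu\le\frac12$, $\mu=E/2$ and $\frac1\lambda=\frac{1-2\nu}{E\nu}$ (so $\frac1\lambda=0$ if $\nu=\frac12$). Put $\mathrm H=\{v\in H^1(\Omega)^d: v=0\text{ on }\Gamma_D\}$, $\mathrm Q=L^2(\Omega)$, $\varepsilon(v)=\frac12(\nabla v+\nabla v^{t})$ and $$a(u,v)=2\int_\Omega\mu\,\varepsilon(u):\varepsilon(v),\quad b(v,q)=-\int_\Omega q\,\mathrm{div}\,v,\quad c(p,q)=\int_\Omega\tfrac1\lambda pq,\quad |||(v,q)|||^2=\|\mu^{1/2}\nabla v\|_{0,\Omega}^2+\|\mu^{-1/2}q\|_{0,\Omega}^2+\|\lambda^{-1/2}q\|_{0,\Omega}^2 .$$ Let $\kappa\in\mathbb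 R$ and $(0,0)\ne(u,p)\in\mathrm H\times\mathrm Q$ satisfy $a(u,v)+b(v,p)=\kappa\int_\Omega u\cdot v$ and $b(u,q)-c(p,q)=0$ for all $(v,q)\in\mathrm H\times\mathrm Q$. Let $\mathcal T_h$ be a conforming partition of $\overline\Omega$ into closed nondegenerate simplices, such that each facet contained in $\partial\Omega$ lies in $\Gamma_D$ or in $\Gamma_N$, and which is shape regular with constant $\sigma$ (each $K\in\mathcal T_h$ contains a ball of some radius $r>0$ with $h_K:=\mathrm{diam}\,K\le\sigma r$). Let $\mathrm H_h\subset\mathrm H$, $\mathrm Q_h\subset\mathrm Q$ be the spaces of the mini element (continuous velocities in $[\mathbb P_1\oplus\mathrm{span}\{b_K\}]^d$ on each $K$, with $b_K$ the product of the barycentric coordinates of $K$; continuous piecewise $\mathbb P_1$ pressures) or of the lowest order Taylor–Hood element (continuous piecewise $\mathbb P_2$ velocities, continuous piecewise $\mathbb P_1$ pressures), and let $\kappa_h\in\mathbb R$ and $(0,0)\neq(u_h,p_h)\in\mathrm H_h\times\mathrm Q_h$ satisfy the same two equations for all test functions in $\mathrm H_h\times\mathrm Q_h$. Fix $k\ge0$.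 On each $K$ let $\mu_h$ be the $L^2(K)$-projection of $\mu$ onto $\mathbb P_k(K)$, and let $\mu_h\ge m>0$ on every $K$ (if $k=0$ this holds with $m=E_{\min}/2$). With $\kappa_*=\kappa_h$ or $\kappa_*=\kappa$, put on $K$ $$R_1=\mathrm{div}(2\mu_h\varepsilon(u_h))-\nabla p_h+\kappa_*u_h,\quad R_2=\mathrm{div}\,u_h+\tfrac1\lambda p_h,\quad \rho_1=(2\mu_h)^{-1/2},\quad\rho_2=\big[(2\mu_h)^{-1}+\lambda^{-1}\big]^{-1},\quad\rho_\ell=(2\mu_h)^{-1/2}/\sqrt2 ,$$ and for a facet $\ell$, with $n$ the outer unit normal of the element, let $J_\ell$ be $\frac12[\![(2\mu_h\varepsilon(u_h)-p_hI)n]\!]$ (the sum of the contributions of the two adjacent elements, halved) if $\ell\not\subset\partial\Omega$, $(2\mu_h\varepsilon(u_h)-p_hI)n$ if $\ell\subset\Gamma_N$, and $0$ if $\ell\subset\Gamma_D$. With $h_\ell=\mathrm{diam}\,\ell$ and $\rho_\ell$ computed from $\mu_h|_K$, define $$\eta^2=\sum_{K\in\mathcal T_h}\Big(h_K^2\|\rho_1R_1\|_{0,K}^2+\|\rho_2^{1/2}R_2\|_{0,K}^2+\sum_{\ell\subset\partial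 K}h_\ell\|\rho_\ell J_\ell\|_{0,\ell}^2\Big),\qquad \Theta^2=\sum_{K\in\mathcal T_h}\|\rho_1(\mu-\mu_h)\varepsilon(u_h)\|_{0,K}^2 ,$$ $$\text{h.o.t.}=\Big(\sum_{K\in\mathcal T_h}h_K^2\big(|\kappa-\kappa_h|\,\|u_h\|_{0,K}+|\kappa|\,\|u-u_h\|_{0,K}\big)^2\Big)^{1/2}.$$ Claim. There is a constant $C>0$, depending only on $d$, the choice of the element, $E_{\min}$, $E_{\max}$, $m$, $k$ and $\sigma$ (in particular independent of the mesh size, of $\nu$ and of the continuous and discrete solutions), such that always $$\eta\le C\big(|||(u-u_h,p-p_h)|||+\Theta+\text{h.o.t.}\big).$$ -/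

import Mathlib

open MeasureTheory Set
open scoped ContDiff NNReal

noncomputable section

namespace ElasticityEig

/-- Euclidean `d`-space. -/
abbrev Pt (d : ℕ) := EuclideanSpace ℝ (Fin d)

variable {d : ℕ}

/-! ### Domains and their boundary -/

/-- `Ω` has a Lipschitz boundary: near every boundary point, `Ω` is the strict epigraph, in some
unit direction `e`, of a Lipschitz function of the coordinates orthogonal to `e`. -/
def HasLipschitzBoundary (Ω : Set (Pt d)) : Prop :=
  ∀ x ∈ frontier Ω, ∃ (e : Pt d) (L : ℝ≥0) (γ : Pt d → ℝ) (r : ℝ),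
    ‖e‖ = 1 ∧ LipschitzWith L γ ∧ (∀ (y : Pt d) (t : ℝ), γ (y + t • e) = γ y) ∧ 0 < r ∧
      ∀ y ∈ Metric.ball x r, (y ∈ Ω ↔ γ y < inner ℝ y e)

/-- The boundary of `Ω` is divided into two closed parts `ΓD`, `ΓN` (overlapping at most in a
null set of the surface measure), the first of positive surface measure. -/
structure IsBoundarySplitting (Ω ΓD ΓN : Set (Pt d)) : Prop where
  closed_D : IsClosed ΓD
  closed_N : IsClosed ΓN
  union_eq : ΓD ∪ ΓN = frontier Ω
  overlap : μHE[d - 1] (ΓD ∩ ΓN) = 0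
  pos_D : 0 < μHE[d - 1] ΓD

/-! ### Sobolev spaces -/

/-- Partial derivative `∂_j φ` of a scalar function. -/
def pd (φ : Pt d → ℝ) (j : Fin d) (x : Pt d) : ℝ :=
  fderiv ℝ φ x (EuclideanSpace.single j 1)

/-- `G` is a weak gradient of the vector field `v` on `Ω`, where `G x i j = ∂_j v_i (x)`. -/
def IsWeakGrad (Ω : Set (Pt d)) (v : Pt d → Pt d) (G : Pt d → Matrix (Fin d) (Fin d) ℝ) : Prop :=
  ∀ φ : Pt d → ℝ, ContDiff ℝ ∞ φ → HasCompactSupport φ → tsupport φ ⊆ Ω →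
    ∀ i j, ∫ x in Ω, v x i * pd φ j x = - ∫ x in Ω, G x i j * φ x

/-- The field `v` with weak gradient `G` has zero trace on the part `ΓD` of the boundary, where
`ΓN` is the rest of it. On a Lipschitz domain, Green's formula says that
`∫_Ω v_i ∂_j φ + ∫_Ω ∂_j v_i φ = ∫_∂Ω v_i φ n_j`, and testing with all smooth `φ` which vanish
near `ΓN` expresses that the trace of `v` vanishes almost everywhere on `ΓD`. -/
def HasZeroTraceOff (Ω ΓN : Set (Pt d)) (v : Pt d → Pt d)
    (G : Pt d → Matrix (Fin d) (Fin d) ℝ) : Prop :=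
  ∀ φ : Pt d → ℝ, ContDiff ℝ ∞ φ → HasCompactSupport φ → Disjoint (tsupport φ) ΓN →
    ∀ i j, ∫ x in Ω, v x i * pd φ j x = - ∫ x in Ω, G x i j * φ x

/-- `v` belongs to `H = {v ∈ H¹(Ω)^d : v = 0 on ΓD}` and `G` is its weak gradient. -/
structure MemH (Ω ΓN : Set (Pt d)) (v : Pt d → Pt d)
    (G : Pt d → Matrix (Fin d) (Fin d) ℝ) : Prop where
  memLp : MemLp v 2 (volume.restrict Ω)
  memLp_grad : ∀ i j, MemLp (fun x => G x i j) 2 (volume.restrict Ω)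
  weakGrad : IsWeakGrad Ω v G
  zeroTrace : HasZeroTraceOff Ω ΓN v G

/-- `q` belongs to `Q = L²(Ω)`. -/
def MemQ (Ω : Set (Pt d)) (q : Pt d → ℝ) : Prop := MemLp q 2 (volume.restrict Ω)

/-! ### Coefficients, bilinear forms, weighted norm -/

/-- The scaled Lamé coefficient `μ = E / 2`. -/
def mu (E : Pt d → ℝ) (x : Pt d) : ℝ := E x / 2

/-- The reciprocal `1 / λ` of the scaled Lamé coefficient `λ = E ν / (1 - 2 ν)`; it is zero in the
incompressible limit `ν = 1 / 2`. -/
def lamInv (E : Pt d → ℝ) (ν : ℝ) (x : Pt d) : ℝ := (1 - 2 * ν) / (E x * ν)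

/-- The strain, i.e. the symmetric part of a gradient. -/
def strain (G : Matrix (Fin d) (Fin d) ℝ) : Matrix (Fin d) (Fin d) ℝ :=
  (1 / 2 : ℝ) • (G + G.transpose)

/-- The product `A : B` of matrices. -/
def ddot (A B : Matrix (Fin d) (Fin d) ℝ) : ℝ := ∑ i, ∑ j, A i j * B i j

/-- `a(u, v) = 2 ∫_Ω μ ε(u) : ε(v)`, through the gradients of `u` and `v`. -/
def formA (Ω : Set (Pt d)) (E : Pt d → ℝ) (Gu Gv : Pt d → Matrix (Fin d) (Fin d) ℝ) : ℝ :=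
  2 * ∫ x in Ω, mu E x * ddot (strain (Gu x)) (strain (Gv x))

/-- `b(v, q) = - ∫_Ω q div v`, through the gradient of `v`. -/
def formB (Ω : Set (Pt d)) (Gv : Pt d → Matrix (Fin d) (Fin d) ℝ) (q : Pt d → ℝ) : ℝ :=
  - ∫ x in Ω, q x * (Gv x).trace

/-- `c(p, q) = ∫_Ω (1 / λ) p q`. -/
def formC (Ω : Set (Pt d)) (E : Pt d → ℝ) (ν : ℝ) (p q : Pt d → ℝ) : ℝ :=
  ∫ x in Ω, lamInv E ν x * (p x * q x)

/-- `d(u, v) = ∫_Ω u · v`. -/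
def formD (Ω : Set (Pt d)) (u v : Pt d → Pt d) : ℝ := ∫ x in Ω, ∑ i, u x i * v x i

/-- The norm `‖v‖_{0,K}` of a vector field. -/
def l2norm (K : Set (Pt d)) (v : Pt d → Pt d) : ℝ := √(∫ x in K, ∑ i, (v x i) ^ 2)

/-- The weighted norm `|||(v, q)|||`, through the gradient `G` of `v`; its square is
`‖μ^{1/2} ∇v‖² + ‖μ^{-1/2} q‖² + ‖λ^{-1/2} q‖²`. -/
def tripleNorm (Ω : Set (Pt d)) (E : Pt d → ℝ) (ν : ℝ)
    (G : Pt d → Matrix (Fin d) (Fin d) ℝ) (q : Pt d → ℝ) : ℝ :=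
  √((∫ x in Ω, mu E x * ddot (G x) (G x)) + (∫ x in Ω, (mu E x)⁻¹ * (q x) ^ 2)
    + ∫ x in Ω, lamInv E ν x * (q x) ^ 2)

/-- `(κ, (u, p))` solves the eigenvalue problem: `(u, p) ∈ H × Q` is nonzero and
`a(u, v) + b(v, p) = κ d(u, v)`, `b(u, q) - c(p, q) = 0` for all `(v, q) ∈ H × Q`.
Here `Gu` is the weak gradient of `u`. -/
structure IsEigenSolution (Ω ΓN : Set (Pt d)) (E : Pt d → ℝ) (ν κ : ℝ)
    (u : Pt d → Pt d) (Gu : Pt d → Matrix (Fin d) (Fin d) ℝ) (p : Pt d → ℝ) : Prop where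
  memH : MemH Ω ΓN u Gu
  memQ : MemQ Ω p
  nonzero : ¬ ∀ᵐ x ∂(volume.restrict Ω), u x = 0 ∧ p x = 0
  momentum : ∀ v Gv, MemH Ω ΓN v Gv →
    formA Ω E Gu Gv + formB Ω Gv p = κ * formD Ω u v
  mass : ∀ q, MemQ Ω q → formB Ω Gu q - formC Ω E ν p q = 0

/-! ### Meshes. A simplex is given by the finite set of its vertices. -/

/-- The closed simplex (or facet) with vertex set `s`. -/
def hull (s : Finset (Pt d)) : Set (Pt d) := convexHull ℝ (s : Set (Pt d))

/-- `T` is a conforming partition of the closure of `Ω` into nondegenerate closed simplices. -/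
structure IsMesh (Ω : Set (Pt d)) (T : Finset (Finset (Pt d))) : Prop where
  card_eq : ∀ s ∈ T, s.card = d + 1
  affineIndependent : ∀ s ∈ T, AffineIndependent ℝ (fun v : s => (v : Pt d))
  conforming : ∀ s ∈ T, ∀ t ∈ T,
    hull s ∩ hull t = convexHull ℝ ((s : Set (Pt d)) ∩ (t : Set (Pt d)))
  cover : ⋃ s ∈ T, hull s = closure Ω

open Classical in
/-- The facets of the simplex `s`. -/
def facets (s : Finset (Pt d)) : Finset (Finset (Pt d)) :=
  s.image (fun v => s.erase v)

/-- Every boundary facet of the mesh lies in one of the two parts of the boundary. -/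
def ResolvesBoundary (Ω ΓD ΓN : Set (Pt d)) (T : Finset (Finset (Pt d))) : Prop :=
  ∀ s ∈ T, ∀ F ∈ facets s, hull F ⊆ frontier Ω → hull F ⊆ ΓD ∨ hull F ⊆ ΓN

/-- Shape regularity with constant `σ`: each simplex contains a ball of some radius `r` and has
diameter at most `σ r`. -/
def ShapeRegular (σ : ℝ) (T : Finset (Finset (Pt d))) : Prop :=
  ∀ s ∈ T, ∃ (c : Pt d) (r : ℝ), 0 < r ∧ Metric.closedBall c r ⊆ hull s ∧
    Metric.diam (hull s) ≤ σ * r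

/-- The barycenter of a finite set of vertices. -/
def barycenter (s : Finset (Pt d)) : Pt d := (s.card : ℝ)⁻¹ • ∑ v ∈ s, v

/-- The component orthogonal to the facet `F` of the vector from the barycenter of the simplex `s`
to the barycenter of `F`; it is normal to `F` and points out of `s`. -/
def outerDir (s F : Finset (Pt d)) : Pt d :=
  (vectorSpan ℝ (F : Set (Pt d)))ᗮ.starProjection (barycenter F - barycenter s)

/-- The outer unit normal vector of the simplex `s` on its facet `F`. -/
def outerNormal (s F : Finset (Pt d)) : Pt d := ‖outerDir s F‖⁻¹ • outerDir s F

open Classical in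
/-- The barycentric coordinate of the simplex `s` that belongs to its vertex `v`: the affine
function which vanishes on the facet opposite to `v` and is one at `v`. -/
def baryCoord (s : Finset (Pt d)) (v x : Pt d) : ℝ :=
  inner ℝ (outerNormal s (s.erase v)) (x - barycenter (s.erase v)) /
    inner ℝ (outerNormal s (s.erase v)) (v - barycenter (s.erase v))

/-- The element bubble function, i.e. the product of all barycentric coordinates. -/
def bubble (s : Finset (Pt d)) (x : Pt d) : ℝ := ∏ v ∈ s, baryCoord s v x

/-! ### Finite element spaces -/

/-- `f` coincides on `K` with a polynomial of degree at most `k`. -/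
def IsPolyOn (k : ℕ) (K : Set (Pt d)) (f : Pt d → ℝ) : Prop :=
  ∃ P : MvPolynomial (Fin d) ℝ, P.totalDegree ≤ k ∧
    ∀ x ∈ K, f x = MvPolynomial.eval (fun i => x i) P

/-- The two families of finite elements. -/
inductive FEFamily
  | mini
  | taylorHood

/-- The local space for each component of the velocity: `P₁ ⊕ span (bubble)` for the mini element
and `P₂` for the lowest order Taylor-Hood element. -/
def IsLocalVelocity : FEFamily → Finset (Pt d) → (Pt d → ℝ) → Prop
  | FEFamily.mini, s, f =>
      ∃ (g : Pt d → ℝ) (c : ℝ), IsPolyOn 1 (hull s) g ∧ ∀ x ∈ hull s, f x = g x + c * bubble s x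
  | FEFamily.taylorHood, s, f => IsPolyOn 2 (hull s) f

/-- The classical gradient `G x i j = ∂_j v_i (x)`. For a piecewise smooth `v` it is the gradient
away from the skeleton of the mesh, hence almost everywhere. -/
def grad (v : Pt d → Pt d) (x : Pt d) : Matrix (Fin d) (Fin d) ℝ :=
  Matrix.of fun i j => fderiv ℝ v x (EuclideanSpace.single j 1) i

/-- The gradient of the restriction of `v` to `K`; used for simplices `K`, up to the boundary. -/
def gradOn (K : Set (Pt d)) (v : Pt d → Pt d) (x : Pt d) : Matrix (Fin d) (Fin d) ℝ :=
  Matrix.of fun i j => fderivWithin ℝ v K x (EuclideanSpace.single j 1) i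

/-- Partial derivative `∂_j` of the restriction of a scalar function to `K`. -/
def pdOn (K : Set (Pt d)) (f : Pt d → ℝ) (j : Fin d) (x : Pt d) : ℝ :=
  fderivWithin ℝ f K x (EuclideanSpace.single j 1)

/-- The discrete velocity space `H_h`. -/
structure MemHh (fe : FEFamily) (Ω ΓN : Set (Pt d)) (T : Finset (Finset (Pt d)))
    (v : Pt d → Pt d) : Prop where
  continuousOn : ContinuousOn v (closure Ω)
  loc : ∀ s ∈ T, ∀ i, IsLocalVelocity fe s (fun x => v x i)
  memH : MemH Ω ΓN v (grad v)

/-- The discrete pressure space `Q_h` of continuous piecewise affine functions. -/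
structure MemQh (Ω : Set (Pt d)) (T : Finset (Finset (Pt d))) (q : Pt d → ℝ) : Prop where
  continuousOn : ContinuousOn q (closure Ω)
  loc : ∀ s ∈ T, IsPolyOn 1 (hull s) q

/-- `(κh, (uh, ph))` solves the discrete eigenvalue problem. -/
structure IsDiscreteEigenSolution (fe : FEFamily) (Ω ΓN : Set (Pt d))
    (T : Finset (Finset (Pt d))) (E : Pt d → ℝ) (ν κh : ℝ) (uh : Pt d → Pt d) (ph : Pt d → ℝ) :
    Prop where
  memHh : MemHh fe Ω ΓN T uh
  memQh : MemQh Ω T ph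
  nonzero : ¬ ∀ x ∈ Ω, uh x = 0 ∧ ph x = 0
  momentum : ∀ vh, MemHh fe Ω ΓN T vh →
    formA Ω E (grad uh) (grad vh) + formB Ω (grad vh) ph = κh * formD Ω uh vh
  mass : ∀ qh, MemQh Ω T qh → formB Ω (grad uh) qh - formC Ω E ν ph qh = 0

/-- `μh s` is, for each simplex `s` of the mesh, the `L²(s)`-orthogonal projection of `μ` onto the
polynomials of degree at most `k`. -/
def IsL2Projection (k : ℕ) (T : Finset (Finset (Pt d))) (μ : Pt d → ℝ)
    (μh : Finset (Pt d) → Pt d → ℝ) : Prop :=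
  ∀ s ∈ T, IsPolyOn k (hull s) (μh s) ∧
    ∀ q, IsPolyOn k (hull s) q → ∫ x in hull s, (μ x - μh s x) * q x = 0

/-! ### The residual estimator -/

/-- Component `i` of the residual `R₁ = div (2 μh ε(uh)) - ∇ph + κR uh` on the simplex `s`. -/
def R1 (μh : Finset (Pt d) → Pt d → ℝ) (κR : ℝ) (uh : Pt d → Pt d) (ph : Pt d → ℝ)
    (s : Finset (Pt d)) (x : Pt d) (i : Fin d) : ℝ :=
  (∑ j, pdOn (hull s) (fun y => 2 * μh s y * strain (gradOn (hull s) uh y) i j) j x)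
    - pdOn (hull s) ph i x + κR * uh x i

/-- The residual `R₂ = div uh + (1 / λ) ph` on the simplex `s`. -/
def R2 (E : Pt d → ℝ) (ν : ℝ) (uh : Pt d → Pt d) (ph : Pt d → ℝ)
    (s : Finset (Pt d)) (x : Pt d) : ℝ :=
  (gradOn (hull s) uh x).trace + lamInv E ν x * ph x

/-- The traction `(2 μh ε(uh) - ph I) n` of the restriction to the simplex `s` on its facet `F`,
with `n` the outer unit normal of `s`. -/
def traction (μh : Finset (Pt d) → Pt d → ℝ) (uh : Pt d → Pt d) (ph : Pt d → ℝ)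
    (s F : Finset (Pt d)) (x : Pt d) : Fin d → ℝ :=
  ((2 * μh s x) • strain (gradOn (hull s) uh x) - ph x • (1 : Matrix (Fin d) (Fin d) ℝ)).mulVec
    (fun j => outerNormal s F j)

open Classical in
/-- The sum of the tractions over the simplices of the mesh which have `F` as a facet: the jump
across `F` if `F` is interior, and the traction itself if `F` is on the boundary. -/
def tractionSum (T : Finset (Finset (Pt d))) (μh : Finset (Pt d) → Pt d → ℝ)
    (uh : Pt d → Pt d) (ph : Pt d → ℝ) (F : Finset (Pt d)) (x : Pt d) : Fin d → ℝ :=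
  ∑ t ∈ T with F ∈ facets t, traction μh uh ph t F x

open Classical in
/-- The facet residual: half of the jump of the traction on interior facets, the traction on
facets in `ΓN`, and zero on the other boundary facets (those in `ΓD`). -/
def facetResidual (Ω ΓN : Set (Pt d)) (T : Finset (Finset (Pt d)))
    (μh : Finset (Pt d) → Pt d → ℝ) (uh : Pt d → Pt d) (ph : Pt d → ℝ)
    (F : Finset (Pt d)) (x : Pt d) : Fin d → ℝ :=
  if hull F ⊆ frontier Ω then
    (if hull F ⊆ ΓN then tractionSum T μh uh ph F x else 0)
  else (1 / 2 : ℝ) • tractionSum T μh uh ph F x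

/-- `h_K² ‖ρ₁ R₁‖²_{0,K} + ‖ρ₂^{1/2} R₂‖²_{0,K}` with `ρ₁² = (2 μh)⁻¹` and
`ρ₂ = ((2 μh)⁻¹ + 1 / λ)⁻¹`. -/
def etaElemSq (E : Pt d → ℝ) (ν : ℝ) (μh : Finset (Pt d) → Pt d → ℝ) (κR : ℝ)
    (uh : Pt d → Pt d) (ph : Pt d → ℝ) (s : Finset (Pt d)) : ℝ :=
  Metric.diam (hull s) ^ 2 * (∫ x in hull s, (2 * μh s x)⁻¹ * ∑ i, (R1 μh κR uh ph s x i) ^ 2)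
    + ∫ x in hull s, ((2 * μh s x)⁻¹ + lamInv E ν x)⁻¹ * (R2 E ν uh ph s x) ^ 2

/-- `h_F ‖ρ_F J_F‖²_{0,F}` with `ρ_F² = (2 μh)⁻¹ / 2`, where `μh` is taken from the simplex `s`. -/
def etaFacetSq (Ω ΓN : Set (Pt d)) (T : Finset (Finset (Pt d)))
    (μh : Finset (Pt d) → Pt d → ℝ) (uh : Pt d → Pt d) (ph : Pt d → ℝ)
    (s F : Finset (Pt d)) : ℝ :=
  Metric.diam (hull F) *
    ∫ x in hull F, (2 * μh s x)⁻¹ / 2 * ∑ i, (facetResidual Ω ΓN T μh uh ph F x i) ^ 2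
      ∂(μHE[d - 1] : Measure (Pt d))

/-- The global residual estimator `η`. -/
def eta (Ω ΓN : Set (Pt d)) (T : Finset (Finset (Pt d))) (E : Pt d → ℝ) (ν : ℝ)
    (μh : Finset (Pt d) → Pt d → ℝ) (κR : ℝ) (uh : Pt d → Pt d) (ph : Pt d → ℝ) : ℝ :=
  √(∑ s ∈ T, (etaElemSq E ν μh κR uh ph s + ∑ F ∈ facets s, etaFacetSq Ω ΓN T μh uh ph s F))

/-- The global data oscillation `Θ`, with `Θ_K² = ‖ρ₁ (μ - μh) ε(uh)‖²_{0,K}`. -/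
def oscillation (T : Finset (Finset (Pt d))) (E : Pt d → ℝ)
    (μh : Finset (Pt d) → Pt d → ℝ) (uh : Pt d → Pt d) : ℝ :=
  √(∑ s ∈ T, ∫ x in hull s, (2 * μh s x)⁻¹ * (mu E x - μh s x) ^ 2 *
    ddot (strain (gradOn (hull s) uh x)) (strain (gradOn (hull s) uh x)))

/-- The higher order terms: the root of the sum over all `K` of
`h_K² (|κ - κh| ‖uh‖_{0,K} + |κ| ‖u - uh‖_{0,K})²`. -/
def higherOrder (T : Finset (Finset (Pt d))) (κ κh : ℝ) (u uh : Pt d → Pt d) : ℝ :=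
  √(∑ s ∈ T, Metric.diam (hull s) ^ 2 *
    (|κ - κh| * l2norm (hull s) uh + |κ| * l2norm (hull s) (fun x => u x - uh x)) ^ 2)

end ElasticityEig

end

noncomputable section

namespace ElasticityEig

/-! ### Polynomials -/

section Polynomials
open MvPolynomial

/-! The argument is Verfürth's bubble function technique. Let $\sigma_h=2\mu_h\varepsilon(u_h)-p_hI$
and let $w$ be an admissible test field that is smooth on each simplex of a small patch. Integrating
$\sigma_h$ by parts and subtracting the exact momentum equation gives the identity
`IsSetting.sum_residual_eq`: the volume residual $R_1$ tested with $w$, minus the facet terms of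
$\sigma_h w$, equals the integral of
$2\mu\,\varepsilon(u-u_h):\varepsilon(w)-(p-p_h)\,\mathrm{div}\,w+2(\mu-\mu_h)\varepsilon(u_h):\varepsilon(w)-(\kappa
u-\kappa_*u_h)\cdot w$. The right side sees only the error, the oscillation and the higher order
terms.

On one simplex take $w$ to be the element bubble times $R_1$. The facet terms vanish, and the left
side is a weighted $L^2$ norm of $R_1$, which bounds all other norms on polynomials of bounded
degree. The right side costs $|\nabla w|$, hence a factor $1/r$ that the weight $h_K\le\sigma r$
absorbs (`IsSetting.element_residual_le`). On the simplices around a facet take the facet bubble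
times the traction sum, extended into each simplex. Now the facet terms give the weighted norm of
the traction sum, and the volume terms have already been bounded (`IsSetting.facet_residual_le`). No
test is needed for $R_2$: the exact mass equation holds almost everywhere, so
$R_2=-(\mathrm{div}(u-u_h)+\frac1\lambda(p-p_h))$, and $\rho_2\le2\mu_h$ together with
$\rho_2/\lambda\le1$ makes the bound independent of $\nu$ (`IsSetting.residual_two_le`). Summation
uses that a facet belongs to at most two simplices and a simplex has boundedly many facets.

The constants come from the reference simplex: equivalence of norms by compactness
(`exists_poly_bound`), transported by affine maps whose inverses are controlled by the inscribed
ball (`IsFrame.abs_symm_le`). The same norm equivalence bounds $\mu_h$ from above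
(`IsSetting.coef_le`). The divergence theorem is needed only for functions that vanish on all facets
but one, where it is the fundamental theorem of calculus along an edge direction. The surface
measure of a facet is needed only from above, since the residual is bounded pointwise on the facet.
-/

theorem hasFDerivAt_eval {ι E : Type*} [Fintype ι] [NormedAddCommGroup E] [NormedSpace ℝ E]
    {ℓ : ι → E → ℝ} {ℓ' : ι → E →L[ℝ] ℝ} {x : E} (h : ∀ i, HasFDerivAt (ℓ i) (ℓ' i) x)
    (P : MvPolynomial ι ℝ) :
    HasFDerivAt (fun z => eval (fun i => ℓ i z) P)
      (∑ i, eval (fun i => ℓ i x) (pderiv i P) • ℓ' i) x := by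
  classical
  induction P using MvPolynomial.induction_on with
  | C r => simpa using hasFDerivAt_const r x
  | add p q hp hq =>
    have := hp.add hq
    simp only [map_add, add_smul, Finset.sum_add_distrib]
    exact this
  | mul_X p i hp =>
    have := hp.mul (h i)
    simp only [map_mul, eval_X, Derivation.leibniz, map_add, smul_eq_mul, pderiv_X]
    refine this.congr_fderiv ?_
    simp only [add_smul, Finset.sum_add_distrib, Finset.smul_sum, smul_smul]
    congr 1
    rw [Finset.sum_eq_single i]
    · simp
    · intro b _ hb
      simp [hb.symm]
    · simp

theorem contDiff_eval {ι E : Type*} [Fintype ι] [NormedAddCommGroup E] [NormedSpace ℝ E]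
    {ℓ : ι → E → ℝ} (h : ∀ i, ContDiff ℝ ∞ (ℓ i)) (P : MvPolynomial ι ℝ) :
    ContDiff ℝ ∞ (fun z => eval (fun i => ℓ i z) P) := by
  induction P using MvPolynomial.induction_on with
  | C r => simpa using contDiff_const
  | add p q hp hq => simpa using hp.add hq
  | mul_X p i hp => simpa using hp.mul (h i)

theorem totalDegree_pderiv_le {ι : Type*} (i : ι) (P : MvPolynomial ι ℝ) :
    (pderiv i P).totalDegree ≤ P.totalDegree := by
  classical
  conv_lhs => rw [P.as_sum, map_sum]
  refine totalDegree_finsetSum_le fun m hm => ?_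
  rw [pderiv_monomial]
  refine (totalDegree_monomial_le _ _).trans (le_trans ?_ (le_totalDegree hm))
  have : m - Finsupp.single i 1 ≤ m := tsub_le_self
  exact Finsupp.sum_le_sum_index this (by intros; exact fun _ _ h => h) (by simp)

theorem totalDegree_bind₁_le {ι κ : Type*} (g : ι → MvPolynomial κ ℝ)
    (hg : ∀ i, (g i).totalDegree ≤ 1) (P : MvPolynomial ι ℝ) :
    (bind₁ g P).totalDegree ≤ P.totalDegree := by
  classical
  conv_lhs => rw [P.as_sum, map_sum]
  refine totalDegree_finsetSum_le fun m hm => ?_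
  rw [bind₁_monomial]
  refine (totalDegree_mul _ _).trans ?_
  rw [totalDegree_C, zero_add]
  refine (totalDegree_finsetProd _ _).trans (le_trans ?_ (le_totalDegree hm))
  refine Finset.sum_le_sum fun j _ => (totalDegree_pow _ _).trans ?_
  exact mul_le_of_le_one_right (Nat.zero_le _) (hg j)

/-- The affine polynomial `c + ∑ j, b j * X j`. -/
def affinePoly {κ : Type*} [Fintype κ] (c : ℝ) (b : κ → ℝ) : MvPolynomial κ ℝ :=
  C c + ∑ j, C (b j) * X j

theorem eval_affinePoly {κ : Type*} [Fintype κ] (c : ℝ) (b : κ → ℝ) (y : κ → ℝ) :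
    eval y (affinePoly c b) = c + ∑ j, b j * y j := by
  simp [affinePoly]

theorem totalDegree_affinePoly_le {κ : Type*} [Fintype κ] (c : ℝ) (b : κ → ℝ) :
    (affinePoly c b).totalDegree ≤ 1 := by
  refine (totalDegree_add _ _).trans (max_le (by simp) ?_)
  refine totalDegree_finsetSum_le fun j _ => (totalDegree_mul _ _).trans ?_
  simp

/-- Polynomials may be composed with affine maps without raising the degree. -/
theorem exists_eval_affine {ι κ : Type*} [Fintype κ] (c : ι → ℝ) (b : ι → κ → ℝ)
    (P : MvPolynomial ι ℝ) : ∃ Q : MvPolynomial κ ℝ, Q.totalDegree ≤ P.totalDegree ∧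
      ∀ y, eval y Q = eval (fun i => c i + ∑ j, b i j * y j) P := by
  refine ⟨bind₁ (fun i => affinePoly (c i) (b i)) P,
    totalDegree_bind₁_le _ (fun i => totalDegree_affinePoly_le _ _) P, fun y => ?_⟩
  have : ((eval y).comp (bind₁ fun i => affinePoly (c i) (b i)).toRingHom) P =
      eval (fun i => c i + ∑ j, b i j * y j) P := by
    congr 1
    refine MvPolynomial.ringHom_ext ?_ ?_ <;> intros <;> simp [eval_affinePoly]
  simpa using this

end Polynomials

/-! ### The reference simplex -/

/-- The reference simplex with vertices `0` and the unit vectors. -/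
def refSimplex (n : ℕ) : Set (Fin n → ℝ) := {y | (∀ i, 0 ≤ y i) ∧ ∑ i, y i ≤ 1}

/-- The product of the barycentric coordinates of the reference simplex. -/
def refBubble {n : ℕ} (y : Fin n → ℝ) : ℝ := (1 - ∑ i, y i) * ∏ i, y i

theorem refSimplex_coord_le {n : ℕ} {y : Fin n → ℝ} (hy : y ∈ refSimplex n) (i : Fin n) :
    y i ≤ 1 :=
  (Finset.single_le_sum (fun j _ => hy.1 j) (Finset.mem_univ i)).trans hy.2

theorem refSimplex_abs_le {n : ℕ} {y : Fin n → ℝ} (hy : y ∈ refSimplex n) (i : Fin n) :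
    |y i| ≤ 1 := by
  rw [abs_of_nonneg (hy.1 i)]; exact refSimplex_coord_le hy i

theorem isClosed_refSimplex (n : ℕ) : IsClosed (refSimplex n) := by
  have h : refSimplex n = (⋂ i, {y | 0 ≤ y i}) ∩ {y | ∑ i, y i ≤ 1} := by
    ext y; simp [refSimplex]
  rw [h]
  exact (isClosed_iInter fun i => isClosed_le (by fun_prop) (by fun_prop)).inter
    (isClosed_le (by fun_prop) (by fun_prop))

theorem isCompact_refSimplex (n : ℕ) : IsCompact (refSimplex n) := by
  refine (isCompact_Icc (a := (0 : Fin n → ℝ)) (b := 1)).of_isClosed_subset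
    (isClosed_refSimplex n) fun y hy => ⟨fun i => hy.1 i, fun i => refSimplex_coord_le hy i⟩

theorem measurableSet_refSimplex (n : ℕ) : MeasurableSet (refSimplex n) :=
  (isClosed_refSimplex n).measurableSet

theorem continuous_refBubble {n : ℕ} : Continuous (refBubble (n := n)) := by
  unfold refBubble; fun_prop

theorem refBubble_nonneg {n : ℕ} {y : Fin n → ℝ} (hy : y ∈ refSimplex n) : 0 ≤ refBubble y :=
  mul_nonneg (sub_nonneg.2 hy.2) (Finset.prod_nonneg fun i _ => hy.1 i)

/-- A box inside the reference simplex. -/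
theorem openBox_subset (n : ℕ) {y : Fin n → ℝ} (hy : ∀ i, y i ∈ Set.Ioo (0 : ℝ) (1 / (n + 1))) :
    (∀ i, 0 < y i) ∧ ∑ i, y i < 1 := by
  refine ⟨fun i => (hy i).1, ?_⟩
  have : ∑ i, y i ≤ ∑ _i : Fin n, (1 / (n + 1) : ℝ) := Finset.sum_le_sum fun i _ => (hy i).2.le
  refine this.trans_lt ?_
  simp only [Finset.sum_const, Finset.card_univ, Fintype.card_fin, nsmul_eq_mul, mul_one_div]
  rw [div_lt_one (by positivity)]
  linarith

theorem refBubble_pos {n : ℕ} {y : Fin n → ℝ} (h1 : ∀ i, 0 < y i) (h2 : ∑ i, y i < 1) :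
    0 < refBubble y :=
  mul_pos (sub_pos.2 h2) (Finset.prod_pos fun i _ => h1 i)

/-- The bubble is positive in the interior, so a vanishing weighted integral makes the polynomial
vanish on an open box. A polynomial that vanishes on a product of infinite sets is zero. This makes
the bubble-weighted form definite. -/
theorem eq_zero_of_integral_refBubble {n : ℕ} (P : MvPolynomial (Fin n) ℝ)
    (h : ∫ z in refSimplex n, refBubble z * (MvPolynomial.eval z P) ^ 2 = 0) : P = 0 := by
  have hc : Continuous fun z : Fin n → ℝ => refBubble z * (MvPolynomial.eval z P) ^ 2 :=
    continuous_refBubble.mul ((MvPolynomial.continuous_eval P).pow 2)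
  have hi : IntegrableOn (fun z : Fin n → ℝ => refBubble z * (MvPolynomial.eval z P) ^ 2)
      (refSimplex n) := hc.continuousOn.integrableOn_compact (isCompact_refSimplex n)
  set U : Set (Fin n → ℝ) := Set.univ.pi fun _ => Set.Ioo (0 : ℝ) (1 / (n + 1)) with hU
  have hUo : IsOpen U := isOpen_set_pi Set.finite_univ fun _ _ => isOpen_Ioo
  have hUs : U ⊆ refSimplex n := fun y hy => by
    have := openBox_subset n (y := y) (fun i => hy i (Set.mem_univ i))
    exact ⟨fun i => (this.1 i).le, this.2.le⟩
  rw [setIntegral_eq_zero_iff_of_nonneg_ae _ hi] at h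
  swap
  · filter_upwards [ae_restrict_mem (measurableSet_refSimplex n)] with y hy
    exact mul_nonneg (refBubble_nonneg hy) (sq_nonneg _)
  have h' := ae_restrict_of_ae_restrict_of_subset hUs h
  have h0 := Measure.eqOn_open_of_ae_eq h' hUo hc.continuousOn continuousOn_const
  refine MvPolynomial.funext_set (fun _ => Set.Ioo (0 : ℝ) (1 / (n + 1))) ?_ ?_
  · intro i; exact Set.Ioo_infinite (by positivity)
  · intro y hy
    have h1 := h0 hy
    have h2 := openBox_subset n (y := y) (fun i => hy i (Set.mem_univ i))
    have h3 := refBubble_pos h2.1 h2.2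
    simpa [h3.ne'] using h1

/-- On polynomials of bounded degree, the values and the first derivatives in the unit cube are
controlled by the `L²` norm weighted with the bubble function. -/
theorem exists_poly_bound (n N : ℕ) : ∃ C : ℝ, 0 < C ∧ ∀ P : MvPolynomial (Fin n) ℝ,
    P.totalDegree ≤ N → ∀ y : Fin n → ℝ, (∀ i, |y i| ≤ 1) →
      (MvPolynomial.eval y P) ^ 2 ≤
          C * ∫ z in refSimplex n, refBubble z * (MvPolynomial.eval z P) ^ 2 ∧
      ∀ i, (MvPolynomial.eval y (MvPolynomial.pderiv i P)) ^ 2 ≤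
          C * ∫ z in refSimplex n, refBubble z * (MvPolynomial.eval z P) ^ 2 := by
  classical
  -- All norms are equivalent on this finite-dimensional space; the rest makes this explicit in the
  -- coefficients with respect to a basis.
  let V := MvPolynomial.restrictTotalDegree (Fin n) ℝ N
  obtain ⟨m, ⟨b⟩⟩ : ∃ m, Nonempty (Module.Basis (Fin m) ℝ V) := ⟨_, ⟨Module.finBasis ℝ V⟩⟩
  let Φ : (Fin m → ℝ) →ₗ[ℝ] MvPolynomial (Fin n) ℝ :=
    V.subtype ∘ₗ (b.equivFun.symm : (Fin m → ℝ) →ₗ[ℝ] V)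
  have hΦ : ∀ c, Φ c = ∑ i, c i • (b i : MvPolynomial (Fin n) ℝ) := fun c => by
    simp [Φ, Module.Basis.equivFun_symm_apply]
  let ψ : (Fin m → ℝ) → ℝ := fun c =>
    ∫ z in refSimplex n, refBubble z * (MvPolynomial.eval z (Φ c)) ^ 2
  have hψc : Continuous ψ := by
    refine continuous_parametric_integral_of_continuous ?_ (isCompact_refSimplex n)
    have : (Function.uncurry fun (c : Fin m → ℝ) (z : Fin n → ℝ) =>
        refBubble z * (MvPolynomial.eval z (Φ c)) ^ 2) = fun q =>
        refBubble q.2 * (∑ i, q.1 i * MvPolynomial.eval q.2 (b i : MvPolynomial (Fin n) ℝ)) ^ 2 := by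
      funext q; simp [Function.uncurry, hΦ, MvPolynomial.smul_eval]
    rw [this]
    have h1 := fun i => MvPolynomial.continuous_eval (b i : MvPolynomial (Fin n) ℝ)
    have h2 : ∀ i, Continuous fun q : (Fin m → ℝ) × (Fin n → ℝ) =>
      MvPolynomial.eval q.2 (b i : MvPolynomial (Fin n) ℝ) := fun i => (h1 i).comp continuous_snd
    exact (continuous_refBubble.comp continuous_snd).mul
      ((continuous_finsetSum _ fun i _ => ((continuous_apply i).comp continuous_fst).mul
        (h2 i)).pow 2)
  have hψ0 : ∀ c, 0 ≤ ψ c := fun c => setIntegral_nonneg (measurableSet_refSimplex n)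
    fun z hz => mul_nonneg (refBubble_nonneg hz) (sq_nonneg _)
  have hψs : ∀ (r : ℝ) c, ψ (r • c) = r ^ 2 * ψ c := fun r c => by
    simp only [ψ, map_smul, MvPolynomial.smul_eval]
    rw [← integral_const_mul]
    congr 1; funext z; ring
  have hψp : ∀ c, c ≠ 0 → 0 < ψ c := fun c hc => by
    refine lt_of_le_of_ne (hψ0 c) fun h => hc ?_
    have := eq_zero_of_integral_refBubble (Φ c) h.symm
    have h2 : b.equivFun.symm c = 0 := Subtype.ext this
    exact (LinearEquiv.map_eq_zero_iff _).1 h2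
  -- The minimum of the positive continuous function `ψ` on the unit sphere, extended by homogeneity
  -- of degree two.
  obtain ⟨δ, hδ, hδψ⟩ : ∃ δ : ℝ, 0 < δ ∧ ∀ c, δ * ‖c‖ ^ 2 ≤ ψ c := by
    by_cases hne : (Metric.sphere (0 : Fin m → ℝ) 1).Nonempty
    · obtain ⟨c0, hc0, hmin⟩ := (isCompact_sphere (0 : Fin m → ℝ) 1).exists_isMinOn hne
        hψc.continuousOn
      refine ⟨ψ c0, hψp c0 (by rintro rfl; simp at hc0), fun c => ?_⟩
      rcases eq_or_ne c 0 with rfl | hc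
      · simpa using hψ0 0
      · have h1 : ‖c‖⁻¹ • c ∈ Metric.sphere (0 : Fin m → ℝ) 1 := by
          simp [norm_smul, hc]
        have h2 := hmin h1
        simp only [mem_ofPred_eq, hψs] at h2
        have h3 : 0 < ‖c‖ ^ 2 := by positivity
        calc ψ c0 * ‖c‖ ^ 2 ≤ (‖c‖⁻¹ ^ 2 * ψ c) * ‖c‖ ^ 2 := by gcongr
          _ = ψ c := by field_simp
    -- The sphere is empty only if the coefficient space is trivial, and then any constant serves.
    · refine ⟨1, one_pos, fun c => ?_⟩
      rcases eq_or_ne c 0 with rfl | hc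
      · simpa using hψ0 0
      · exact absurd ⟨‖c‖⁻¹ • c, by simp [norm_smul, hc]⟩ hne
  have hcube : IsCompact {y : Fin n → ℝ | ∀ i, |y i| ≤ 1} := by
    convert isCompact_Icc (a := fun _ : Fin n => (-1 : ℝ)) (b := fun _ => 1) using 1
    ext y; simp [abs_le, Set.mem_Icc, Pi.le_def, forall_and]
  have hbd : ∀ Q : MvPolynomial (Fin n) ℝ, ∃ B : ℝ, 0 ≤ B ∧ ∀ y : Fin n → ℝ, (∀ i, |y i| ≤ 1) →
      |MvPolynomial.eval y Q| ≤ B := fun Q => by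
    obtain ⟨B, hB⟩ := hcube.exists_bound_of_continuousOn (MvPolynomial.continuous_eval Q).continuousOn
    exact ⟨max B 0, le_max_right _ _, fun y hy => (hB y hy).trans (le_max_left _ _)⟩
  choose B hB0 hB using hbd
  let K : ℝ := ∑ i, (B (b i) + ∑ j, B (MvPolynomial.pderiv j (b i : MvPolynomial (Fin n) ℝ)))
  -- Values and first derivatives are handled at once: `D` will be the identity or a partial
  -- derivative, and `K` sums the bounds of the basis polynomials and of their derivatives.
  have key : ∀ (D : MvPolynomial (Fin n) ℝ →ₗ[ℝ] MvPolynomial (Fin n) ℝ),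
      (∀ i, B (D (b i)) ≤ B (b i) + ∑ j, B (MvPolynomial.pderiv j (b i : MvPolynomial (Fin n) ℝ))) →
      ∀ c y, (∀ i, |y i| ≤ 1) → (MvPolynomial.eval y (D (Φ c))) ^ 2 ≤ ((K + 1) ^ 2 / δ) * ψ c := by
    intro D hD c y hy
    have h1 : |MvPolynomial.eval y (D (Φ c))| ≤ ‖c‖ * K := by
      simp only [hΦ, map_sum, map_smul, MvPolynomial.smul_eval, K, Finset.mul_sum]
      refine (Finset.abs_sum_le_sum_abs _ _).trans (Finset.sum_le_sum fun i _ => ?_)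
      rw [abs_mul]
      exact mul_le_mul (norm_le_pi_norm c i) ((hB _ y hy).trans (hD i)) (abs_nonneg _)
        (norm_nonneg _)
    have hK : 0 ≤ K := Finset.sum_nonneg fun i _ =>
      add_nonneg (hB0 _) (Finset.sum_nonneg fun j _ => hB0 _)
    calc (MvPolynomial.eval y (D (Φ c))) ^ 2 = |MvPolynomial.eval y (D (Φ c))| ^ 2 := (sq_abs _).symm
      _ ≤ (‖c‖ * K) ^ 2 := by gcongr
      _ = K ^ 2 * ‖c‖ ^ 2 := by ring
      _ ≤ (K + 1) ^ 2 * (ψ c / δ) := by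
          have : ‖c‖ ^ 2 ≤ ψ c / δ := by rw [le_div_iff₀ hδ]; linarith [hδψ c]
          gcongr; linarith
      _ = _ := by ring
  -- `K` may vanish; adding one keeps the constant positive.
  refine ⟨(K + 1) ^ 2 / δ, ?_, ?_⟩
  · have hK : 0 ≤ K := Finset.sum_nonneg fun i _ =>
      add_nonneg (hB0 _) (Finset.sum_nonneg fun j _ => hB0 _)
    positivity
  · intro P hP y hy
    obtain ⟨c, rfl⟩ : ∃ c, Φ c = P := by
      refine ⟨b.equivFun ⟨P, (MvPolynomial.mem_restrictTotalDegree _ _ _).2 hP⟩, ?_⟩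
      simp [Φ]
    refine ⟨key LinearMap.id (fun i => ?_) c y hy, fun j => key (MvPolynomial.pderiv j).toLinearMap
      (fun i => ?_) c y hy⟩
    · exact le_add_of_nonneg_right (Finset.sum_nonneg fun j _ => hB0 _)
    · refine le_add_of_nonneg_of_le (hB0 _) ?_
      exact Finset.single_le_sum
        (f := fun j => B (MvPolynomial.pderiv j (b i : MvPolynomial (Fin n) ℝ)))
        (fun j _ => hB0 _) (Finset.mem_univ j)

/-! ### The divergence theorem on the reference simplex -/

theorem cons_mem_refSimplex {n : ℕ} {t : ℝ} {y : Fin n → ℝ} :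
    (Fin.cons t y : Fin (n + 1) → ℝ) ∈ refSimplex (n + 1) ↔
      y ∈ refSimplex n ∧ t ∈ Icc 0 (1 - ∑ i, y i) := by
  simp only [refSimplex, Set.mem_ofPred_eq, Fin.forall_fin_succ, Fin.cons_zero, Fin.cons_succ,
    Fin.sum_univ_succ, mem_Icc]
  constructor
  · rintro ⟨⟨h1, h2⟩, h3⟩
    exact ⟨⟨h2, by linarith⟩, h1, by linarith⟩
  · rintro ⟨⟨h2, h3⟩, h1, h4⟩
    exact ⟨⟨h1, h2⟩, by linarith⟩

/-- Fubini with the first coordinate innermost: the fibre over `y` is the interval from zero to `1 -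
∑ i, y i`, and it is empty unless `y` lies in the lower-dimensional reference simplex. -/
theorem setIntegral_refSimplex_succ {n : ℕ} {h : (Fin (n + 1) → ℝ) → ℝ} (hh : Continuous h) :
    ∫ y in refSimplex (n + 1), h y =
      ∫ y in refSimplex n, ∫ t in (0 : ℝ)..(1 - ∑ i, y i), h (Fin.cons t y) := by
  have hmp := (volume_preserving_piFinSuccAbove (fun _ : Fin (n + 1) => ℝ) 0).symm
  have hi : Integrable ((refSimplex (n + 1)).indicator h) :=
    (integrable_indicator_iff (measurableSet_refSimplex _)).2
      (hh.continuousOn.integrableOn_compact (isCompact_refSimplex _))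
  rw [← integral_indicator (measurableSet_refSimplex _),
    ← integral_indicator (measurableSet_refSimplex _)]
  rw [← hmp.integral_comp' (g := (refSimplex (n + 1)).indicator h)]
  have hi' : Integrable (fun z => (refSimplex (n + 1)).indicator h
      ((MeasurableEquiv.piFinSuccAbove (fun _ : Fin (n + 1) => ℝ) 0).symm z))
      ((volume : Measure ℝ).prod (volume : Measure (Fin n → ℝ))) :=
    (hmp.integrable_comp_emb (MeasurableEquiv.measurableEmbedding _)).2 hi
  rw [Measure.volume_eq_prod] at *
  rw [integral_prod_symm _ hi']
  congr 1; funext y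
  have hval : ∀ t : ℝ, (MeasurableEquiv.piFinSuccAbove (fun _ : Fin (n + 1) => ℝ) 0).symm (t, y) =
      (Fin.cons t y : Fin (n + 1) → ℝ) := fun t => by
    simp [MeasurableEquiv.piFinSuccAbove, Fin.insertNthEquiv]
  simp only [hval]
  by_cases hy : y ∈ refSimplex n
  · rw [indicator_of_mem hy, intervalIntegral.integral_of_le (sub_nonneg.2 hy.2),
      ← integral_Icc_eq_integral_Ioc, ← integral_indicator measurableSet_Icc]
    congr 1; funext t
    by_cases ht : t ∈ Icc 0 (1 - ∑ i, y i)
    · rw [indicator_of_mem ht, indicator_of_mem (cons_mem_refSimplex.2 ⟨hy, ht⟩)]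
    · rw [indicator_of_notMem ht, indicator_of_notMem fun h' => ht (cons_mem_refSimplex.1 h').2]
  · rw [indicator_of_notMem hy]
    have : ∀ t : ℝ, (refSimplex (n + 1)).indicator h (Fin.cons t y) = 0 := fun t =>
      indicator_of_notMem (fun h' => hy (cons_mem_refSimplex.1 h').1) _
    simp [this]

theorem hasDerivAt_cons {n : ℕ} (y : Fin n → ℝ) (t : ℝ) :
    HasDerivAt (fun s : ℝ => (Fin.cons s y : Fin (n + 1) → ℝ)) (Pi.single 0 1) t := by
  rw [hasDerivAt_pi]
  intro i
  refine Fin.cases ?_ (fun i => ?_) i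
  · simpa using hasDerivAt_id' t
  · simpa using hasDerivAt_const t (y i)

/-- The fundamental theorem of calculus on each fibre in the first direction. The lower endpoint
lies on the facet where `g` vanishes, the upper one on the facet opposite to the origin. -/
theorem integral_fderiv_refSimplex_zero {n : ℕ} {g : (Fin (n + 1) → ℝ) → ℝ} (hg : ContDiff ℝ 1 g)
    (h0 : ∀ y ∈ refSimplex (n + 1), y 0 = 0 → g y = 0) :
    ∫ y in refSimplex (n + 1), fderiv ℝ g y (Pi.single 0 1) =
      ∫ y in refSimplex n, g (Fin.cons (1 - ∑ i, y i) y) := by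
  have hc : Continuous fun y => fderiv ℝ g y (Pi.single 0 1) :=
    (hg.continuous_fderiv one_ne_zero).clm_apply continuous_const
  rw [setIntegral_refSimplex_succ hc]
  refine setIntegral_congr_fun (measurableSet_refSimplex n) fun y hy => ?_
  have hcons : Continuous fun s : ℝ => (Fin.cons s y : Fin (n + 1) → ℝ) :=
    continuous_iff_continuousAt.2 fun t => (hasDerivAt_cons y t).continuousAt
  have hd : ∀ t : ℝ, HasDerivAt (fun s : ℝ => g (Fin.cons s y))
      (fderiv ℝ g (Fin.cons t y) (Pi.single 0 1)) t := fun t =>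
    ((hg.differentiable one_ne_zero _).hasFDerivAt).comp_hasDerivAt t (hasDerivAt_cons y t)
  have := intervalIntegral.integral_eq_sub_of_hasDerivAt (a := 0) (b := 1 - ∑ i, y i)
    (fun t _ => hd t) ((hc.comp hcons).intervalIntegrable _ _)
  refine this.trans ?_
  rw [h0 (Fin.cons 0 y) (cons_mem_refSimplex.2 ⟨hy, le_refl _, sub_nonneg.2 hy.2⟩) rfl, sub_zero]

/-- Exchange of the coordinate `i` with the barycentric coordinate of the origin. -/
def refFlip {n : ℕ} (i : Fin n) (y : Fin n → ℝ) : Fin n → ℝ := Function.update y i (1 - ∑ j, y j)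

theorem sum_refFlip {n : ℕ} (i : Fin n) (y : Fin n → ℝ) : ∑ j, refFlip i y j = 1 - y i := by
  have h := Finset.sum_update_of_mem (Finset.mem_univ i) y (1 - ∑ j, y j)
  rw [refFlip, h]
  have := Finset.sum_sdiff (Finset.subset_univ {i}) (f := y)
  simp only [Finset.sum_singleton] at this
  linarith

theorem refFlip_refFlip {n : ℕ} (i : Fin n) (y : Fin n → ℝ) : refFlip i (refFlip i y) = y := by
  conv_lhs => rw [refFlip, sum_refFlip]
  rw [refFlip, Function.update_idem, sub_sub_cancel, Function.update_eq_self]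

theorem refFlip_mem {n : ℕ} (i : Fin n) {y : Fin n → ℝ} (hy : y ∈ refSimplex n) :
    refFlip i y ∈ refSimplex n := by
  refine ⟨fun j => ?_, ?_⟩
  · rcases eq_or_ne j i with rfl | hj
    · simpa [refFlip] using hy.2
    · simpa [refFlip, hj] using hy.1 j
  · rw [sum_refFlip]; linarith [hy.1 i]

/-- The exchange of two vertices is an affine involution of the simplex. Its linear part is a rank
one perturbation of the identity, and the matrix determinant lemma gives determinant -1. -/
theorem integral_comp_refFlip {n : ℕ} (i : Fin n) (h : (Fin n → ℝ) → ℝ) :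
    ∫ y in refSimplex n, h (refFlip i y) = ∫ y in refSimplex n, h y := by
  let A : Matrix (Fin n) (Fin n) ℝ := 1 + Matrix.replicateCol Unit (Pi.single i (1 : ℝ)) *
    Matrix.replicateRow Unit (fun j => -1 - Pi.single (M := fun _ => ℝ) i 1 j)
  let L : (Fin n → ℝ) →L[ℝ] (Fin n → ℝ) := LinearMap.toContinuousLinearMap (Matrix.toLin' A)
  have hA : A.det = -1 := by
    rw [Matrix.det_one_add_replicateCol_mul_replicateRow]
    simp [dotProduct, Pi.single_apply]
  have hL : L.det = -1 := by
    rw [ContinuousLinearMap.det]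
    simp [L, hA]
  have hf : ∀ y, refFlip i y = L y + Pi.single i 1 := fun y => by
    funext k
    simp only [L, A, LinearMap.coe_toContinuousLinearMap', Matrix.toLin'_apply, Matrix.add_mulVec,
      Matrix.one_mulVec, ← Matrix.mulVec_mulVec, Pi.add_apply, refFlip]
    have hs : (Matrix.replicateRow Unit fun j => -1 - Pi.single (M := fun _ => ℝ) i 1 j).mulVec y =
        fun _ => -(∑ j, y j) - y i := by
      funext u
      simp [Matrix.mulVec, dotProduct, sub_mul, Finset.sum_sub_distrib, Pi.single_apply]
    rw [hs]
    rcases eq_or_ne k i with rfl | hk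
    · simp [Matrix.mulVec, dotProduct]; ring
    · simp [Matrix.mulVec, dotProduct, hk]
  have hd : ∀ y ∈ refSimplex n, HasFDerivWithinAt (refFlip i) L (refSimplex n) y := fun y _ => by
    have h1 : refFlip i = fun y => L y + Pi.single i 1 := funext hf
    rw [h1]
    exact (L.hasFDerivAt.add_const _).hasFDerivWithinAt
  have hinj : InjOn (refFlip i) (refSimplex n) := fun x _ y _ hxy => by
    rw [← refFlip_refFlip i x, hxy, refFlip_refFlip]
  have him : refFlip i '' refSimplex n = refSimplex n := by
    ext y; constructor
    · rintro ⟨x, hx, rfl⟩; exact refFlip_mem i hx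
    · intro hy; exact ⟨_, refFlip_mem i hy, refFlip_refFlip i y⟩
  have := integral_image_eq_integral_abs_det_fderiv_smul volume (measurableSet_refSimplex n) hd
    hinj h
  rw [him] at this
  simp only [hL, abs_neg, abs_one, one_smul] at this
  exact this.symm

theorem integral_comp_perm_refSimplex {n : ℕ} (σ : Equiv.Perm (Fin n)) (h : (Fin n → ℝ) → ℝ) :
    ∫ y in refSimplex n, h (fun i => y (σ i)) = ∫ y in refSimplex n, h y := by
  have hmp := volume_measurePreserving_piCongrLeft (fun _ : Fin n => ℝ) σ.symm
  have hval : ∀ y : Fin n → ℝ, (MeasurableEquiv.piCongrLeft (fun _ : Fin n => ℝ) σ.symm) y =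
      fun i => y (σ i) := fun y => by
    funext i
    simp [MeasurableEquiv.piCongrLeft, Equiv.piCongrLeft]
  have := hmp.setIntegral_preimage_emb (MeasurableEquiv.measurableEmbedding _) h (refSimplex n)
  simp only [hval] at this
  rw [← this]
  congr 2
  ext y
  simp only [mem_preimage, hval, refSimplex, Set.mem_ofPred_eq]
  rw [Equiv.sum_comp σ y, σ.forall_congr_left (p := fun i => 0 ≤ y (σ i))]
  simp

/-- The divergence theorem on the reference simplex for functions which vanish on all facets but
the one opposite to the origin. -/
theorem integral_fderiv_refSimplex {n : ℕ} {g : (Fin (n + 1) → ℝ) → ℝ} (hg : ContDiff ℝ 1 g)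
    (h0 : ∀ y ∈ refSimplex (n + 1), ∀ i, y i = 0 → g y = 0) (j : Fin (n + 1)) :
    ∫ y in refSimplex (n + 1), fderiv ℝ g y (Pi.single j 1) =
      ∫ y in refSimplex n, g (Fin.cons (1 - ∑ i, y i) y) := by
  refine Fin.cases (integral_fderiv_refSimplex_zero hg fun y hy => h0 y hy 0) (fun i => ?_) j
  -- Swapping coordinates reduces the direction `i.succ` to the direction `0` already treated.
  let σ : Equiv.Perm (Fin (n + 1)) := Equiv.swap 0 i.succ
  let S : (Fin (n + 1) → ℝ) →L[ℝ] (Fin (n + 1) → ℝ) :=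
    ContinuousLinearMap.pi fun k => ContinuousLinearMap.proj (σ k)
  have hS : ∀ y, S y = fun k => y (σ k) := fun y => rfl
  have hgS : ContDiff ℝ 1 fun y => g (S y) := hg.comp S.contDiff
  have hder : ∀ y, fderiv ℝ (fun y => g (S y)) y (Pi.single 0 1) =
      fderiv ℝ g (S y) (Pi.single i.succ 1) := fun y => by
    have h1 : HasFDerivAt (fun y => g (S y)) ((fderiv ℝ g (S y)).comp S) y :=
      ((hg.differentiable one_ne_zero (S y)).hasFDerivAt).comp y S.hasFDerivAt
    rw [h1.fderiv, ContinuousLinearMap.comp_apply]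
    congr 1
    rw [hS]; funext k
    simp only [Pi.single_apply]
    congr 1
    rw [eq_iff_iff, ← Equiv.eq_symm_apply]
    simp [σ]
  have hmem : ∀ y ∈ refSimplex (n + 1), S y ∈ refSimplex (n + 1) := fun y hy => by
    refine ⟨fun k => hy.1 _, ?_⟩
    simp only [hS]
    rw [Equiv.sum_comp σ y]; exact hy.2
  have h1 := integral_fderiv_refSimplex_zero hgS fun y hy hy0 =>
    h0 (S y) (hmem y hy) i.succ (by simp [hS, σ, hy0])
  simp only [hder] at h1
  have h2 := integral_comp_perm_refSimplex σ fun y => fderiv ℝ g y (Pi.single i.succ 1)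
  rw [← h2]
  refine h1.trans ?_
  -- The swap also moves the facet opposite to the origin within itself. In terms of the free
  -- parameters this motion is `refFlip i`, which preserves the integral.
  rw [← integral_comp_refFlip i]
  refine setIntegral_congr_fun (measurableSet_refSimplex n) fun y _ => ?_
  simp only [hS]
  congr 1
  funext k
  rw [sum_refFlip, sub_sub_cancel]
  rcases eq_or_ne k 0 with rfl | hk
  · simp [σ, refFlip]
  · obtain ⟨k, rfl⟩ := Fin.exists_succ_eq.2 hk
    rcases eq_or_ne k i with rfl | hki
    · simp [σ, refFlip]
    · have : σ k.succ = k.succ := Equiv.swap_apply_of_ne_of_ne (Fin.succ_ne_zero k)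
        (fun h => hki (Fin.succ_injective _ h))
      rw [this]
      simp [refFlip, hki]

/-! ### Simplices in coordinates -/

/-- The simplex `s` has the facet `F`, with vertices `f`, and the opposite vertex `a`; the map
`y ↦ a + M y` takes the reference simplex to `s` and the origin to `a`. -/
structure IsFrame {n : ℕ} (s F : Finset (Pt (n + 1))) (a : Pt (n + 1))
    (f : Fin (n + 1) → Pt (n + 1)) (M : (Fin (n + 1) → ℝ) ≃L[ℝ] Pt (n + 1)) : Prop where
  eq_insert : (s : Set (Pt (n + 1))) = insert a (F : Set (Pt (n + 1)))
  range_eq : (F : Set (Pt (n + 1))) = range f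
  notMem : a ∉ F
  injective : Function.Injective f
  map_single : ∀ j, M (Pi.single j 1) = f j - a

/-- The enumeration of the facet is prescribed, so that two simplices with a common facet can be
given the same parametrization of it. -/
theorem exists_isFrame_of_enum {n : ℕ} {s F : Finset (Pt (n + 1))}
    (hs : AffineIndependent ℝ (fun v : s => (v : Pt (n + 1)))) (hF : F ∈ facets s)
    {f : Fin (n + 1) → Pt (n + 1)} (hinj : Function.Injective f)
    (hf : (F : Set (Pt (n + 1))) = range f) : ∃ a M, IsFrame s F a f M := by
  classical
  obtain ⟨a, ha, hFa⟩ := Finset.mem_image.1 hF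
  replace hFa : s.erase a = F := by rw [← hFa]
  have hfs : ∀ j, f j ∈ s ∧ f j ≠ a := fun j => by
    have : f j ∈ (F : Set (Pt (n + 1))) := by rw [hf]; exact mem_range_self j
    rw [← hFa, Finset.mem_coe, Finset.mem_erase] at this; exact this.symm
  have hli := (affineIndependent_iff_linearIndependent_vsub ℝ _ (⟨a, ha⟩ : s)).1 hs
  let g : Fin (n + 1) → {x : s // x ≠ ⟨a, ha⟩} := fun j =>
    ⟨⟨f j, (hfs j).1⟩, fun h => (hfs j).2 (congrArg Subtype.val h)⟩
  have hg : Function.Injective g := fun i j h => hinj (by simpa [g] using h)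
  have hli' : LinearIndependent ℝ fun j => f j - a := hli.comp g hg
  let b := basisOfLinearIndependentOfCardEqFinrank hli' (by simp)
  refine ⟨a, b.equivFun.symm.toContinuousLinearEquiv, ?_, hf, ?_, hinj, ?_⟩
  · rw [← hFa, ← Finset.coe_insert, Finset.insert_erase ha]
  · rw [← hFa]; simp
  · intro j
    have : b.equivFun.symm (Pi.single j 1) = b j := by
      rw [LinearEquiv.symm_apply_eq]
      ext i
      simp [Pi.single_apply, eq_comm]
    simp [b]

theorem exists_isFrame {n : ℕ} {s F : Finset (Pt (n + 1))} (hcard : s.card = n + 2)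
    (hs : AffineIndependent ℝ (fun v : s => (v : Pt (n + 1)))) (hF : F ∈ facets s) :
    ∃ a f M, IsFrame s F a f M := by
  classical
  have hc : F.card = n + 1 := by
    obtain ⟨a, ha, hFa⟩ := Finset.mem_image.1 hF
    replace hFa : s.erase a = F := by rw [← hFa]
    rw [← hFa, Finset.card_erase_of_mem ha, hcard]; rfl
  let e := F.equivFinOfCardEq hc
  let f : Fin (n + 1) → Pt (n + 1) := fun j => (e.symm j : Pt (n + 1))
  have hf : (F : Set (Pt (n + 1))) = range f := by
    ext x; constructor
    · intro hx; exact ⟨e ⟨x, hx⟩, by simp [f]⟩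
    · rintro ⟨j, rfl⟩; exact (e.symm j).2
  obtain ⟨a, M, h⟩ := exists_isFrame_of_enum hs hF
    (fun i j h => e.symm.injective (Subtype.ext h)) hf
  exact ⟨a, f, M, h⟩

/-- The parametrization of the facet with vertices `f` over the reference simplex. -/
def facetPt {n : ℕ} (f : Fin (n + 1) → Pt (n + 1)) (y : Fin n → ℝ) : Pt (n + 1) :=
  (1 - ∑ i, y i) • f 0 + ∑ i, y i • f i.succ

namespace IsFrame

variable {n : ℕ} {s F : Finset (Pt (n + 1))} {a : Pt (n + 1)} {f : Fin (n + 1) → Pt (n + 1)}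
  {M : (Fin (n + 1) → ℝ) ≃L[ℝ] Pt (n + 1)}

theorem map_eq (h : IsFrame s F a f M) (y : Fin (n + 1) → ℝ) : M y = ∑ j, y j • (f j - a) := by
  conv_lhs => rw [pi_eq_sum_univ' y]
  simp only [map_sum, map_smul, ← h.map_single]

theorem add_map_eq (h : IsFrame s F a f M) (y : Fin (n + 1) → ℝ) :
    a + M y = (1 - ∑ j, y j) • a + ∑ j, y j • f j := by
  rw [h.map_eq]
  simp only [smul_sub, Finset.sum_sub_distrib, ← Finset.sum_smul, sub_smul, one_smul]
  abel

theorem symm_vertex (h : IsFrame s F a f M) (j : Fin (n + 1)) :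
    M.symm (f j - a) = Pi.single j 1 := by
  rw [← h.map_single]; simp

theorem apex_mem (h : IsFrame s F a f M) : a ∈ s := by
  have : a ∈ (s : Set (Pt (n + 1))) := by rw [h.eq_insert]; exact mem_insert _ _
  exact this

theorem vertex_mem_facet (h : IsFrame s F a f M) (j : Fin (n + 1)) : f j ∈ F := by
  have : f j ∈ (F : Set (Pt (n + 1))) := by rw [h.range_eq]; exact mem_range_self _
  exact this

theorem facet_subset (h : IsFrame s F a f M) : F ⊆ s := fun x hx => by
  have : x ∈ (s : Set (Pt (n + 1))) := by rw [h.eq_insert]; exact mem_insert_of_mem _ hx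
  exact this

theorem vertex_mem (h : IsFrame s F a f M) (j : Fin (n + 1)) : f j ∈ s :=
  h.facet_subset (h.vertex_mem_facet j)

theorem mem_iff (h : IsFrame s F a f M) {x : Pt (n + 1)} : x ∈ s ↔ x = a ∨ ∃ j, f j = x := by
  rw [← Finset.mem_coe, h.eq_insert, h.range_eq]; rfl

theorem hull_eq (h : IsFrame s F a f M) : hull s = (fun y => a + M y) '' refSimplex (n + 1) := by
  apply Subset.antisymm
  · refine convexHull_min ?_ ?_
    · intro x hx
      rcases h.mem_iff.1 hx with rfl | ⟨j, rfl⟩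
      · exact ⟨0, by simp [refSimplex], by simp⟩
      · refine ⟨Pi.single j 1, ⟨fun i => ?_, by simp⟩, by simp [h.map_single]⟩
        rw [Pi.single_apply]; split_ifs <;> norm_num
    · have hc : Convex ℝ (refSimplex (n + 1)) := by
        intro y hy z hz α β hα hβ hαβ
        refine ⟨fun i => ?_, ?_⟩
        · have := mul_nonneg hα (hy.1 i); have := mul_nonneg hβ (hz.1 i)
          simp only [Pi.add_apply, Pi.smul_apply, smul_eq_mul]; linarith
        · simp only [Pi.add_apply, Pi.smul_apply, smul_eq_mul, Finset.sum_add_distrib,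
            ← Finset.mul_sum]
          nlinarith [mul_le_mul_of_nonneg_left hy.2 hα, mul_le_mul_of_nonneg_left hz.2 hβ]
      have := (hc.linear_image (M : (Fin (n + 1) → ℝ) →L[ℝ] Pt (n + 1)).toLinearMap).translate a
      rwa [image_image] at this
  · rintro _ ⟨y, hy, rfl⟩
    simp only [h.add_map_eq]
    have := (convex_convexHull ℝ (s : Set (Pt (n + 1)))).sum_mem (t := Finset.univ)
      (w := (Fin.cons (1 - ∑ j, y j) y : Fin (n + 2) → ℝ)) (z := (Fin.cons a f : Fin (n + 2) → _))
      ?_ ?_ ?_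
    · simpa [Fin.sum_univ_succ, hull] using this
    · intro i _; refine Fin.cases ?_ (fun i => ?_) i
      · simpa using hy.2
      · simpa using hy.1 i
    · simp [Fin.sum_univ_succ]
    · intro i _; refine Fin.cases ?_ (fun i => ?_) i
      · exact subset_convexHull _ _ h.apex_mem
      · exact subset_convexHull _ _ (h.vertex_mem i)

theorem mem_hull (h : IsFrame s F a f M) {x : Pt (n + 1)} :
    x ∈ hull s ↔ M.symm (x - a) ∈ refSimplex (n + 1) := by
  rw [h.hull_eq]; constructor
  · rintro ⟨y, hy, rfl⟩; simpa using hy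
  · intro hx; exact ⟨_, hx, by simp⟩

theorem facetPt_eq (h : IsFrame s F a f M) (y : Fin n → ℝ) :
    facetPt f y = a + M (Fin.cons (1 - ∑ i, y i) y) := by
  rw [h.add_map_eq, facetPt]; simp [Fin.sum_univ_succ]

theorem symm_facetPt (h : IsFrame s F a f M) (y : Fin n → ℝ) :
    M.symm (facetPt f y - a) = Fin.cons (1 - ∑ i, y i) y := by
  rw [h.facetPt_eq]; simp

theorem sum_symm_facet (h : IsFrame s F a f M) {x : Pt (n + 1)} (hx : x ∈ hull F) :
    ∑ j, M.symm (x - a) j = 1 := by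
  have : hull F ⊆ {x | ∑ j, M.symm (x - a) j = 1} := by
    refine convexHull_min ?_ ?_
    · rw [h.range_eq]; rintro _ ⟨j, rfl⟩
      rw [Set.mem_ofPred_eq, h.symm_vertex]; simp
    · intro x hx y hy α β _ _ hαβ
      simp only [Set.mem_ofPred_eq, map_sub, map_add, map_smul, Pi.sub_apply, Pi.add_apply,
        Pi.smul_apply, smul_eq_mul, Finset.sum_sub_distrib, Finset.sum_add_distrib,
        ← Finset.mul_sum] at hx hy ⊢
      have hb : β = 1 - α := by linarith
      subst hb
      linear_combination α * hx + (1 - α) * hy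
  exact this hx

theorem hull_facet_subset (h : IsFrame s F a f M) : hull F ⊆ hull s :=
  convexHull_mono (Finset.coe_subset.2 h.facet_subset)

theorem hull_facet_eq (h : IsFrame s F a f M) : hull F = facetPt f '' refSimplex n := by
  apply Subset.antisymm
  · intro x hx
    have h1 := h.sum_symm_facet hx
    have h2 := h.mem_hull.1 (h.hull_facet_subset hx)
    refine ⟨Fin.tail (M.symm (x - a)), ⟨fun i => h2.1 _, ?_⟩, ?_⟩
    · rw [Fin.sum_univ_succ] at h1
      have := h2.1 0
      simp only [Fin.tail]; linarith
    · rw [h.facetPt_eq]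
      have : (Fin.cons (1 - ∑ i, Fin.tail (M.symm (x - a)) i) (Fin.tail (M.symm (x - a))) :
          Fin (n + 1) → ℝ) = M.symm (x - a) := by
        conv_rhs => rw [← Fin.cons_self_tail (M.symm (x - a))]
        congr 1
        rw [Fin.sum_univ_succ] at h1
        simp only [Fin.tail]; linarith
      rw [this]; simp
  · rintro _ ⟨y, hy, rfl⟩
    rw [facetPt]
    have := (convex_convexHull ℝ (F : Set (Pt (n + 1)))).sum_mem (t := Finset.univ)
      (w := (Fin.cons (1 - ∑ j, y j) y : Fin (n + 1) → ℝ)) (z := f) ?_ ?_ ?_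
    · simpa [Fin.sum_univ_succ, hull] using this
    · intro i _; refine Fin.cases ?_ (fun i => ?_) i
      · simpa using hy.2
      · simpa using hy.1 i
    · simp [Fin.sum_univ_succ]
    · intro i _
      exact subset_convexHull _ _ (h.vertex_mem_facet i)

/-- A point in the hull of some vertices has no component along the remaining vertices. -/
theorem symm_eq_zero (h : IsFrame s F a f M) {V : Set (Pt (n + 1))} (hV : V ⊆ s)
    {j : Fin (n + 1)} (hj : f j ∉ V) {x : Pt (n + 1)} (hx : x ∈ convexHull ℝ V) :
    M.symm (x - a) j = 0 := by
  have : convexHull ℝ V ⊆ {x | M.symm (x - a) j = 0} := by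
    refine convexHull_min ?_ ?_
    · intro x hx
      rcases h.mem_iff.1 (hV hx) with rfl | ⟨i, rfl⟩
      · simp
      · have : i ≠ j := by rintro rfl; exact hj hx
        rw [Set.mem_ofPred_eq, h.symm_vertex]; simp [this.symm]
    · intro x hx y hy α β _ _ hαβ
      simp only [Set.mem_ofPred_eq, map_sub, map_add, map_smul, Pi.sub_apply, Pi.add_apply,
        Pi.smul_apply, smul_eq_mul] at hx hy ⊢
      have hb : β = 1 - α := by linarith
      subst hb
      linear_combination α * hx + (1 - α) * hy
  exact this hx

theorem isClosed_hull (s : Finset (Pt (n + 1))) : IsClosed (hull s) :=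
  (s.finite_toSet.isCompact_convexHull ℝ).isClosed

theorem isCompact_hull (s : Finset (Pt (n + 1))) : IsCompact (hull s) :=
  s.finite_toSet.isCompact_convexHull ℝ

theorem continuous_coord (M : (Fin (n + 1) → ℝ) ≃L[ℝ] Pt (n + 1)) (a : Pt (n + 1)) :
    Continuous fun x => M.symm (x - a) :=
  M.symm.continuous.comp (continuous_id.sub continuous_const)

theorem mem_interior_hull (h : IsFrame s F a f M) {x : Pt (n + 1)}
    (h1 : ∀ j, 0 < M.symm (x - a) j) (h2 : ∑ j, M.symm (x - a) j < 1) : x ∈ interior (hull s) := by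
  have hc := continuous_coord M a
  have ho : IsOpen ((⋂ j, {x | 0 < M.symm (x - a) j}) ∩ {x | ∑ j, M.symm (x - a) j < 1}) := by
    refine (isOpen_iInter_of_finite fun j => ?_).inter ?_
    · exact isOpen_lt continuous_const ((continuous_apply j).comp hc)
    · exact isOpen_lt (continuous_finsetSum _ fun j _ => (continuous_apply j).comp hc)
        continuous_const
  refine interior_maximal ?_ ho ⟨mem_iInter.2 h1, h2⟩
  rintro y ⟨hy1, hy2⟩
  exact h.mem_hull.2 ⟨fun i => (mem_iInter.1 hy1 i).le, hy2.le⟩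

theorem interior_hull_nonempty (h : IsFrame s F a f M) : (interior (hull s)).Nonempty := by
  have hb := openBox_subset (n + 1) (y := fun _ => 1 / (((n + 1 : ℕ) : ℝ) + 1) / 2)
    (fun i => ⟨by positivity, half_lt_self (by positivity)⟩)
  refine ⟨a + M (fun _ => 1 / (((n + 1 : ℕ) : ℝ) + 1) / 2), h.mem_interior_hull ?_ ?_⟩
  · simpa using hb.1
  · simpa using hb.2

/-- This makes derivatives within the closed simplex unique, so that the one-sided derivatives in
the estimator can be read off from polynomials up to the boundary. -/
theorem uniqueDiffOn_hull (h : IsFrame s F a f M) : UniqueDiffOn ℝ (hull s) :=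
  uniqueDiffOn_convex (convex_convexHull ℝ _) h.interior_hull_nonempty

end IsFrame

/-- The absolute value of the determinant of `M`. -/
def jac {d : ℕ} (M : (Fin d → ℝ) ≃L[ℝ] Pt d) : ℝ :=
  |LinearMap.det (((EuclideanSpace.equiv (Fin d) ℝ).toLinearEquiv : Pt d →ₗ[ℝ] (Fin d → ℝ)) ∘ₗ
    (M.toLinearEquiv : (Fin d → ℝ) →ₗ[ℝ] Pt d))|

theorem jac_pos {d : ℕ} (M : (Fin d → ℝ) ≃L[ℝ] Pt d) : 0 < jac M := by
  rw [jac, abs_pos]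
  have := LinearEquiv.isUnit_det' (M.toLinearEquiv.trans (EuclideanSpace.equiv (Fin d) ℝ).toLinearEquiv)
  exact this.ne_zero

/-- Change of variables to an affine image. -/
theorem setIntegral_image_affine {d : ℕ} (M : (Fin d → ℝ) ≃L[ℝ] Pt d) (a : Pt d)
    {S : Set (Fin d → ℝ)} (hS : MeasurableSet S) (g : Pt d → ℝ) :
    ∫ x in (fun y => a + M y) '' S, g x = jac M * ∫ y in S, g (a + M y) := by
  let e := EuclideanSpace.equiv (Fin d) ℝ
  let L : (Fin d → ℝ) →L[ℝ] (Fin d → ℝ) := (e : Pt d →L[ℝ] (Fin d → ℝ)).comp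
    (M : (Fin d → ℝ) →L[ℝ] Pt d)
  have hd : ∀ y ∈ S, HasFDerivWithinAt (fun y => e (a + M y)) L S y := fun y _ => by
    have : (fun y => e (a + M y)) = fun y => e a + L y := by funext y; simp [L]
    rw [this]
    exact (L.hasFDerivAt.const_add _).hasFDerivWithinAt
  have hinj : InjOn (fun y => e (a + M y)) S := fun x _ y _ hxy => by simpa using hxy
  have h1 := integral_image_eq_integral_abs_det_fderiv_smul volume hS hd hinj
    (fun z => g (e.symm z))
  have hdet : |L.det| = jac M := rfl
  have hmp := PiLp.volume_preserving_toLp (Fin d)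
  have h2 := hmp.setIntegral_preimage_emb (MeasurableEquiv.toLp 2 (Fin d → ℝ)).measurableEmbedding g
    ((fun y => a + M y) '' S)
  rw [← h2]
  have h3 : WithLp.toLp 2 ⁻¹' ((fun y => a + M y) '' S) = (fun y => e (a + M y)) '' S := by
    ext z; constructor
    · rintro ⟨y, hy, hyz⟩
      exact ⟨y, hy, by simp only at hyz ⊢; rw [hyz]; rfl⟩
    · rintro ⟨y, hy, rfl⟩; exact ⟨y, hy, rfl⟩
  rw [h3]
  refine h1.trans ?_
  rw [← integral_const_mul]
  simp only [hdet, smul_eq_mul, ContinuousLinearEquiv.symm_apply_apply]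

/-! ### Integrals over simplices and facets -/

/-- The integral over the facet with vertices `f`, with respect to the parameters. -/
def facetInt {n : ℕ} (f : Fin (n + 1) → Pt (n + 1)) (g : Pt (n + 1) → ℝ) : ℝ :=
  ∫ y in refSimplex n, g (facetPt f y)

/-- The sum of the components of `M⁻¹ e`, which is minus the derivative in direction `e` of the
barycentric coordinate of the vertex opposite to the facet. -/
def slope {d : ℕ} (M : (Fin d → ℝ) ≃L[ℝ] Pt d) (e : Pt d) : ℝ := ∑ j, M.symm e j

theorem slope_add {d : ℕ} (M : (Fin d → ℝ) ≃L[ℝ] Pt d) (e e' : Pt d) :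
    slope M (e + e') = slope M e + slope M e' := by
  simp [slope, Finset.sum_add_distrib]

theorem slope_sub {d : ℕ} (M : (Fin d → ℝ) ≃L[ℝ] Pt d) (e e' : Pt d) :
    slope M (e - e') = slope M e - slope M e' := by
  simp [slope, Finset.sum_sub_distrib]

theorem slope_smul {d : ℕ} (M : (Fin d → ℝ) ≃L[ℝ] Pt d) (r : ℝ) (e : Pt d) :
    slope M (r • e) = r * slope M e := by
  simp [slope, Finset.mul_sum]

namespace IsFrame

variable {n : ℕ} {s t F : Finset (Pt (n + 1))} {a a' : Pt (n + 1)}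
  {f : Fin (n + 1) → Pt (n + 1)} {M M' : (Fin (n + 1) → ℝ) ≃L[ℝ] Pt (n + 1)}

theorem setIntegral_hull (h : IsFrame s F a f M) (g : Pt (n + 1) → ℝ) :
    ∫ x in hull s, g x = jac M * ∫ y in refSimplex (n + 1), g (a + M y) := by
  rw [h.hull_eq]; exact setIntegral_image_affine M a (measurableSet_refSimplex _) g

/-- After the pullback, `e` is a combination of the edge vectors at `a`. Each edge derivative
integrates to the same facet integral, so only the sum of the coefficients of `e` remains. -/
theorem setIntegral_fderiv_hull (h : IsFrame s F a f M) {g : Pt (n + 1) → ℝ}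
    (hg : ContDiff ℝ 1 g)
    (h0 : ∀ x ∈ hull s, ∀ j, M.symm (x - a) j = 0 → g x = 0) (e : Pt (n + 1)) :
    ∫ x in hull s, fderiv ℝ g x e = slope M e * jac M * facetInt f g := by
  rw [h.setIntegral_hull]
  let G : (Fin (n + 1) → ℝ) → ℝ := fun y => g (a + M y)
  have hG : ContDiff ℝ 1 G := hg.comp (contDiff_const.add M.contDiff)
  have hG0 : ∀ y ∈ refSimplex (n + 1), ∀ i, y i = 0 → G y = 0 := fun y hy i hi =>
    h0 _ (h.mem_hull.2 (by simpa using hy)) i (by simpa using hi)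
  have hd : ∀ y, fderiv ℝ g (a + M y) e =
      ∑ j, M.symm e j * fderiv ℝ G y (Pi.single j 1) := fun y => by
    have h1 : HasFDerivAt G ((fderiv ℝ g (a + M y)).comp (M : (Fin (n + 1) → ℝ) →L[ℝ] Pt (n + 1)))
        y := ((hg.differentiable one_ne_zero _).hasFDerivAt).comp y (M.hasFDerivAt.const_add a)
    rw [h1.fderiv]
    have h2 : e = ∑ j, M.symm e j • M (Pi.single j 1) := by
      conv_lhs => rw [← M.apply_symm_apply e, pi_eq_sum_univ' (M.symm e)]
      simp
    conv_lhs => rw [h2]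
    simp
  have hc : ∀ j, IntegrableOn (fun y => M.symm e j * fderiv ℝ G y (Pi.single j 1))
      (refSimplex (n + 1)) := fun j =>
    (continuous_const.mul ((hG.continuous_fderiv one_ne_zero).clm_apply
      continuous_const)).continuousOn.integrableOn_compact (isCompact_refSimplex _)
  simp only [hd]
  rw [integral_finsetSum _ fun j _ => hc j]
  simp only [integral_const_mul, integral_fderiv_refSimplex hG hG0]
  rw [← Finset.sum_mul, slope, facetInt]
  simp only [h.facetPt_eq, G]
  ring

theorem slope_vertex (h : IsFrame s F a f M) (j : Fin (n + 1)) : slope M (f j - a) = 1 := by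
  simp [slope, h.symm_vertex]

theorem slope_facet (h : IsFrame s F a f M) (i j : Fin (n + 1)) : slope M (f i - f j) = 0 := by
  have : f i - f j = (f i - a) - (f j - a) := by abel
  rw [this, slope_sub, h.slope_vertex, h.slope_vertex, sub_self]

theorem sum_smul_vertex (h : IsFrame s F a f M) (e : Pt (n + 1)) :
    e = ∑ j, M.symm e j • (f j - a) := by
  conv_lhs => rw [← M.apply_symm_apply e, h.map_eq]

/-- The slopes of two simplices with a common facet are proportional. -/
theorem slope_eq_mul_slope (h : IsFrame s F a f M) (h' : IsFrame t F a' f M') (e : Pt (n + 1)) :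
    slope M e = slope M (f 0 - a') * slope M' e := by
  -- All vertices of the facet have the same slope as seen from `a'`, because `slope M` vanishes on
  -- directions along the facet.
  have h1 : ∀ j, slope M (f j - a') = slope M (f 0 - a') := fun j => by
    have : f j - a' = (f j - f 0) + (f 0 - a') := by abel
    rw [this, slope_add, h.slope_facet, zero_add]
  conv_lhs => rw [h'.sum_smul_vertex e]
  have : ∀ (S : Finset (Fin (n + 1))), slope M (∑ j ∈ S, M'.symm e j • (f j - a')) =
      ∑ j ∈ S, M'.symm e j * slope M (f j - a') := fun S => by
    classical
    induction S using Finset.induction_on with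
    | empty => simp [slope]
    | insert i S hi ih => rw [Finset.sum_insert hi, Finset.sum_insert hi, slope_add, slope_smul, ih]
  rw [this]
  simp only [h1]
  rw [← Finset.sum_mul, slope, slope, mul_comm]

theorem slope_apex_ne_zero (h : IsFrame s F a f M) (h' : IsFrame t F a' f M') :
    slope M (f 0 - a') ≠ 0 := fun h0 => by
  have := h.slope_eq_mul_slope h' (f 0 - a)
  rw [h.slope_vertex, h0, zero_mul] at this
  exact one_ne_zero this

/-- Both maps send the unit vectors to edges ending at the same facet vertices, so `M'` is `M`
composed with the identity minus a matrix whose columns all equal the coordinates `α` of `a' - a`.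
That matrix has rank at most one, and the determinant is `1 - ∑ j, α j`. -/
theorem jac_eq (h : IsFrame s F a f M) (h' : IsFrame t F a' f M') :
    jac M' = |slope M (f 0 - a')| * jac M := by
  let E : Pt (n + 1) →ₗ[ℝ] (Fin (n + 1) → ℝ) :=
    ((EuclideanSpace.equiv (Fin (n + 1)) ℝ).toLinearEquiv : Pt (n + 1) →ₗ[ℝ] (Fin (n + 1) → ℝ))
  let α : Fin (n + 1) → ℝ := M.symm (a' - a)
  let A : Matrix (Fin (n + 1)) (Fin (n + 1)) ℝ :=
    1 + Matrix.replicateCol Unit (-α) * Matrix.replicateRow Unit (fun _ => (1 : ℝ))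
  have hA : A.det = slope M (f 0 - a') := by
    rw [Matrix.det_one_add_replicateCol_mul_replicateRow]
    have : f 0 - a' = (f 0 - a) - (a' - a) := by abel
    rw [this, slope_sub, h.slope_vertex]
    have h1 : slope M (a' - a) = ∑ j, α j := rfl
    rw [h1]
    simp [dotProduct, sub_eq_add_neg]
  have hM : E ∘ₗ (M'.toLinearEquiv : (Fin (n + 1) → ℝ) →ₗ[ℝ] Pt (n + 1)) =
      (E ∘ₗ (M.toLinearEquiv : (Fin (n + 1) → ℝ) →ₗ[ℝ] Pt (n + 1))) ∘ₗ Matrix.toLin' A := by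
    refine LinearMap.pi_ext' fun j => LinearMap.ext_ring ?_
    simp only [LinearMap.comp_apply, LinearMap.single_apply]
    congr 1
    have h1 : Matrix.toLin' A (Pi.single j 1) = Pi.single j 1 - α := by
      rw [Matrix.toLin'_apply, Matrix.add_mulVec, Matrix.one_mulVec, ← Matrix.mulVec_mulVec]
      funext k
      simp [Matrix.mulVec, dotProduct, sub_eq_add_neg]
    rw [h1]
    change M' (Pi.single j 1) = M (Pi.single j 1 - α)
    rw [map_sub, h.map_single, h'.map_single]
    simp [α]
  rw [jac, jac]
  change |LinearMap.det (E ∘ₗ (M'.toLinearEquiv : (Fin (n + 1) → ℝ) →ₗ[ℝ] Pt (n + 1)))| = _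
  rw [hM, LinearMap.det_comp, LinearMap.det_toLin', hA, abs_mul, mul_comm]

/-! ### The outer normal -/

theorem slope_eq_zero_of_mem (h : IsFrame s F a f M) {e : Pt (n + 1)}
    (he : e ∈ vectorSpan ℝ (F : Set (Pt (n + 1)))) : slope M e = 0 := by
  let φ : Pt (n + 1) →ₗ[ℝ] ℝ :=
    { toFun := slope M, map_add' := slope_add M, map_smul' := fun r e => slope_smul M r e }
  have : vectorSpan ℝ (F : Set (Pt (n + 1))) ≤ LinearMap.ker φ := by
    refine Submodule.span_le.2 ?_
    rintro _ ⟨x, hx, y, hy, rfl⟩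
    rw [h.range_eq] at hx hy
    obtain ⟨i, rfl⟩ := hx
    obtain ⟨j, rfl⟩ := hy
    exact h.slope_facet i j
  exact this he

theorem barycenter_facet (h : IsFrame s F a f M) :
    barycenter F = ((n : ℝ) + 1)⁻¹ • ∑ j, f j := by
  classical
  have h1 : F = Finset.univ.image f := by
    apply Finset.coe_injective; rw [h.range_eq]; simp
  have hc : F.card = n + 1 := by rw [h1, Finset.card_image_of_injective _ h.injective]; simp
  rw [barycenter, hc, h1, Finset.sum_image fun i _ j _ hij => h.injective hij]
  push_cast; rfl

theorem card_facet (h : IsFrame s F a f M) : F.card = n + 1 := by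
  classical
  have h1 : F = Finset.univ.image f := by
    apply Finset.coe_injective; rw [h.range_eq]; simp
  rw [h1, Finset.card_image_of_injective _ h.injective]; simp

theorem barycenter_sub (h : IsFrame s F a f M) :
    barycenter F - barycenter s = ((n : ℝ) + 2)⁻¹ • (barycenter F - a) := by
  classical
  have h1 : s = insert a F := by
    apply Finset.coe_injective; rw [h.eq_insert, Finset.coe_insert]
  have hs : barycenter s = ((n : ℝ) + 2)⁻¹ • (a + ((n : ℝ) + 1) • barycenter F) := by
    rw [barycenter, barycenter, h1, Finset.card_insert_of_notMem h.notMem,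
      Finset.sum_insert h.notMem, h.card_facet, smul_smul]
    push_cast
    rw [mul_inv_cancel₀ (by positivity), one_smul, show (n : ℝ) + 1 + 1 = n + 2 by ring]
  rw [hs]
  match_scalars
  · field_simp
    ring
  · field_simp

/-- The inner product with the normal and `slope M` both vanish along the facet, hence are
proportional; the factor is the height of the apex. It is positive because the vector between the
barycenters has slope `1 / (n + 2)` and its product with its own orthogonal component is the squared
length of that component. -/
theorem exists_height (h : IsFrame s F a f M) : ∃ H : ℝ, 0 < H ∧
    H = inner ℝ (outerNormal s F) (f 0 - a) ∧ ‖outerNormal s F‖ = 1 ∧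
    ∀ e, inner ℝ (outerNormal s F) e = H * slope M e := by
  set W := vectorSpan ℝ (F : Set (Pt (n + 1))) with hW
  set N := outerDir s F with hN
  have hNW : ∀ v ∈ W, inner ℝ N v = 0 := fun v hv => by
    have : N ∈ Wᗮ := Submodule.starProjection_apply_mem _ _
    exact Submodule.inner_left_of_mem_orthogonal hv this
  have hdiff : ∀ i j, f i - f j ∈ W := fun i j =>
    vsub_mem_vectorSpan ℝ (h.vertex_mem_facet i) (h.vertex_mem_facet j)
  set h0 := inner ℝ N (f 0 - a) with hh0
  have hj : ∀ j, inner ℝ N (f j - a) = h0 := fun j => by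
    have : f j - a = (f j - f 0) + (f 0 - a) := by abel
    rw [this, inner_add_right, hNW _ (hdiff j 0), zero_add]
  have hall : ∀ e, inner ℝ N e = h0 * slope M e := fun e => by
    conv_lhs => rw [h.sum_smul_vertex e]
    rw [inner_sum]
    simp only [inner_smul_right, hj]
    rw [← Finset.sum_mul, slope, mul_comm]
  have hbF : slope M (barycenter F - a) = 1 := by
    have : barycenter F - a = ((n : ℝ) + 1)⁻¹ • ∑ j, (f j - a) := by
      rw [h.barycenter_facet, Finset.sum_sub_distrib, smul_sub]
      congr 1
      simp only [Finset.sum_const, Finset.card_univ, Fintype.card_fin]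
      rw [← Nat.cast_smul_eq_nsmul ℝ, smul_smul]
      push_cast
      rw [inv_mul_cancel₀ (by positivity), one_smul]
    have h2 : ∑ j, (f j - a) = M (fun _ => 1) := by rw [h.map_eq]; simp
    rw [this, slope_smul, h2, slope]
    simp
    field_simp
  set w := barycenter F - barycenter s with hw
  have hsw : slope M w = ((n : ℝ) + 2)⁻¹ := by
    rw [hw, h.barycenter_sub, slope_smul, hbF, mul_one]
  -- Otherwise the vector between the barycenters would be parallel to the facet and have slope
  -- zero.
  have hN0 : N ≠ 0 := fun hzero => by
    have h1 : w ∈ W := by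
      have h2 := Submodule.sub_starProjection_mem_orthogonal (K := Wᗮ) w
      have h3 : Wᗮ.starProjection w = 0 := hzero
      rw [h3, sub_zero, Submodule.orthogonal_orthogonal] at h2
      exact h2
    have := h.slope_eq_zero_of_mem h1
    rw [hsw] at this
    have : ((n : ℝ) + 2)⁻¹ ≠ 0 := by positivity
    contradiction
  have hNw : inner ℝ N w = ‖N‖ ^ 2 := by
    have h1 : inner ℝ (w - N) N = 0 :=
      Submodule.starProjection_inner_eq_zero (K := Wᗮ) w N (Submodule.starProjection_apply_mem _ _)
    rw [inner_sub_left, real_inner_self_eq_norm_sq] at h1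
    rw [real_inner_comm]; linarith
  have hNn : 0 < ‖N‖ := norm_pos_iff.2 hN0
  have hpos : 0 < h0 := by
    rw [hall, hsw] at hNw
    have h2 : 0 < h0 * ((n : ℝ) + 2)⁻¹ := by rw [hNw]; positivity
    exact pos_of_mul_pos_left h2 (by positivity)
  refine ⟨‖N‖⁻¹ * h0, by positivity, ?_, ?_, fun e => ?_⟩
  · rw [outerNormal, inner_smul_left]; rfl
  · rw [outerNormal, norm_smul, norm_inv, norm_norm, inv_mul_cancel₀ hNn.ne']
  · rw [outerNormal, inner_smul_left, ← hN, hall]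
    simp [mul_assoc]

/-- The height of the vertex `a` above the facet `F` of the simplex `s`. -/
def height (s F : Finset (Pt (n + 1))) (a : Pt (n + 1)) (f : Fin (n + 1) → Pt (n + 1)) : ℝ :=
  inner ℝ (outerNormal s F) (f 0 - a)

theorem height_pos (h : IsFrame s F a f M) : 0 < height s F a f := by
  obtain ⟨H, h1, h2, -⟩ := h.exists_height; rw [height, ← h2]; exact h1

theorem norm_outerNormal (h : IsFrame s F a f M) : ‖outerNormal s F‖ = 1 := by
  obtain ⟨H, h1, h2, h3, -⟩ := h.exists_height; exact h3

theorem inner_outerNormal (h : IsFrame s F a f M) (e : Pt (n + 1)) :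
    inner ℝ (outerNormal s F) e = height s F a f * slope M e := by
  obtain ⟨H, h1, h2, h3, h4⟩ := h.exists_height; rw [h4, height, ← h2]

theorem dist_vertex_le (s : Finset (Pt (n + 1))) {x y : Pt (n + 1)} (hx : x ∈ s) (hy : y ∈ s) :
    ‖x - y‖ ≤ Metric.diam (hull s) := by
  rw [← dist_eq_norm]
  exact Metric.dist_le_diam_of_mem (isCompact_hull s).isBounded (subset_convexHull _ _ hx)
    (subset_convexHull _ _ hy)

theorem height_le (h : IsFrame s F a f M) : height s F a f ≤ Metric.diam (hull s) := by
  refine (real_inner_le_norm _ _).trans ?_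
  rw [h.norm_outerNormal, one_mul]
  exact dist_vertex_le s (h.vertex_mem 0) h.apex_mem

/-- Both normals represent multiples of the same linear form; comparing lengths gives the ratio of
the heights, and the sign tells on which side of the facet the apices lie. A positive sign means the
same side, which a mesh excludes for distinct simplices. -/
theorem height_eq (h : IsFrame s F a f M) (h' : IsFrame t F a' f M') :
    height t F a' f = |slope M (f 0 - a')| * height s F a f ∧
    outerNormal s F = (SignType.sign (slope M (f 0 - a')) : ℝ) • outerNormal t F := by
  set γ := slope M (f 0 - a')
  have hγ : γ ≠ 0 := h.slope_apex_ne_zero h'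
  set Hs := height s F a f
  set Ht := height t F a' f
  have hs := h.height_pos
  have ht := h'.height_pos
  have h1 : Ht • outerNormal s F = (Hs * γ) • outerNormal t F := by
    refine ext_inner_right ℝ fun e => ?_
    rw [inner_smul_left, inner_smul_left, h.inner_outerNormal, h'.inner_outerNormal,
      h.slope_eq_mul_slope h']
    simp only [conj_trivial]
    ring
  have h2 : Ht = |γ| * Hs := by
    have := congrArg norm h1
    rw [norm_smul, norm_smul, h.norm_outerNormal, h'.norm_outerNormal, Real.norm_eq_abs,
      Real.norm_eq_abs, abs_mul, abs_of_pos hs, abs_of_pos ht] at this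
    linarith
  refine ⟨h2, ?_⟩
  have h3 : outerNormal s F = (Ht⁻¹ * (Hs * γ)) • outerNormal t F := by
    rw [mul_smul, ← h1, smul_smul, inv_mul_cancel₀ ht.ne', one_smul]
  rw [h3, h2]
  rcases lt_or_gt_of_ne hγ with hneg | hpos
  · rw [sign_neg hneg, abs_of_neg hneg]
    have : (-γ * Hs)⁻¹ * (Hs * γ) = -1 := by
      have : Hs ≠ 0 := hs.ne'
      field_simp
    rw [this]
    simp
  · rw [sign_pos hpos, abs_of_pos hpos]
    have : (γ * Hs)⁻¹ * (Hs * γ) = 1 := by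
      have : Hs ≠ 0 := hs.ne'
      field_simp
    rw [this]
    simp

/-- The density of the surface measure with respect to the parameters of a facet. -/
def facetJac (s F : Finset (Pt (n + 1))) (a : Pt (n + 1)) (f : Fin (n + 1) → Pt (n + 1))
    (M : (Fin (n + 1) → ℝ) ≃L[ℝ] Pt (n + 1)) : ℝ := jac M / height s F a f

theorem facetJac_pos (h : IsFrame s F a f M) : 0 < facetJac s F a f M :=
  div_pos (jac_pos M) h.height_pos

/-- Volume factor and height change by the same ratio, so the density belongs to the facet alone.
The facet terms from the two sides can therefore be added under one integral. -/
theorem facetJac_eq (h : IsFrame s F a f M) (h' : IsFrame t F a' f M') :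
    facetJac t F a' f M' = facetJac s F a f M := by
  rw [facetJac, facetJac, h.jac_eq h', (h.height_eq h').1]
  exact mul_div_mul_left _ _ (abs_ne_zero.2 (h.slope_apex_ne_zero h'))

/-- The divergence theorem on a simplex, for functions vanishing on all facets but one. -/
theorem divergence (h : IsFrame s F a f M) {g : Pt (n + 1) → ℝ} (hg : ContDiff ℝ 1 g)
    (h0 : ∀ x ∈ hull s, ∀ j, M.symm (x - a) j = 0 → g x = 0) (j : Fin (n + 1)) :
    ∫ x in hull s, pd g j x = outerNormal s F j * facetJac s F a f M * facetInt f g := by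
  have h1 := h.setIntegral_fderiv_hull hg h0 (EuclideanSpace.single j 1)
  have h2 := h.inner_outerNormal (EuclideanSpace.single j 1)
  rw [EuclideanSpace.inner_single_right] at h2
  simp only [one_mul, conj_trivial] at h2
  have := h.height_pos
  simp only [pd]
  rw [h1, h2, facetJac]
  field_simp

/-! ### Shape regularity -/

/-- The coordinates lie between 0 and 1 at the centre of the ball and at the point at distance `r`
in the direction `e`, so their linear parts change by at most 1 over this length. This is the
geometric half of the inverse estimate. -/
theorem abs_symm_le (h : IsFrame s F a f M) {c : Pt (n + 1)} {r : ℝ} (hr : 0 < r)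
    (hb : Metric.closedBall c r ⊆ hull s) (e : Pt (n + 1)) (j : Fin (n + 1)) :
    |M.symm e j| ≤ ‖e‖ / r := by
  rcases eq_or_ne e 0 with rfl | he
  · simp
  have hn : 0 < ‖e‖ := norm_pos_iff.2 he
  have h1 := h.mem_hull.1 (hb (Metric.mem_closedBall_self hr.le))
  have h2 := h.mem_hull.1 (hb (show c + (r / ‖e‖) • e ∈ Metric.closedBall c r by
    rw [mem_closedBall_iff_norm, add_sub_cancel_left, norm_smul, Real.norm_eq_abs,
      abs_of_pos (by positivity), div_mul_cancel₀ _ hn.ne']))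
  have h3 : M.symm (c + (r / ‖e‖) • e - a) j = M.symm (c - a) j + (r / ‖e‖) * M.symm e j := by
    have : c + (r / ‖e‖) • e - a = (c - a) + (r / ‖e‖) • e := by abel
    rw [this, map_add, map_smul]; rfl
  have h4 : |(r / ‖e‖) * M.symm e j| ≤ 1 := by
    have a1 := h1.1 j
    have a2 := refSimplex_coord_le h1 j
    have a3 := h2.1 j
    have a4 := refSimplex_coord_le h2 j
    rw [h3] at a3 a4
    rw [abs_le]; constructor <;> linarith
  rw [abs_mul, abs_of_pos (by positivity)] at h4
  rw [le_div_iff₀ hr]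
  calc |M.symm e j| * r = ‖e‖ * (r / ‖e‖ * |M.symm e j|) := by field_simp
    _ ≤ ‖e‖ * 1 := by gcongr
    _ = ‖e‖ := mul_one _

theorem hull_real_eq (h : IsFrame s F a f M) :
    volume.real (hull s) = jac M * volume.real (refSimplex (n + 1)) := by
  have := h.setIntegral_hull fun _ => 1
  simpa using this

end IsFrame

/-! ### Measures of simplices and facets -/

theorem refSimplex_real_le_one (n : ℕ) : volume.real (refSimplex n) ≤ 1 := by
  have h1 : refSimplex n ⊆ Icc (0 : Fin n → ℝ) 1 := fun y hy =>
    ⟨fun i => hy.1 i, fun i => refSimplex_coord_le hy i⟩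
  refine (measureReal_mono h1 isCompact_Icc.measure_lt_top.ne).trans ?_
  rw [measureReal_def, Real.volume_Icc_pi]
  simp

theorem le_hull_real {d : ℕ} {s : Finset (Pt d)} {c : Pt d} {r : ℝ} (hr : 0 < r)
    (hb : Metric.closedBall c r ⊆ hull s) :
    r ^ d * volume.real (Metric.closedBall (0 : Pt d) 1) ≤ volume.real (hull s) := by
  have hcpt : IsCompact (hull s) := s.finite_toSet.isCompact_convexHull ℝ
  refine le_trans (le_of_eq ?_) (measureReal_mono hb hcpt.measure_lt_top.ne)
  rw [measureReal_def, measureReal_def, Measure.addHaar_closedBall' _ _ hr.le, ENNReal.toReal_mul,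
    ENNReal.toReal_ofReal (by positivity)]
  simp

/-- The surface measure of a facet is at most of the order of the power of its diameter. -/
theorem exists_facet_measure_le (n : ℕ) : ∃ C : ℝ, 0 < C ∧
    ∀ (s F : Finset (Pt (n + 1))) (a : Pt (n + 1)) (f : Fin (n + 1) → Pt (n + 1))
      (M : (Fin (n + 1) → ℝ) ≃L[ℝ] Pt (n + 1)), IsFrame s F a f M →
      (μHE[n] : Measure (Pt (n + 1))) (hull F) < ⊤ ∧
      (μHE[n] : Measure (Pt (n + 1))).real (hull F) ≤ C * Metric.diam (hull F) ^ n := by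
  -- The factor between the normalized and the plain Hausdorff measure; it depends on `n` only.
  set c : ℝ≥0 := Measure.addHaarScalarFactor (volume : Measure (EuclideanSpace ℝ (Fin n))) μH[n]
  refine ⟨c * (n : ℝ) ^ n + 1, by positivity, fun s F a f M h => ?_⟩
  have hcpt : IsCompact (hull F) := F.finite_toSet.isCompact_convexHull ℝ
  set D : ℝ≥0 := ⟨Metric.diam (hull F), Metric.diam_nonneg⟩ with hD
  -- The parameter space carries the sup norm, so each of the `n` edges contributes at most one
  -- diameter to the Lipschitz constant.
  have hL : LipschitzWith ((n : ℝ≥0) * D) (facetPt f) := by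
    refine LipschitzWith.of_dist_le_mul fun y z => ?_
    have h1 : facetPt f y - facetPt f z = ∑ i, (y i - z i) • (f i.succ - f 0) := by
      simp only [facetPt, sub_smul, smul_sub, Finset.sum_sub_distrib, Finset.sum_smul, one_smul]
      abel
    rw [dist_eq_norm, h1, dist_eq_norm]
    refine (norm_sum_le _ _).trans ?_
    have h2 : ∀ i ∈ Finset.univ, ‖(y i - z i) • (f i.succ - f 0)‖ ≤ ‖y - z‖ * D := fun i _ => by
      rw [norm_smul]
      refine mul_le_mul (norm_le_pi_norm (y - z) i) ?_ (norm_nonneg _) (norm_nonneg _)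
      exact IsFrame.dist_vertex_le F (h.vertex_mem_facet _) (h.vertex_mem_facet _)
    refine (Finset.sum_le_sum h2).trans (le_of_eq ?_)
    simp
    ring
  have h3 := hL.hausdorffMeasure_image_le (d := (n : ℝ)) (Nat.cast_nonneg n) (refSimplex n)
  rw [← h.hull_facet_eq] at h3
  -- For the sup norm the Hausdorff measure of full dimension is exactly Lebesgue measure.
  have h4 : (μH[(n : ℝ)] : Measure (Fin n → ℝ)) = volume := by
    have := hausdorffMeasure_pi_real (ι := Fin n)
    simpa using this
  rw [h4, ENNReal.rpow_natCast] at h3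
  have h5 : volume (refSimplex n) ≤ 1 := by
    have h6 := refSimplex_real_le_one n
    rw [measureReal_def] at h6
    rw [← ENNReal.ofReal_toReal (isCompact_refSimplex n).measure_lt_top.ne]
    exact ENNReal.ofReal_le_one.2 h6
  have h7 : (μHE[n] : Measure (Pt (n + 1))) (hull F) ≤ ((c * ((n : ℝ≥0) * D) ^ n : ℝ≥0) : ENNReal) := by
    rw [Measure.euclideanHausdorffMeasure_def, Measure.smul_apply, ENNReal.smul_def, smul_eq_mul]
    push_cast
    refine mul_le_mul_right ?_ _
    refine h3.trans ?_
    push_cast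
    exact mul_le_of_le_one_right' h5
  refine ⟨h7.trans_lt ENNReal.coe_lt_top, ?_⟩
  have h8 := ENNReal.toReal_mono ENNReal.coe_ne_top h7
  rw [measureReal_def]
  refine h8.trans ?_
  have : (0 : ℝ) ≤ Metric.diam (hull F) ^ n := by positivity
  have hDr : (D : ℝ) = Metric.diam (hull F) := rfl
  rw [ENNReal.coe_toReal]
  push_cast
  rw [hDr, mul_pow]
  nlinarith

/-! ### Geometry of the mesh -/

open Filter Topology

/-- A Lipschitz domain lies locally on one side of its boundary, which rules out slits. A point of
the closure's interior outside `Ω` can be moved strictly below the graph without leaving that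
interior, although near such a point there is nothing of `Ω`. The mesh only covers the closure, so
this places the open simplices inside `Ω`. -/
theorem interior_closure_subset {d : ℕ} {Ω : Set (Pt d)} (hΩ : IsOpen Ω)
    (hL : HasLipschitzBoundary Ω) : interior (closure Ω) ⊆ Ω := by
  intro x hx
  by_contra hxΩ
  have hxf : x ∈ frontier Ω := by
    rw [hΩ.frontier_eq]; exact ⟨interior_subset hx, hxΩ⟩
  obtain ⟨e, L, γ, r, he, hγ, hinv, hr, hloc⟩ := hL x hxf
  have hee : inner ℝ e e = (1 : ℝ) := by rw [real_inner_self_eq_norm_sq, he, one_pow]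
  have hle : inner ℝ x e ≤ γ x := by
    by_contra hlt
    exact hxΩ ((hloc x (Metric.mem_ball_self hr)).2 (not_le.1 hlt))
  have hopen : IsOpen {y | inner ℝ y e < γ y} :=
    isOpen_lt (by fun_prop) hγ.continuous
  have hcont : Continuous fun t : ℝ => x - t • e := by fun_prop
  have h1 : ∀ᶠ t in 𝓝[>] (0 : ℝ), x - t • e ∈ interior (closure Ω) ∩ Metric.ball x r := by
    refine (hcont.tendsto 0).mono_left nhdsWithin_le_nhds ?_
    simp only [zero_smul, sub_zero]
    exact (isOpen_interior.inter Metric.isOpen_ball).mem_nhds ⟨hx, Metric.mem_ball_self hr⟩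
  obtain ⟨t, ⟨ht1, ht2⟩, ht0⟩ := (h1.and self_mem_nhdsWithin).exists
  have ht0' : 0 < t := ht0
  have hγt : γ (x - t • e) = γ x := by
    have := hinv x (-t); rwa [neg_smul, ← sub_eq_add_neg] at this
  have hmem : x - t • e ∈ {y | inner ℝ y e < γ y} ∩ Metric.ball x r := by
    refine ⟨?_, ht2⟩
    rw [Set.mem_ofPred_eq, inner_sub_left, inner_smul_left, hγt, hee]
    simp only [conj_trivial, mul_one]
    linarith
  obtain ⟨y, ⟨hy1, hy2⟩, hyΩ⟩ := mem_closure_iff.1 (interior_subset ht1) _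
    (hopen.inter Metric.isOpen_ball) hmem
  have h3 := (hloc y hy2).1 hyΩ
  have h4 : inner ℝ y e < γ y := hy1
  exact lt_asymm h3 h4

section Mesh

variable {n : ℕ} {Ω : Set (Pt (n + 1))} {T : Finset (Finset (Pt (n + 1)))}

theorem hull_subset_closure (hT : IsMesh Ω T) {s : Finset (Pt (n + 1))} (hs : s ∈ T) :
    hull s ⊆ closure Ω := by
  rw [← hT.cover]; exact subset_biUnion_of_mem (u := fun s => hull s) hs

theorem interior_hull_subset (hΩ : IsOpen Ω) (hL : HasLipschitzBoundary Ω) (hT : IsMesh Ω T)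
    {s : Finset (Pt (n + 1))} (hs : s ∈ T) : interior (hull s) ⊆ Ω :=
  (interior_mono (hull_subset_closure hT hs)).trans (interior_closure_subset hΩ hL)

theorem measurableSet_hull {d : ℕ} (s : Finset (Pt d)) : MeasurableSet (hull s) :=
  (s.finite_toSet.isCompact_convexHull ℝ).isClosed.measurableSet

theorem interior_hull_ae_eq {d : ℕ} (s : Finset (Pt d)) :
    (interior (hull s) : Set (Pt d)) =ᵐ[volume] hull s := by
  refine (interior_ae_eq_of_null_frontier ?_)
  exact (convex_convexHull ℝ _).addHaar_frontier volume

theorem restrict_interior_hull {d : ℕ} (s : Finset (Pt d)) :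
    (volume.restrict (interior (hull s)) : Measure (Pt d)) = volume.restrict (hull s) :=
  Measure.restrict_congr_set (interior_hull_ae_eq s)

theorem exists_facet (hT : IsMesh Ω T) {s : Finset (Pt (n + 1))} (hs : s ∈ T) {v : Pt (n + 1)}
    (hv : v ∈ s) : ∃ F f M, IsFrame s F v f M := by
  classical
  have hF : s.erase v ∈ facets s := Finset.mem_image.2 ⟨v, hv, rfl⟩
  obtain ⟨a, f, M, h⟩ := exists_isFrame (hT.card_eq s hs) (hT.affineIndependent s hs) hF
  have hav : a = v := by
    by_contra hne
    exact h.notMem (Finset.mem_erase.2 ⟨hne, h.apex_mem⟩)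
  subst hav
  exact ⟨_, f, M, h⟩

theorem exists_frame (hT : IsMesh Ω T) {s : Finset (Pt (n + 1))} (hs : s ∈ T) :
    ∃ F a f M, IsFrame s F a f M := by
  have : s.Nonempty := by rw [← Finset.card_pos, hT.card_eq s hs]; omega
  obtain ⟨v, hv⟩ := this
  obtain ⟨F, f, M, h⟩ := exists_facet hT hs hv
  exact ⟨F, v, f, M, h⟩

/-- By conformity the intersection of the two simplices is spanned by common vertices, hence lies in
the facet opposite to a vertex `v` that is not shared. An open set cannot lie in the hyperplane of
that facet. -/
theorem disjoint_interior_hull (hT : IsMesh Ω T) {s t : Finset (Pt (n + 1))} (hs : s ∈ T)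
    (ht : t ∈ T) (hst : s ≠ t) : Disjoint (interior (hull s)) (interior (hull t)) := by
  classical
  rw [Set.disjoint_left]
  intro x hxs hxt
  obtain ⟨v, hvs, hvt⟩ : ∃ v ∈ s, v ∉ t := by
    by_contra hcon
    push Not at hcon
    exact hst (Finset.eq_of_subset_of_card_le hcon (by rw [hT.card_eq s hs, hT.card_eq t ht]))
  obtain ⟨F, f, M, h⟩ := exists_facet hT hs hvs
  have hsub : interior (hull s) ∩ interior (hull t) ⊆ hull F := by
    intro y hy
    have h1 : y ∈ hull s ∩ hull t := ⟨interior_subset hy.1, interior_subset hy.2⟩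
    rw [hT.conforming s hs t ht] at h1
    refine convexHull_mono ?_ h1
    rintro z ⟨hzs, hzt⟩
    rw [h.eq_insert] at hzs
    rcases hzs with rfl | hz
    · exact absurd hzt hvt
    · exact hz
  -- A small move towards `v` stays in both interiors but leaves the hyperplane.
  have hcont : Continuous fun ε : ℝ => x + ε • (v - x) := by fun_prop
  have h1 : ∀ᶠ ε in 𝓝[>] (0 : ℝ), x + ε • (v - x) ∈ interior (hull s) ∩ interior (hull t) := by
    refine (hcont.tendsto 0).mono_left nhdsWithin_le_nhds ?_
    simp only [zero_smul, add_zero]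
    exact (isOpen_interior.inter isOpen_interior).mem_nhds ⟨hxs, hxt⟩
  obtain ⟨ε, hε1, hε0⟩ := (h1.and self_mem_nhdsWithin).exists
  have hε0' : 0 < ε := hε0
  have e1 : slope M (x - v) = 1 := h.sum_symm_facet (hsub ⟨hxs, hxt⟩)
  have e2 : slope M (x + ε • (v - x) - v) = 1 := h.sum_symm_facet (hsub hε1)
  have e3 : x + ε • (v - x) - v = (1 - ε) • (x - v) := by module
  rw [e3, slope_smul, e1] at e2
  linarith

theorem ae_mem_interior_hull {d : ℕ} (s : Finset (Pt d)) :
    ∀ᵐ x ∂(volume.restrict (hull s)), x ∈ interior (hull s) := by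
  rw [← restrict_interior_hull]
  exact ae_restrict_mem isOpen_interior.measurableSet

theorem restrict_hull_le (hΩ : IsOpen Ω) (hL : HasLipschitzBoundary Ω) (hT : IsMesh Ω T)
    {s : Finset (Pt (n + 1))} (hs : s ∈ T) :
    (volume.restrict (hull s) : Measure (Pt (n + 1))) ≤ volume.restrict Ω := by
  rw [← restrict_interior_hull]
  exact Measure.restrict_mono (interior_hull_subset hΩ hL hT hs) le_rfl

theorem sum_setIntegral_hull_le (hΩ : IsOpen Ω) (hL : HasLipschitzBoundary Ω)
    (hT : IsMesh Ω T) {g : Pt (n + 1) → ℝ} (hg : IntegrableOn g Ω) (h0 : ∀ x ∈ Ω, 0 ≤ g x) :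
    ∑ s ∈ T, ∫ x in hull s, g x ≤ ∫ x in Ω, g x := by
  simp only [← restrict_interior_hull]
  rw [← integral_biUnion_finset (s := fun s => interior (hull s)) T
    (fun s _ => isOpen_interior.measurableSet)
    (fun s hs t ht hst => disjoint_interior_hull hT hs ht hst)
    (fun s hs => hg.mono_set (interior_hull_subset hΩ hL hT hs))]
  refine setIntegral_mono_set hg ?_ (LE.le.eventuallyLE ?_)
  · exact (ae_restrict_iff' hΩ.measurableSet).2 (Eventually.of_forall h0)
  · exact iUnion₂_subset fun s hs => interior_hull_subset hΩ hL hT hs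

/-- Two simplices of the mesh lie on opposite sides of a common facet. -/
theorem outerNormal_eq_neg (hT : IsMesh Ω T) {s t F : Finset (Pt (n + 1))}
    {a a' : Pt (n + 1)} {f : Fin (n + 1) → Pt (n + 1)} {M M' : (Fin (n + 1) → ℝ) ≃L[ℝ] Pt (n + 1)}
    (h : IsFrame s F a f M) (h' : IsFrame t F a' f M') (hs : s ∈ T) (ht : t ∈ T) (hst : s ≠ t) :
    outerNormal s F = -outerNormal t F := by
  have hγ := h.slope_apex_ne_zero h'
  rw [(h.height_eq h').2]
  rcases lt_or_gt_of_ne hγ with hneg | hpos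
  · rw [sign_neg hneg]; simp
  exfalso
  -- The barycenter of the common facet. If both apices were on the same side, a small move from `b`
  -- towards `a` would enter the interior of both simplices.
  set b : Pt (n + 1) := a + M (fun _ => ((n : ℝ) + 1)⁻¹) with hb
  have hn : (0 : ℝ) < ((n : ℝ) + 1)⁻¹ := by positivity
  have hsum : ∑ _j : Fin (n + 1), ((n : ℝ) + 1)⁻¹ = 1 := by
    simp; field_simp
  have hb1 : M.symm (b - a) = fun _ => ((n : ℝ) + 1)⁻¹ := by simp [hb]
  have hb2 : M'.symm (b - a') = fun _ => ((n : ℝ) + 1)⁻¹ := by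
    have : b = a' + M' (fun _ => ((n : ℝ) + 1)⁻¹) := by
      rw [hb, h.add_map_eq, h'.add_map_eq, hsum, sub_self, zero_smul, zero_smul]
    rw [this]; simp
  have hs1 : slope M (b - a) = 1 := by rw [slope, hb1, hsum]
  have hs2 : slope M' (b - a') = 1 := by rw [slope, hb2, hsum]
  have hs3 : slope M' (a - b) < 0 := by
    have := h.slope_eq_mul_slope h' (a - b)
    rw [← neg_sub b a] at this
    rw [← neg_sub b a]
    have h2 : slope M (-(b - a)) = -1 := by
      rw [← neg_one_smul ℝ, slope_smul, hs1]; norm_num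
    rw [h2] at this
    by_contra hcon
    have := mul_nonneg hpos.le (not_lt.1 hcon)
    linarith
  -- The coordinates with respect to `t` are all positive at `b` and stay so nearby; their sum falls
  -- below one because the direction has negative slope by `hs3`.
  have hev : ∀ᶠ ε in 𝓝[>] (0 : ℝ), (∀ j, 0 < M'.symm (b + ε • (a - b) - a') j) ∧ ε < 1 := by
    refine Filter.Eventually.and ?_ ((eventually_lt_nhds one_pos).filter_mono nhdsWithin_le_nhds)
    refine eventually_all.2 fun j => ?_
    have hc : Continuous fun ε : ℝ => M'.symm (b + ε • (a - b) - a') j :=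
      (continuous_apply j).comp (M'.symm.continuous.comp (by fun_prop))
    refine ((hc.tendsto 0).mono_left nhdsWithin_le_nhds).eventually (lt_mem_nhds ?_)
    simp only [zero_smul, add_zero, hb2]
    exact hn
  obtain ⟨ε, ⟨hε1, hε2⟩, hε0⟩ := (hev.and self_mem_nhdsWithin).exists
  have hε0' : 0 < ε := hε0
  have hx1 : b + ε • (a - b) ∈ interior (hull s) := by
    have e : b + ε • (a - b) - a = (1 - ε) • (b - a) := by module
    refine h.mem_interior_hull (fun j => ?_) ?_
    · rw [e, map_smul, hb1]
      simp only [Pi.smul_apply, smul_eq_mul]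
      exact mul_pos (by linarith) hn
    · have : slope M (b + ε • (a - b) - a) < 1 := by
        rw [e, slope_smul, hs1]; linarith
      exact this
  have hx2 : b + ε • (a - b) ∈ interior (hull t) := by
    refine h'.mem_interior_hull hε1 ?_
    have : slope M' (b + ε • (a - b) - a') < 1 := by
      have e : b + ε • (a - b) - a' = (b - a') + ε • (a - b) := by module
      rw [e, slope_add, slope_smul, hs2]
      nlinarith
    exact this
  exact Set.disjoint_left.1 (disjoint_interior_hull hT hs ht hst) hx1 hx2

open Classical in
/-- The simplices of the mesh with facet `F`. -/
def facetPatch (T : Finset (Finset (Pt (n + 1)))) (F : Finset (Pt (n + 1))) :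
    Finset (Finset (Pt (n + 1))) := T.filter fun t => F ∈ facets t

theorem mem_facetPatch {F t : Finset (Pt (n + 1))} :
    t ∈ facetPatch T F ↔ t ∈ T ∧ F ∈ facets t := by
  classical
  exact Finset.mem_filter

theorem exists_frame_of_mem_facetPatch (hT : IsMesh Ω T) {s t F : Finset (Pt (n + 1))}
    {a : Pt (n + 1)} {f : Fin (n + 1) → Pt (n + 1)} {M : (Fin (n + 1) → ℝ) ≃L[ℝ] Pt (n + 1)}
    (h : IsFrame s F a f M) (ht : t ∈ facetPatch T F) : ∃ a' M', IsFrame t F a' f M' := by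
  obtain ⟨ht, hF⟩ := mem_facetPatch.1 ht
  exact exists_isFrame_of_enum (hT.affineIndependent t ht) hF h.injective
    h.range_eq

theorem outerNormal_patch (hT : IsMesh Ω T) {s t F : Finset (Pt (n + 1))}
    (hs : s ∈ facetPatch T F) (ht : t ∈ facetPatch T F) (hst : s ≠ t) :
    outerNormal s F = -outerNormal t F := by
  obtain ⟨hs', hF⟩ := mem_facetPatch.1 hs
  obtain ⟨a, f, M, h⟩ := exists_isFrame (hT.card_eq s hs') (hT.affineIndependent s hs') hF
  obtain ⟨a', M', h'⟩ := exists_frame_of_mem_facetPatch hT h ht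
  exact outerNormal_eq_neg hT h h' hs' (mem_facetPatch.1 ht).1 hst

/-- Three simplices would have pairwise opposite normals on the facet, so a unit vector would be its
own negative. -/
theorem card_facetPatch_le (hT : IsMesh Ω T) (F : Finset (Pt (n + 1))) :
    (facetPatch T F).card ≤ 2 := by
  by_contra hcon
  obtain ⟨r, s, t, hr, hs, ht, hrs, hrt, hst⟩ := Finset.two_lt_card_iff.1 (not_le.1 hcon)
  have h1 := outerNormal_patch hT hr hs hrs
  have h2 := outerNormal_patch hT hr ht hrt
  have h3 := outerNormal_patch hT hs ht hst
  obtain ⟨hr', hF⟩ := mem_facetPatch.1 hr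
  obtain ⟨a, f, M, h⟩ := exists_isFrame (hT.card_eq r hr') (hT.affineIndependent r hr') hF
  have h4 := h.norm_outerNormal
  have h5 : outerNormal r F = 0 := by
    have : outerNormal r F = -outerNormal r F := by
      rw [h3, neg_neg, ← neg_eq_iff_eq_neg.2 h2] at h1
      exact h1
    have h6 : (2 : ℝ) • outerNormal r F = 0 := by
      rw [two_smul]; nth_rewrite 1 [this]; exact neg_add_cancel _
    exact (smul_eq_zero.1 h6).resolve_left two_ne_zero
  rw [h5, norm_zero] at h4
  exact zero_ne_one h4

/-- A facet which belongs to one simplex only lies on the boundary. -/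
theorem exists_neighbor (hΩ : IsOpen Ω) (hT : IsMesh Ω T) {s F : Finset (Pt (n + 1))}
    (hs : s ∈ facetPatch T F) (hF : ¬ hull F ⊆ frontier Ω) :
    ∃ t ∈ facetPatch T F, t ≠ s := by
  classical
  by_contra hcon
  push Not at hcon
  apply hF
  obtain ⟨hsT, hFs⟩ := mem_facetPatch.1 hs
  obtain ⟨a, f, M, h⟩ := exists_isFrame (hT.card_eq s hsT) (hT.affineIndependent s hsT) hFs
  have key : ∀ y : Fin n → ℝ, (∀ i, 0 < y i) → ∑ i, y i < 1 → facetPt f y ∈ frontier Ω := by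
    intro y hy1 hy2
    set x := facetPt f y with hx
    have hxs : ∀ j, 0 < M.symm (x - a) j := by
      rw [hx, h.symm_facetPt]
      intro j; refine Fin.cases ?_ (fun i => ?_) j
      · simpa using hy2
      · simpa using hy1 i
    have hxF : x ∈ hull F := by
      rw [h.hull_facet_eq]; exact ⟨y, ⟨fun i => (hy1 i).le, hy2.le⟩, rfl⟩
    -- The point has positive weight at every vertex of the facet. By conformity another simplex
    -- containing it has all these vertices, hence has the facet itself, against the assumption.
    have hother : ∀ t ∈ T.erase s, x ∉ hull t := by
      intro t ht hxt
      obtain ⟨hts, htT⟩ := Finset.mem_erase.1 ht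
      have h1 : x ∈ hull s ∩ hull t := ⟨h.hull_facet_subset hxF, hxt⟩
      rw [hT.conforming s hsT t htT] at h1
      have hsub : F ⊆ t := by
        intro z hz
        have hz' : z ∈ (F : Set (Pt (n + 1))) := hz
        rw [h.range_eq] at hz'
        obtain ⟨j, rfl⟩ := hz'
        by_contra hjt
        have := h.symm_eq_zero (V := (s : Set (Pt (n + 1))) ∩ t) inter_subset_left (j := j)
          (fun hj => hjt hj.2) h1
        exact (hxs j).ne' this
      have hFt : F ∈ facets t := by
        have hlt : F.card < t.card := by rw [h.card_facet, hT.card_eq t htT]; omega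
        obtain ⟨b, hbt, hbF⟩ := Finset.exists_mem_notMem_of_card_lt_card hlt
        refine Finset.mem_image.2 ⟨b, hbt, ?_⟩
        symm
        refine Finset.eq_of_subset_of_card_le (fun z hz => Finset.mem_erase.2
          ⟨fun hzb => hbF (hzb ▸ hz), hsub hz⟩) ?_
        rw [Finset.card_erase_of_mem hbt, h.card_facet, hT.card_eq t htT]; omega
      exact hts (hcon t (mem_facetPatch.2 ⟨htT, hFt⟩))
    rw [hΩ.frontier_eq]
    refine ⟨hull_subset_closure hT hsT (h.hull_facet_subset hxF), fun hxΩ => ?_⟩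
    have hU : IsOpen (Ω ∩ ⋂ t ∈ T.erase s, (hull t)ᶜ) :=
      hΩ.inter (isOpen_biInter_finset fun t _ => (IsFrame.isClosed_hull t).isOpen_compl)
    -- If the point were in `Ω`, a small move away from the apex `a` would stay in `Ω` and off the
    -- other simplices, hence in `s`; but the coordinate sum then exceeds one.
    have hcont : Continuous fun ε : ℝ => x + ε • (x - a) := by fun_prop
    have h1 : ∀ᶠ ε in 𝓝[>] (0 : ℝ), x + ε • (x - a) ∈ Ω ∩ ⋂ t ∈ T.erase s, (hull t)ᶜ := by
      refine (hcont.tendsto 0).mono_left nhdsWithin_le_nhds ?_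
      simp only [zero_smul, add_zero]
      exact hU.mem_nhds ⟨hxΩ, mem_iInter₂.2 hother⟩
    obtain ⟨ε, ⟨hε1, hε2⟩, hε0⟩ := (h1.and self_mem_nhdsWithin).exists
    have hε0' : 0 < ε := hε0
    have h2 := subset_closure hε1
    rw [← hT.cover] at h2
    obtain ⟨t, ht, hxt⟩ := mem_iUnion₂.1 h2
    have hts : t = s := by
      by_contra hne
      exact mem_iInter₂.1 hε2 t (Finset.mem_erase.2 ⟨hne, ht⟩) hxt
    subst hts
    have e1 : slope M (x + ε • (x - a) - a) ≤ 1 := (h.mem_hull.1 hxt).2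
    have e2 : slope M (x - a) = 1 := h.sum_symm_facet hxF
    have e3 : x + ε • (x - a) - a = (1 + ε) • (x - a) := by module
    rw [e3, slope_smul, e2] at e1
    linarith
  -- The relative interior is dense in the facet and the frontier is closed.
  rw [h.hull_facet_eq]
  rintro _ ⟨y, hy, rfl⟩
  obtain ⟨z, hz⟩ : ∃ z : Fin n → ℝ, (∀ i, 0 < z i) ∧ ∑ i, z i < 1 :=
    ⟨fun _ => 1 / ((n : ℝ) + 1) / 2, openBox_subset n fun i =>
      ⟨by positivity, half_lt_self (by positivity)⟩⟩
  have hcont : Continuous fun ε : ℝ => facetPt f ((1 - ε) • y + ε • z) := by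
    unfold facetPt; fun_prop
  have hlim : Tendsto (fun ε : ℝ => facetPt f ((1 - ε) • y + ε • z)) (𝓝[>] 0) (𝓝 (facetPt f y)) := by
    have := (hcont.tendsto 0).mono_left (nhdsWithin_le_nhds (s := Set.Ioi 0))
    simpa using this
  refine isClosed_frontier.mem_of_tendsto hlim ?_
  filter_upwards [self_mem_nhdsWithin,
    (eventually_lt_nhds (one_pos : (0 : ℝ) < 1)).filter_mono nhdsWithin_le_nhds] with ε hε0 hε1
  have hε0' : 0 < ε := hε0
  refine key _ (fun i => ?_) ?_
  · have := mul_nonneg (sub_nonneg.2 hε1.le) (hy.1 i)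
    have := mul_pos hε0' (hz.1 i)
    simp only [Pi.add_apply, Pi.smul_apply, smul_eq_mul]; linarith
  · simp only [Pi.add_apply, Pi.smul_apply, smul_eq_mul, Finset.sum_add_distrib, ← Finset.mul_sum]
    nlinarith [mul_le_mul_of_nonneg_left hy.2 (sub_nonneg.2 hε1.le),
      mul_lt_mul_of_pos_left hz.2 hε0']

/-- An interior facet has exactly two simplices, with opposite normals. Hence functions with equal
values on both sides have facet terms that cancel, which makes facet bubble fields weakly
differentiable. -/
theorem sum_outerNormal_eq_zero (hΩ : IsOpen Ω) (hT : IsMesh Ω T) {s F : Finset (Pt (n + 1))}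
    (hs : s ∈ facetPatch T F) (hF : ¬ hull F ⊆ frontier Ω) :
    ∑ t ∈ facetPatch T F, outerNormal t F = 0 := by
  classical
  obtain ⟨t, ht, hts⟩ := exists_neighbor hΩ hT hs hF
  have h1 : facetPatch T F = {s, t} := by
    symm
    refine Finset.eq_of_subset_of_card_le ?_ ?_
    · intro x hx
      rcases Finset.mem_insert.1 hx with rfl | hx
      · exact hs
      · rw [Finset.mem_singleton.1 hx]; exact ht
    · rw [Finset.card_pair hts.symm]; exact card_facetPatch_le hT F
  rw [h1, Finset.sum_pair hts.symm, outerNormal_patch hT hs ht hts.symm, neg_add_cancel]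

end Mesh

/-! ### Polynomial functions on a simplex -/

open MvPolynomial in
/-- The polynomial function on Euclidean space. -/
def evalPt {d : ℕ} (P : MvPolynomial (Fin d) ℝ) (x : Pt d) : ℝ := eval (fun i => x i) P

section PolyPt
variable {d : ℕ}

theorem hasFDerivAt_evalPt (P : MvPolynomial (Fin d) ℝ) (x : Pt d) :
    HasFDerivAt (evalPt P) (∑ i, evalPt (MvPolynomial.pderiv i P) x •
      (EuclideanSpace.proj i : Pt d →L[ℝ] ℝ)) x :=
  hasFDerivAt_eval (ℓ := fun i (z : Pt d) => z i)
    (fun i => (EuclideanSpace.proj i : Pt d →L[ℝ] ℝ).hasFDerivAt) P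

theorem contDiff_evalPt (P : MvPolynomial (Fin d) ℝ) : ContDiff ℝ ∞ (evalPt P) :=
  contDiff_eval (ℓ := fun i (z : Pt d) => z i)
    (fun i => (EuclideanSpace.proj i : Pt d →L[ℝ] ℝ).contDiff) P

theorem continuous_evalPt (P : MvPolynomial (Fin d) ℝ) : Continuous (evalPt P) :=
  (contDiff_evalPt P).continuous

theorem sum_smul_proj_single (c : Fin d → ℝ) (j : Fin d) :
    (∑ i, c i • (EuclideanSpace.proj i : Pt d →L[ℝ] ℝ)) (EuclideanSpace.single j 1) = c j := by
  simp

theorem pd_evalPt (P : MvPolynomial (Fin d) ℝ) (j : Fin d) (x : Pt d) :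
    pd (evalPt P) j x = evalPt (MvPolynomial.pderiv j P) x := by
  rw [pd, (hasFDerivAt_evalPt P x).fderiv]
  exact sum_smul_proj_single (fun i => evalPt (MvPolynomial.pderiv i P) x) j

theorem pdOn_eq {K : Set (Pt d)} (hK : UniqueDiffOn ℝ K) {f : Pt d → ℝ}
    {P : MvPolynomial (Fin d) ℝ} (hf : ∀ x ∈ K, f x = evalPt P x) (j : Fin d) {x : Pt d}
    (hx : x ∈ K) : pdOn K f j x = evalPt (MvPolynomial.pderiv j P) x := by
  have h1 : HasFDerivWithinAt f _ K x :=
    ((hasFDerivAt_evalPt P x).hasFDerivWithinAt (s := K)).congr hf (hf x hx)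
  rw [pdOn, h1.fderivWithin (hK x hx)]
  exact sum_smul_proj_single (fun i => evalPt (MvPolynomial.pderiv i P) x) j

theorem gradOn_eq {K : Set (Pt d)} (hK : UniqueDiffOn ℝ K) {v : Pt d → Pt d}
    {U : Fin d → MvPolynomial (Fin d) ℝ} (hv : ∀ x ∈ K, ∀ i, v x i = evalPt (U i) x)
    (i j : Fin d) {x : Pt d} (hx : x ∈ K) :
    gradOn K v x i j = evalPt (MvPolynomial.pderiv j (U i)) x := by
  have h1 : HasFDerivWithinAt v ((PiLp.continuousLinearEquiv 2 ℝ (fun _ : Fin d => ℝ)).symm.toContinuousLinearMap.comp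
      (ContinuousLinearMap.pi fun i => ∑ l, evalPt (MvPolynomial.pderiv l (U i)) x •
        (EuclideanSpace.proj l : Pt d →L[ℝ] ℝ))) K x := by
    rw [hasFDerivWithinAt_euclidean]
    intro i
    refine (((hasFDerivAt_evalPt (U i) x).hasFDerivWithinAt (s := K)).congr
      (fun y hy => hv y hy i) (hv x hx i)).congr_fderiv ?_
    ext e
    simp
  rw [gradOn, Matrix.of_apply, h1.fderivWithin (hK x hx)]
  exact sum_smul_proj_single (fun l => evalPt (MvPolynomial.pderiv l (U i)) x) j

theorem grad_eq_gradOn {K : Set (Pt d)} {v : Pt d → Pt d} {x : Pt d} (hx : x ∈ interior K) :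
    grad v x = gradOn K v x := by
  rw [grad, gradOn, fderivWithin_of_mem_nhds (mem_interior_iff_mem_nhds.1 hx)]

theorem IsPolyOn.exists_evalPt {k : ℕ} {K : Set (Pt d)} {f : Pt d → ℝ} (h : IsPolyOn k K f) :
    ∃ P : MvPolynomial (Fin d) ℝ, P.totalDegree ≤ k ∧ ∀ x ∈ K, f x = evalPt P x := h

theorem exists_evalPt_baryCoord (s : Finset (Pt d)) (v : Pt d) :
    ∃ P : MvPolynomial (Fin d) ℝ, P.totalDegree ≤ 1 ∧ ∀ x, baryCoord s v x = evalPt P x := by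
  classical
  set N := outerNormal s (s.erase v)
  set b := barycenter (s.erase v)
  set c := inner ℝ N (v - b)
  refine ⟨affinePoly (-(inner ℝ N b) / c) (fun j => N j / c), totalDegree_affinePoly_le _ _,
    fun x => ?_⟩
  rw [evalPt, eval_affinePoly]
  have h1 : baryCoord s v x = inner ℝ N (x - b) / c := rfl
  have h2 : inner ℝ N x = ∑ j, N j * x j := by
    rw [PiLp.inner_apply]
    exact Finset.sum_congr rfl fun j _ => by simp [mul_comm]
  rw [h1, inner_sub_right, h2, sub_div, Finset.sum_div, neg_div, sub_eq_neg_add]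
  congr 1
  exact Finset.sum_congr rfl fun j _ => by ring

theorem exists_evalPt_bubble (s : Finset (Pt d)) :
    ∃ P : MvPolynomial (Fin d) ℝ, P.totalDegree ≤ s.card ∧ ∀ x, bubble s x = evalPt P x := by
  choose P hP1 hP2 using exists_evalPt_baryCoord s
  refine ⟨∏ v ∈ s, P v, ?_, fun x => ?_⟩
  · refine (MvPolynomial.totalDegree_finsetProd _ _).trans ?_
    refine (Finset.sum_le_sum fun v _ => hP1 v).trans ?_
    simp
  · simp only [bubble, hP2, evalPt, map_prod]

/-- One degree bound for both families: the bubble has degree at most the number of vertices, the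
other parts at most two. From here on the choice of the element matters only through the degree. -/
theorem IsLocalVelocity.exists_evalPt {fe : FEFamily} {s : Finset (Pt d)} {f : Pt d → ℝ}
    (h : IsLocalVelocity fe s f) :
    ∃ P : MvPolynomial (Fin d) ℝ, P.totalDegree ≤ s.card + 2 ∧ ∀ x ∈ hull s, f x = evalPt P x := by
  cases fe with
  | taylorHood =>
    obtain ⟨P, h1, h2⟩ := IsPolyOn.exists_evalPt h
    exact ⟨P, by omega, h2⟩
  | mini =>
    obtain ⟨g, c, hg, hf⟩ := h
    obtain ⟨P, h1, h2⟩ := hg.exists_evalPt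
    obtain ⟨B, h3, h4⟩ := exists_evalPt_bubble s
    refine ⟨P + MvPolynomial.C c * B, ?_, fun x hx => ?_⟩
    · refine (MvPolynomial.totalDegree_add _ _).trans (max_le (by omega) ?_)
      refine (MvPolynomial.totalDegree_mul _ _).trans ?_
      rw [MvPolynomial.totalDegree_C]; omega
    · rw [hf x hx, h2 x hx, h4]; simp [evalPt]

end PolyPt

/-! ### The discrete stress and its divergence -/

/-- The discrete velocity, pressure and coefficient on the simplex `s` as polynomials of degree at
most `N`. -/
structure IsLocalData {d : ℕ} (N : ℕ) (s : Finset (Pt d)) (μh : Finset (Pt d) → Pt d → ℝ)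
    (uh : Pt d → Pt d) (ph : Pt d → ℝ) (U : Fin d → MvPolynomial (Fin d) ℝ)
    (P Mh : MvPolynomial (Fin d) ℝ) : Prop where
  unique : UniqueDiffOn ℝ (hull s)
  vel : ∀ x ∈ hull s, ∀ i, uh x i = evalPt (U i) x
  pres : ∀ x ∈ hull s, ph x = evalPt P x
  coef : ∀ x ∈ hull s, μh s x = evalPt Mh x
  deg_vel : ∀ i, (U i).totalDegree ≤ N
  deg_pres : P.totalDegree ≤ N
  deg_coef : Mh.totalDegree ≤ N

section LocalData
open MvPolynomial
variable {d : ℕ}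

/-- The strain of a polynomial field. -/
def strainPoly (U : Fin d → MvPolynomial (Fin d) ℝ) (i j : Fin d) : MvPolynomial (Fin d) ℝ :=
  C (1 / 2) * (pderiv j (U i) + pderiv i (U j))

/-- The stress of a polynomial field. -/
def stressPoly (U : Fin d → MvPolynomial (Fin d) ℝ) (P Mh : MvPolynomial (Fin d) ℝ)
    (i j : Fin d) : MvPolynomial (Fin d) ℝ :=
  C 2 * Mh * strainPoly U i j - if i = j then P else 0

/-- The first residual of a polynomial field. -/
def residualPoly (κR : ℝ) (U : Fin d → MvPolynomial (Fin d) ℝ) (P Mh : MvPolynomial (Fin d) ℝ)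
    (i : Fin d) : MvPolynomial (Fin d) ℝ :=
  (∑ j, pderiv j (stressPoly U P Mh i j)) + C κR * U i

variable {N : ℕ} {s : Finset (Pt d)} {μh : Finset (Pt d) → Pt d → ℝ}
  {uh : Pt d → Pt d} {ph : Pt d → ℝ} {U : Fin d → MvPolynomial (Fin d) ℝ}
  {P Mh : MvPolynomial (Fin d) ℝ}

theorem totalDegree_strainPoly_le (hU : ∀ i, (U i).totalDegree ≤ N) (i j : Fin d) :
    (strainPoly U i j).totalDegree ≤ N := by
  refine (totalDegree_mul _ _).trans ?_
  rw [totalDegree_C, zero_add]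
  exact (totalDegree_add _ _).trans (max_le ((totalDegree_pderiv_le _ _).trans (hU i))
    ((totalDegree_pderiv_le _ _).trans (hU j)))

theorem IsLocalData.totalDegree_stress_le (h : IsLocalData N s μh uh ph U P Mh) (i j : Fin d) :
    (stressPoly U P Mh i j).totalDegree ≤ 2 * N := by
  refine (totalDegree_sub _ _).trans (max_le ?_ ?_)
  · refine (totalDegree_mul _ _).trans ?_
    have h1 := totalDegree_strainPoly_le h.deg_vel i j
    have h2 : (C 2 * Mh).totalDegree ≤ N := by
      refine (totalDegree_mul _ _).trans ?_
      rw [totalDegree_C, zero_add]; exact h.deg_coef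
    omega
  · split_ifs
    · have := h.deg_pres; omega
    · simp

theorem IsLocalData.totalDegree_residual_le (h : IsLocalData N s μh uh ph U P Mh) (κR : ℝ)
    (i : Fin d) : (residualPoly κR U P Mh i).totalDegree ≤ 2 * N := by
  refine (totalDegree_add _ _).trans (max_le ?_ ?_)
  · exact totalDegree_finsetSum_le fun j _ =>
      (totalDegree_pderiv_le _ _).trans (h.totalDegree_stress_le i j)
  · refine (totalDegree_mul _ _).trans ?_
    rw [totalDegree_C, zero_add]
    have := h.deg_vel i; omega

theorem IsLocalData.gradOn_eq (h : IsLocalData N s μh uh ph U P Mh) {x : Pt d} (hx : x ∈ hull s)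
    (i j : Fin d) : gradOn (hull s) uh x i j = evalPt (pderiv j (U i)) x :=
  ElasticityEig.gradOn_eq h.unique h.vel i j hx

theorem IsLocalData.strain_eq (h : IsLocalData N s μh uh ph U P Mh) {x : Pt d} (hx : x ∈ hull s)
    (i j : Fin d) : strain (gradOn (hull s) uh x) i j = evalPt (strainPoly U i j) x := by
  simp only [strain, Matrix.smul_apply, Matrix.add_apply, Matrix.transpose_apply, h.gradOn_eq hx,
    strainPoly, evalPt, map_mul, map_add, eval_C, smul_eq_mul]

theorem IsLocalData.stress_eq (h : IsLocalData N s μh uh ph U P Mh) {x : Pt d} (hx : x ∈ hull s)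
    (i j : Fin d) : 2 * μh s x * strain (gradOn (hull s) uh x) i j - (if i = j then ph x else 0) =
      evalPt (stressPoly U P Mh i j) x := by
  rw [h.strain_eq hx, h.pres x hx, h.coef x hx, stressPoly]
  split_ifs <;> simp [evalPt]

theorem IsLocalData.R1_eq (h : IsLocalData N s μh uh ph U P Mh) (κR : ℝ) {x : Pt d}
    (hx : x ∈ hull s) (i : Fin d) : R1 μh κR uh ph s x i = evalPt (residualPoly κR U P Mh i) x := by
  have h1 : ∀ j, pdOn (hull s) (fun y => 2 * μh s y * strain (gradOn (hull s) uh y) i j) j x =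
      evalPt (pderiv j (C 2 * Mh * strainPoly U i j)) x := fun j =>
    pdOn_eq h.unique (fun y hy => by
      rw [h.strain_eq hy, h.coef y hy]; simp [evalPt]) j hx
  have h2 : pdOn (hull s) ph i x = evalPt (pderiv i P) x := pdOn_eq h.unique h.pres i hx
  rw [R1, h2, h.vel x hx]
  simp only [h1, residualPoly, stressPoly, map_sub, Finset.sum_sub_distrib, evalPt, map_add,
    map_sum, map_mul, eval_C]
  congr 2
  -- The pressure sits on the diagonal of the stress, so its divergence contributes only the
  -- derivative in direction `i`.
  rw [Finset.sum_eq_single i]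
  · simp
  · intro b _ hb; rw [if_neg hb.symm]; simp
  · simp

theorem IsLocalData.traction_eq (h : IsLocalData N s μh uh ph U P Mh) (F : Finset (Pt d)) {x : Pt d}
    (hx : x ∈ hull s) (i : Fin d) :
    traction μh uh ph s F x i = ∑ j, evalPt (stressPoly U P Mh i j) x * outerNormal s F j := by
  rw [traction, Matrix.mulVec, dotProduct]
  refine Finset.sum_congr rfl fun j _ => ?_
  rw [← h.stress_eq hx]
  simp [Matrix.one_apply]

end LocalData

/-- A simplex has `n + 2` vertices, so velocities have degree at most `n + 4`; adding `k` covers the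
coefficient as well. -/
theorem exists_isLocalData {n : ℕ} {fe : FEFamily} {Ω ΓN : Set (Pt (n + 1))}
    {T : Finset (Finset (Pt (n + 1)))} (hT : IsMesh Ω T) {uh : Pt (n + 1) → Pt (n + 1)}
    {ph : Pt (n + 1) → ℝ} {μh : Finset (Pt (n + 1)) → Pt (n + 1) → ℝ} {k : ℕ}
    {μ : Pt (n + 1) → ℝ}
    (huh : MemHh fe Ω ΓN T uh) (hph : MemQh Ω T ph) (hμh : IsL2Projection k T μ μh)
    {s : Finset (Pt (n + 1))} (hs : s ∈ T) :
    ∃ U P Mh, IsLocalData (k + n + 4) s μh uh ph U P Mh := by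
  choose U hU1 hU2 using fun i => (huh.loc s hs i).exists_evalPt
  obtain ⟨P, hP1, hP2⟩ := (hph.loc s hs).exists_evalPt
  obtain ⟨Mh, hM1, hM2⟩ := (hμh s hs).1.exists_evalPt
  obtain ⟨F, a, f, M, h⟩ := exists_frame hT hs
  have hc := hT.card_eq s hs
  exact ⟨U, P, Mh, h.uniqueDiffOn_hull, fun x hx i => hU2 i x hx, hP2, hM2,
    fun i => (hU1 i).trans (by omega), by omega, by omega⟩

/-! ### Test fields supported on a patch of simplices -/

section Patch

variable {n : ℕ} {Ω ΓN : Set (Pt (n + 1))} {T S : Finset (Finset (Pt (n + 1)))}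

/-- The open simplices are disjoint and lie in `Ω`, the closed ones cover its closure, and a convex
set has a null frontier. So the open simplices exhaust `Ω` up to a null set. -/
theorem setIntegral_eq_sum (hΩ : IsOpen Ω) (hL : HasLipschitzBoundary Ω) (hT : IsMesh Ω T)
    {g : Pt (n + 1) → ℝ} (hg : IntegrableOn g Ω) :
    ∫ x in Ω, g x = ∑ s ∈ T, ∫ x in hull s, g x := by
  have hsub : (⋃ s ∈ T, interior (hull s)) ⊆ Ω :=
    iUnion₂_subset fun s hs => interior_hull_subset hΩ hL hT hs
  have hae : (Ω : Set (Pt (n + 1))) =ᵐ[volume] (⋃ s ∈ T, interior (hull s) : Set (Pt (n + 1))) := by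
    refine Filter.EventuallyLE.antisymm ?_ (LE.le.eventuallyLE hsub)
    have h1 : (⋃ s ∈ T, interior (hull s) : Set (Pt (n + 1))) =ᵐ[volume]
        (⋃ s ∈ T, hull s : Set (Pt (n + 1))) :=
      Finset.eventuallyEq_iUnion T fun s _ => interior_hull_ae_eq s
    refine Filter.EventuallyLE.trans (LE.le.eventuallyLE ?_) h1.symm.le
    rw [hT.cover]; exact subset_closure
  rw [setIntegral_congr_set hae]
  simp only [← restrict_interior_hull]
  exact integral_biUnion_finset (s := fun s => interior (hull s)) T
    (fun s _ => isOpen_interior.measurableSet)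
    (fun s hs t ht hst => disjoint_interior_hull hT hs ht hst)
    (fun s hs => hg.mono_set (interior_hull_subset hΩ hL hT hs))

theorem setIntegral_patch (hΩ : IsOpen Ω) (hL : HasLipschitzBoundary Ω) (hT : IsMesh Ω T)
    (hS : S ⊆ T) {g : Pt (n + 1) → ℝ} (hg : IntegrableOn g Ω)
    {g' : Finset (Pt (n + 1)) → Pt (n + 1) → ℝ}
    (h1 : ∀ t ∈ S, ∀ x ∈ interior (hull t), g x = g' t x)
    (h2 : ∀ t ∈ T, t ∉ S → ∀ x ∈ interior (hull t), g x = 0) :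
    ∫ x in Ω, g x = ∑ t ∈ S, ∫ x in hull t, g' t x := by
  classical
  rw [setIntegral_eq_sum hΩ hL hT hg]
  rw [← Finset.sum_subset hS]
  · refine Finset.sum_congr rfl fun t ht => ?_
    refine integral_congr_ae ?_
    filter_upwards [ae_mem_interior_hull t] with x hx using h1 t ht x hx
  · intro t ht htP
    refine integral_eq_zero_of_ae ?_
    filter_upwards [ae_mem_interior_hull t] with x hx using h2 t ht htP x hx

theorem continuous_pd {d : ℕ} {g : Pt d → ℝ} (hg : ContDiff ℝ ∞ g) (j : Fin d) :
    Continuous (pd g j) :=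
  (hg.continuous_fderiv (by simp)).clm_apply continuous_const

theorem pd_mul {d : ℕ} {g h : Pt d → ℝ} (hg : ContDiff ℝ ∞ g) (hh : ContDiff ℝ ∞ h) (j : Fin d)
    (x : Pt d) : pd (fun y => g y * h y) j x = g x * pd h j x + pd g j x * h x := by
  have h1 := (hg.differentiable (by simp) x).hasFDerivAt.mul
    (hh.differentiable (by simp) x).hasFDerivAt
  have h2 : HasFDerivAt (fun y => g y * h y) _ x := h1
  rw [pd, h2.fderiv]
  simp [pd, mul_comm]

theorem integrableOn_hull {d : ℕ} {g : Pt d → ℝ} (hg : Continuous g) (s : Finset (Pt d)) :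
    IntegrableOn g (hull s) :=
  hg.continuousOn.integrableOn_compact (s.finite_toSet.isCompact_convexHull ℝ)

theorem memLp_hull {d : ℕ} {V : Type*} [NormedAddCommGroup V] [SecondCountableTopology V]
    {g : Pt d → V} (hg : Continuous g) (s : Finset (Pt d)) :
    MemLp g 2 (volume.restrict (hull s)) := by
  have hK : IsCompact (hull s) := s.finite_toSet.isCompact_convexHull ℝ
  obtain ⟨C, hC⟩ := hK.exists_bound_of_continuousOn hg.continuousOn
  have : IsFiniteMeasure (volume.restrict (hull s) : Measure (Pt d)) :=
    isFiniteMeasure_restrict.2 hK.measure_lt_top.ne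
  refine MemLp.of_bound hg.aestronglyMeasurable C ?_
  filter_upwards [ae_restrict_mem hK.measurableSet] with x hx using hC x hx

theorem memLp_indicator_hull {d : ℕ} {V : Type*} [NormedAddCommGroup V] [SecondCountableTopology V]
    {g : Pt d → V} (hg : Continuous g) (s : Finset (Pt d)) (Ω : Set (Pt d)) :
    MemLp ((interior (hull s)).indicator g) 2 (volume.restrict Ω) := by
  refine MemLp.restrict Ω ?_
  rw [memLp_indicator_iff_restrict isOpen_interior.measurableSet, restrict_interior_hull]
  exact memLp_hull hg s

/-- The gradient of a field given by its components. -/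
def compGrad {d : ℕ} (w : Fin d → Pt d → ℝ) (x : Pt d) : Matrix (Fin d) (Fin d) ℝ :=
  Matrix.of fun i j => pd (w i) j x

/-- The field which is `w t` in the interior of each simplex `t` of `S`. -/
def patchField {d : ℕ} (S : Finset (Finset (Pt d))) (w : Finset (Pt d) → Fin d → Pt d → ℝ)
    (x : Pt d) : Pt d :=
  ∑ t ∈ S, (interior (hull t)).indicator (fun y => WithLp.toLp 2 fun i => w t i y) x

/-- The piecewise gradient of `patchField S w`. -/
def patchGrad {d : ℕ} (S : Finset (Finset (Pt d))) (w : Finset (Pt d) → Fin d → Pt d → ℝ)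
    (x : Pt d) : Matrix (Fin d) (Fin d) ℝ :=
  ∑ t ∈ S, (interior (hull t)).indicator (compGrad (w t)) x

theorem sum_indicator_eq {V : Type*} [AddCommMonoid V] (hT : IsMesh Ω T) (hS : S ⊆ T)
    (g : Finset (Pt (n + 1)) → Pt (n + 1) → V) {t : Finset (Pt (n + 1))} (ht : t ∈ T)
    {x : Pt (n + 1)} (hx : x ∈ interior (hull t)) [Decidable (t ∈ S)] :
    ∑ s ∈ S, (interior (hull s)).indicator (g s) x = if t ∈ S then g t x else 0 := by
  have h1 : ∀ s ∈ S, s ≠ t → (interior (hull s)).indicator (g s) x = 0 := fun s hs hst =>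
    indicator_of_notMem (fun hxs => Set.disjoint_left.1
      (disjoint_interior_hull hT (hS hs) ht hst) hxs hx) _
  split_ifs with htP
  · rw [Finset.sum_eq_single_of_mem t htP h1, indicator_of_mem hx]
  · exact Finset.sum_eq_zero fun s hs => h1 s hs fun h => htP (h ▸ hs)

variable {w : Finset (Pt (n + 1)) → Fin (n + 1) → Pt (n + 1) → ℝ}

theorem memLp_patchField (hw : ∀ t ∈ S, ∀ i, ContDiff ℝ ∞ (w t i)) :
    MemLp (patchField S w) 2 (volume.restrict Ω) := by
  refine memLp_finsetSum S fun t ht => memLp_indicator_hull ?_ t Ω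
  exact (PiLp.continuous_toLp 2 _).comp (continuous_pi fun i => (hw t ht i).continuous)

theorem memLp_patchGrad (hw : ∀ t ∈ S, ∀ i, ContDiff ℝ ∞ (w t i)) (i j : Fin (n + 1)) :
    MemLp (fun x => patchGrad S w x i j) 2 (volume.restrict Ω) := by
  have : (fun x => patchGrad S w x i j) = fun x =>
      ∑ t ∈ S, (interior (hull t)).indicator (pd (w t i) j) x := by
    funext x
    rw [patchGrad, Matrix.sum_apply]
    refine Finset.sum_congr rfl fun t _ => ?_
    by_cases hx : x ∈ interior (hull t)
    · rw [indicator_of_mem hx, indicator_of_mem hx]; rfl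
    · rw [indicator_of_notMem hx, indicator_of_notMem hx]; rfl
  rw [this]
  exact memLp_finsetSum S fun t ht => memLp_indicator_hull (continuous_pd (hw t ht i) j) t Ω

theorem memLp_apply {d : ℕ} {v : Pt d → Pt d} {μ : Measure (Pt d)} (hv : MemLp v 2 μ) (i : Fin d) :
    MemLp (fun x => v x i) 2 μ :=
  (EuclideanSpace.proj i : Pt d →L[ℝ] ℝ).comp_memLp' hv

/-- By the product rule, `hz` is the defining identity of the weak gradient summed over the patch.
Since `ΓN` is disjoint from `Ω`, tests supported in `Ω` are among those vanishing near `ΓN`, so one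
condition yields both the weak gradient and the zero trace. -/
theorem memH_patch (hΩ : IsOpen Ω) (hL : HasLipschitzBoundary Ω) (hT : IsMesh Ω T)
    (hS : S ⊆ T) (hΓN : Disjoint Ω ΓN) (hw : ∀ t ∈ S, ∀ i, ContDiff ℝ ∞ (w t i))
    (hz : ∀ φ : Pt (n + 1) → ℝ, ContDiff ℝ ∞ φ → HasCompactSupport φ → Disjoint (tsupport φ) ΓN →
      ∀ i j, ∑ t ∈ S, ∫ x in hull t, pd (fun y => w t i y * φ y) j x = 0) :
    MemH Ω ΓN (patchField S w) (patchGrad S w) := by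
  classical
  have htrace : HasZeroTraceOff Ω ΓN (patchField S w) (patchGrad S w) := by
    intro φ hφ hφc hφN i j
    have hφ2 : MemLp φ 2 (volume.restrict Ω) :=
      (hφ.continuous.memLp_of_hasCompactSupport hφc).restrict Ω
    have hpφc : HasCompactSupport (pd φ j) := by
      have := hφc.fderiv ℝ
      exact this.comp_left (g := fun L : Pt (n + 1) →L[ℝ] ℝ => L (EuclideanSpace.single j 1)) rfl
    have hpφ2 : MemLp (pd φ j) 2 (volume.restrict Ω) :=
      ((continuous_pd hφ j).memLp_of_hasCompactSupport hpφc).restrict Ω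
    have hi1 : IntegrableOn (fun x => patchField S w x i * pd φ j x) Ω :=
      (memLp_apply (memLp_patchField hw) i).integrable_mul hpφ2
    have hi2 : IntegrableOn (fun x => patchGrad S w x i j * φ x) Ω :=
      (memLp_patchGrad hw i j).integrable_mul hφ2
    rw [setIntegral_patch hΩ hL hT hS hi1 (g' := fun t x => w t i x * pd φ j x),
      setIntegral_patch hΩ hL hT hS hi2 (g' := fun t x => pd (w t i) j x * φ x),
      eq_neg_iff_add_eq_zero, ← Finset.sum_add_distrib, ← hz φ hφ hφc hφN i j]
    · refine Finset.sum_congr rfl fun t ht => ?_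
      rw [← integral_add]
      · refine integral_congr_ae (Filter.Eventually.of_forall fun x => ?_)
        exact (pd_mul (hw t ht i) hφ j x).symm
      · exact integrableOn_hull ((hw t ht i).continuous.mul (continuous_pd hφ j)) t
      · exact integrableOn_hull ((continuous_pd (hw t ht i) j).mul hφ.continuous) t
    · intro t ht x hx
      rw [patchGrad, sum_indicator_eq hT hS _ (hS ht) hx, if_pos ht]; rfl
    · intro t ht htP x hx
      rw [patchGrad, sum_indicator_eq hT hS _ ht hx, if_neg htP]; simp
    · intro t ht x hx
      rw [patchField, sum_indicator_eq hT hS _ (hS ht) hx, if_pos ht]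
    · intro t ht htP x hx
      rw [patchField, sum_indicator_eq hT hS _ ht hx, if_neg htP]; simp
  exact ⟨memLp_patchField hw, memLp_patchGrad hw,
    fun φ hφ hφc hφΩ => htrace φ hφ hφc (hΓN.mono_left hφΩ), htrace⟩

end Patch

/-! ### Integrability -/

section Integrability

variable {d : ℕ} {μ : Measure (Pt d)}

theorem memLp_strain {G : Pt d → Matrix (Fin d) (Fin d) ℝ}
    (hG : ∀ i j, MemLp (fun x => G x i j) 2 μ) (i j : Fin d) :
    MemLp (fun x => strain (G x) i j) 2 μ :=
  ((hG i j).add (hG j i)).const_mul (1 / 2)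

theorem integrable_ddot {A B : Pt d → Matrix (Fin d) (Fin d) ℝ}
    (hA : ∀ i j, MemLp (fun x => A x i j) 2 μ) (hB : ∀ i j, MemLp (fun x => B x i j) 2 μ) :
    Integrable (fun x => ddot (A x) (B x)) μ :=
  integrable_finsetSum _ fun i _ => integrable_finsetSum _ fun j _ =>
    (hA i j).integrable_mul (hB i j)

theorem memLp_trace {A : Pt d → Matrix (Fin d) (Fin d) ℝ}
    (hA : ∀ i j, MemLp (fun x => A x i j) 2 μ) : MemLp (fun x => (A x).trace) 2 μ :=
  memLp_finsetSum _ fun i _ => hA i i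

theorem integrable_dot {u v : Pt d → Pt d} (hu : MemLp u 2 μ) (hv : MemLp v 2 μ) :
    Integrable (fun x => ∑ i, u x i * v x i) μ :=
  integrable_finsetSum _ fun i _ => (memLp_apply hu i).integrable_mul (memLp_apply hv i)

theorem integrable_mul_of_bounded {c g : Pt d → ℝ} {B : ℝ} (hc : Measurable c)
    (hB : ∀ᵐ x ∂μ, |c x| ≤ B) (hg : Integrable g μ) : Integrable (fun x => c x * g x) μ :=
  hg.bdd_mul hc.aestronglyMeasurable hB

theorem memLp_mul_of_bounded {c g : Pt d → ℝ} {B : ℝ} (hc : Measurable c)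
    (hB : ∀ᵐ x ∂μ, |c x| ≤ B) (hg : MemLp g 2 μ) : MemLp (fun x => c x * g x) 2 μ :=
  MemLp.of_le_mul (c := B) hg (hc.aestronglyMeasurable.mul hg.1) (by
    filter_upwards [hB] with x hx
    rw [norm_mul, Real.norm_eq_abs (c x)]
    gcongr)

/-- The Cauchy-Schwarz inequality against a constant. -/
theorem integral_sqrt_le [IsFiniteMeasure μ] {α : Pt d → ℝ} (hα : Integrable α μ)
    (h0 : ∀ᵐ x ∂μ, 0 ≤ α x) :
    Integrable (fun x => √(α x)) μ ∧ ∫ x, √(α x) ∂μ ≤ √(μ.real univ) * √(∫ x, α x ∂μ) := by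
  have hm : AEStronglyMeasurable (fun x => √(α x)) μ :=
    Real.continuous_sqrt.comp_aestronglyMeasurable hα.1
  have h2 : MemLp (fun x => √(α x)) 2 μ := by
    rw [memLp_two_iff_integrable_sq hm]
    refine hα.congr ?_
    filter_upwards [h0] with x hx using (Real.sq_sqrt hx).symm
  refine ⟨h2.integrable one_le_two, ?_⟩
  have h := integral_mul_le_Lp_mul_Lq_of_nonneg (μ := μ) (p := 2) (q := 2)
    Real.HolderConjugate.two_two (f := fun _ => (1 : ℝ)) (g := fun x => √(α x))
    (Filter.Eventually.of_forall fun _ => zero_le_one)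
    (Filter.Eventually.of_forall fun _ => Real.sqrt_nonneg _)
    (memLp_const _) (by simpa using h2)
  simp only [one_mul, Real.one_rpow, integral_const, smul_eq_mul, mul_one] at h
  rw [Real.sqrt_eq_rpow, Real.sqrt_eq_rpow]
  refine h.trans (le_of_eq ?_)
  congr 2
  refine integral_congr_ae ?_
  filter_upwards [h0] with x hx
  rw [Real.rpow_two, Real.sq_sqrt hx]

end Integrability

/-! ### The residual identity -/

/-! ### Pointwise inequalities for matrices -/

section Algebra
variable {d : ℕ}

theorem ddot_self_nonneg (A : Matrix (Fin d) (Fin d) ℝ) : 0 ≤ ddot A A :=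
  Finset.sum_nonneg fun _ _ => Finset.sum_nonneg fun _ _ => mul_self_nonneg _

theorem abs_entry_le (A : Matrix (Fin d) (Fin d) ℝ) (i j : Fin d) : |A i j| ≤ √(ddot A A) := by
  refine Real.abs_le_sqrt ?_
  rw [sq]
  refine (Finset.single_le_sum (f := fun j => A i j * A i j) (fun _ _ => mul_self_nonneg _)
    (Finset.mem_univ j)).trans ?_
  exact Finset.single_le_sum (f := fun i => ∑ j, A i j * A i j)
    (fun _ _ => Finset.sum_nonneg fun _ _ => mul_self_nonneg _) (Finset.mem_univ i)

theorem abs_ddot_le {A B : Matrix (Fin d) (Fin d) ℝ} {g : ℝ} (hB : ∀ i j, |B i j| ≤ g) :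
    |ddot A B| ≤ (d : ℝ) ^ 2 * (g * √(ddot A A)) := by
  have h1 : ∀ i j, |A i j * B i j| ≤ g * √(ddot A A) := fun i j => by
    rw [abs_mul, mul_comm]
    exact mul_le_mul (hB i j) (abs_entry_le A i j) (abs_nonneg _) ((abs_nonneg _).trans (hB i j))
  refine (Finset.abs_sum_le_sum_abs _ _).trans ?_
  refine (Finset.sum_le_sum fun i _ => (Finset.abs_sum_le_sum_abs _ _).trans
    (Finset.sum_le_sum fun j _ => h1 i j)).trans (le_of_eq ?_)
  simp only [Finset.sum_const, Finset.card_univ, Fintype.card_fin, nsmul_eq_mul]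
  ring

theorem abs_strain_le {B : Matrix (Fin d) (Fin d) ℝ} {g : ℝ} (hB : ∀ i j, |B i j| ≤ g)
    (i j : Fin d) : |strain B i j| ≤ g := by
  have h1 := abs_le.1 (hB i j)
  have h2 := abs_le.1 (hB j i)
  simp only [strain, Matrix.smul_apply, Matrix.add_apply, Matrix.transpose_apply, smul_eq_mul]
  rw [abs_le]; constructor <;> linarith

theorem abs_trace_le {B : Matrix (Fin d) (Fin d) ℝ} {g : ℝ} (hB : ∀ i j, |B i j| ≤ g) :
    |B.trace| ≤ d * g := by
  refine (Finset.abs_sum_le_sum_abs _ _).trans ((Finset.sum_le_sum fun i _ => hB i i).trans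
    (le_of_eq ?_))
  simp

theorem ddot_strain_le (A : Matrix (Fin d) (Fin d) ℝ) :
    ddot (strain A) (strain A) ≤ ddot A A := by
  have h1 : ddot (strain A) (strain A) ≤ ∑ i, ∑ j, (A i j * A i j + A j i * A j i) / 2 := by
    refine Finset.sum_le_sum fun i _ => Finset.sum_le_sum fun j _ => ?_
    simp only [strain, Matrix.smul_apply, Matrix.add_apply, Matrix.transpose_apply, smul_eq_mul]
    nlinarith [sq_nonneg (A i j - A j i)]
  refine h1.trans (le_of_eq ?_)
  have h2 : ∑ i, ∑ j, A j i * A j i = ddot A A := Finset.sum_comm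
  simp only [← Finset.sum_div, Finset.sum_add_distrib]
  rw [h2]; simp only [ddot]; ring

theorem strain_sub (A B : Matrix (Fin d) (Fin d) ℝ) : strain (A - B) = strain A - strain B := by
  ext i j
  simp [strain]; ring

theorem ddot_sub (A B C : Matrix (Fin d) (Fin d) ℝ) : ddot (A - B) C = ddot A C - ddot B C := by
  simp [ddot, sub_mul, Finset.sum_sub_distrib]

theorem ddot_strain_right (A B : Matrix (Fin d) (Fin d) ℝ) :
    ddot (strain A) (strain B) = ddot (strain A) B := by
  have h1 : ddot (strain A) B.transpose = ddot (strain A) B := by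
    simp only [ddot]
    rw [Finset.sum_comm]
    refine Finset.sum_congr rfl fun i _ => Finset.sum_congr rfl fun j _ => ?_
    simp [strain, add_comm]
  have h2 : ddot (strain A) (strain B) = (ddot (strain A) B + ddot (strain A) B.transpose) / 2 := by
    simp only [ddot, ← Finset.sum_add_distrib, Finset.sum_div]
    refine Finset.sum_congr rfl fun i _ => Finset.sum_congr rfl fun j _ => ?_
    simp [strain]; ring
  rw [h2, h1]; ring

theorem abs_apply_le (x : Fin d → ℝ) (i : Fin d) : |x i| ≤ √(∑ i, x i ^ 2) :=
  Real.abs_le_sqrt (Finset.single_le_sum (f := fun i => x i ^ 2) (fun _ _ => sq_nonneg _)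
    (Finset.mem_univ i))

end Algebra

/-- The data of the efficiency estimate. -/
structure IsSetting {n : ℕ} (fe : FEFamily) (Emin Emax m : ℝ) (k : ℕ) (Ω ΓD ΓN : Set (Pt (n + 1)))
    (E : Pt (n + 1) → ℝ) (T : Finset (Finset (Pt (n + 1))))
    (μh : Finset (Pt (n + 1)) → Pt (n + 1) → ℝ) (ν κ : ℝ) (u : Pt (n + 1) → Pt (n + 1))
    (Gu : Pt (n + 1) → Matrix (Fin (n + 1)) (Fin (n + 1)) ℝ) (p : Pt (n + 1) → ℝ)
    (uh : Pt (n + 1) → Pt (n + 1)) (ph : Pt (n + 1) → ℝ) : Prop where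
  isOpen : IsOpen Ω
  lipschitz : HasLipschitzBoundary Ω
  splitting : IsBoundarySplitting Ω ΓD ΓN
  Emin_pos : 0 < Emin
  m_pos : 0 < m
  measurable : Measurable E
  bounds : ∀ x ∈ Ω, Emin ≤ E x ∧ E x ≤ Emax
  mesh : IsMesh Ω T
  proj : IsL2Projection k T (mu E) μh
  lower : ∀ s ∈ T, ∀ x ∈ hull s, m ≤ μh s x
  ν_pos : 0 < ν
  ν_le : ν ≤ 1 / 2
  sol : IsEigenSolution Ω ΓN E ν κ u Gu p
  memHh : MemHh fe Ω ΓN T uh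
  memQh : MemQh Ω T ph

/-- The density of the square of the weighted norm of the error. -/
def energyDensity {d : ℕ} (E : Pt d → ℝ) (ν : ℝ) (Gu : Pt d → Matrix (Fin d) (Fin d) ℝ)
    (p : Pt d → ℝ) (uh : Pt d → Pt d) (ph : Pt d → ℝ) (x : Pt d) : ℝ :=
  mu E x * ddot (Gu x - grad uh x) (Gu x - grad uh x) + (mu E x)⁻¹ * (p x - ph x) ^ 2
    + lamInv E ν x * (p x - ph x) ^ 2

/-- The density of the square of the data oscillation. -/
def oscDensity {d : ℕ} (E : Pt d → ℝ) (μh : Finset (Pt d) → Pt d → ℝ) (uh : Pt d → Pt d)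
    (s : Finset (Pt d)) (x : Pt d) : ℝ :=
  (2 * μh s x)⁻¹ * (mu E x - μh s x) ^ 2 *
    ddot (strain (gradOn (hull s) uh x)) (strain (gradOn (hull s) uh x))

/-- The local contribution to the higher order terms, without the mesh size. -/
def eigTerm {d : ℕ} (κ κh : ℝ) (u uh : Pt d → Pt d) (s : Finset (Pt d)) : ℝ :=
  |κ - κh| * l2norm (hull s) uh + |κ| * l2norm (hull s) (fun x => u x - uh x)

/-- The square of the local error, including data oscillation. -/
def localErrSq {d : ℕ} (E : Pt d → ℝ) (ν : ℝ) (Gu : Pt d → Matrix (Fin d) (Fin d) ℝ)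
    (p : Pt d → ℝ) (uh : Pt d → Pt d) (ph : Pt d → ℝ) (μh : Finset (Pt d) → Pt d → ℝ)
    (s : Finset (Pt d)) : ℝ :=
  ∫ x in hull s, (energyDensity E ν Gu p uh ph x + oscDensity E μh uh s x)

/-- The integrand of the weak form of the momentum equation. -/
def momentumInt {d : ℕ} (E : Pt d → ℝ) (κ : ℝ) (u : Pt d → Pt d)
    (Gu : Pt d → Matrix (Fin d) (Fin d) ℝ) (p : Pt d → ℝ) (w : Fin d → Pt d → ℝ) (x : Pt d) : ℝ :=
  2 * (mu E x * ddot (strain (Gu x)) (strain (compGrad w x))) - p x * (compGrad w x).trace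
    - κ * ∑ i, u x i * w i x

/-- The part of the residual which is due to the error and the data oscillation. -/
def errorInt {d : ℕ} (E : Pt d → ℝ) (κ κR : ℝ) (u : Pt d → Pt d)
    (Gu : Pt d → Matrix (Fin d) (Fin d) ℝ) (p : Pt d → ℝ) (uh : Pt d → Pt d) (ph : Pt d → ℝ)
    (μh : Finset (Pt d) → Pt d → ℝ) (s : Finset (Pt d)) (w : Fin d → Pt d → ℝ) (x : Pt d) : ℝ :=
  2 * (mu E x * ddot (strain (Gu x - grad uh x)) (strain (compGrad w x)))
    - (p x - ph x) * (compGrad w x).trace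
    + 2 * ((mu E x - μh s x) * ddot (strain (gradOn (hull s) uh x)) (strain (compGrad w x)))
    - ∑ i, (κ * u x i - κR * uh x i) * w i x

/-! ### Error densities and the residual functional -/

namespace IsSetting

variable {n : ℕ} {fe : FEFamily} {Emin Emax m : ℝ} {k : ℕ} {Ω ΓD ΓN : Set (Pt (n + 1))}
  {E : Pt (n + 1) → ℝ} {T S : Finset (Finset (Pt (n + 1)))}
  {μh : Finset (Pt (n + 1)) → Pt (n + 1) → ℝ} {ν κ : ℝ} {u : Pt (n + 1) → Pt (n + 1)}
  {Gu : Pt (n + 1) → Matrix (Fin (n + 1)) (Fin (n + 1)) ℝ} {p : Pt (n + 1) → ℝ}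
  {uh : Pt (n + 1) → Pt (n + 1)} {ph : Pt (n + 1) → ℝ}

theorem mu_mem (h : IsSetting fe Emin Emax m k Ω ΓD ΓN E T μh ν κ u Gu p uh ph) {x : Pt (n + 1)}
    (hx : x ∈ Ω) : 0 < mu E x ∧ Emin / 2 ≤ mu E x ∧ mu E x ≤ Emax / 2 := by
  have := h.bounds x hx
  have := h.Emin_pos
  simp only [mu]
  refine ⟨?_, ?_, ?_⟩ <;> linarith

theorem ae_mu (h : IsSetting fe Emin Emax m k Ω ΓD ΓN E T μh ν κ u Gu p uh ph) :
    ∀ᵐ x ∂(volume.restrict Ω), |mu E x| ≤ Emax / 2 := by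
  filter_upwards [ae_restrict_mem h.isOpen.measurableSet] with x hx
  rw [abs_of_pos (h.mu_mem hx).1]; exact (h.mu_mem hx).2.2

theorem ae_mu_inv (h : IsSetting fe Emin Emax m k Ω ΓD ΓN E T μh ν κ u Gu p uh ph) :
    ∀ᵐ x ∂(volume.restrict Ω), |(mu E x)⁻¹| ≤ (Emin / 2)⁻¹ := by
  filter_upwards [ae_restrict_mem h.isOpen.measurableSet] with x hx
  have := h.Emin_pos
  rw [abs_of_pos (inv_pos.2 (h.mu_mem hx).1)]
  exact inv_anti₀ (by positivity) (h.mu_mem hx).2.1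

theorem lamInv_nonneg (h : IsSetting fe Emin Emax m k Ω ΓD ΓN E T μh ν κ u Gu p uh ph)
    {x : Pt (n + 1)} (hx : x ∈ Ω) : 0 ≤ lamInv E ν x := by
  have h1 := h.bounds x hx
  have h2 := h.Emin_pos
  have h3 := h.ν_pos
  have h4 := h.ν_le
  exact div_nonneg (by linarith) (mul_nonneg (by linarith) h3.le)

theorem ae_lamInv (h : IsSetting fe Emin Emax m k Ω ΓD ΓN E T μh ν κ u Gu p uh ph) :
    ∀ᵐ x ∂(volume.restrict Ω), |lamInv E ν x| ≤ (1 - 2 * ν) / (Emin * ν) := by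
  filter_upwards [ae_restrict_mem h.isOpen.measurableSet] with x hx
  rw [abs_of_nonneg (h.lamInv_nonneg hx)]
  have h1 := h.bounds x hx
  have h2 := h.Emin_pos
  have h3 := h.ν_pos
  have h4 := h.ν_le
  have h5 : 0 ≤ 1 - 2 * ν := by linarith
  exact div_le_div_of_nonneg_left h5 (by positivity) (by gcongr; exact h1.1)

theorem measurable_mu (h : IsSetting fe Emin Emax m k Ω ΓD ΓN E T μh ν κ u Gu p uh ph) :
    Measurable (mu E) := h.measurable.div_const 2

theorem measurable_lamInv (h : IsSetting fe Emin Emax m k Ω ΓD ΓN E T μh ν κ u Gu p uh ph) :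
    Measurable (lamInv E ν) := measurable_const.div (h.measurable.mul_const ν)

theorem disjoint_ΓN (h : IsSetting fe Emin Emax m k Ω ΓD ΓN E T μh ν κ u Gu p uh ph) :
    Disjoint Ω ΓN := by
  have h1 : ΓN ⊆ frontier Ω := by rw [← h.splitting.union_eq]; exact subset_union_right
  rw [h.isOpen.frontier_eq] at h1
  exact Set.disjoint_left.2 fun x hx hxN => (h1 hxN).2 hx

theorem memLp_ph (h : IsSetting fe Emin Emax m k Ω ΓD ΓN E T μh ν κ u Gu p uh ph) :
    MemLp ph 2 (volume.restrict Ω) := by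
  have hK : IsCompact (closure Ω) := by
    rw [← h.mesh.cover]
    exact T.isCompact_biUnion fun s _ => s.finite_toSet.isCompact_convexHull ℝ
  obtain ⟨C, hC⟩ := hK.exists_bound_of_continuousOn h.memQh.continuousOn
  have : IsFiniteMeasure (volume.restrict Ω : Measure (Pt (n + 1))) :=
    isFiniteMeasure_restrict.2 ((measure_mono subset_closure).trans_lt hK.measure_lt_top).ne
  refine MemLp.of_bound ((h.memQh.continuousOn.mono subset_closure).aestronglyMeasurable
    h.isOpen.measurableSet) C ?_
  filter_upwards [ae_restrict_mem h.isOpen.measurableSet] with x hx using hC x (subset_closure hx)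

theorem memLp_err_grad (h : IsSetting fe Emin Emax m k Ω ΓD ΓN E T μh ν κ u Gu p uh ph)
    (i j : Fin (n + 1)) : MemLp (fun x => (Gu x - grad uh x) i j) 2 (volume.restrict Ω) :=
  (h.sol.memH.memLp_grad i j).sub (h.memHh.memH.memLp_grad i j)

theorem memLp_err_pres (h : IsSetting fe Emin Emax m k Ω ΓD ΓN E T μh ν κ u Gu p uh ph) :
    MemLp (fun x => p x - ph x) 2 (volume.restrict Ω) :=
  MemLp.sub h.sol.memQ h.memLp_ph

theorem integrable_energy_parts (h : IsSetting fe Emin Emax m k Ω ΓD ΓN E T μh ν κ u Gu p uh ph) :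
    IntegrableOn (fun x => mu E x * ddot (Gu x - grad uh x) (Gu x - grad uh x)) Ω ∧
    IntegrableOn (fun x => (mu E x)⁻¹ * (p x - ph x) ^ 2) Ω ∧
    IntegrableOn (fun x => lamInv E ν x * (p x - ph x) ^ 2) Ω :=
  ⟨integrable_mul_of_bounded h.measurable_mu h.ae_mu
      (integrable_ddot h.memLp_err_grad h.memLp_err_grad),
    integrable_mul_of_bounded h.measurable_mu.inv h.ae_mu_inv h.memLp_err_pres.integrable_sq,
    integrable_mul_of_bounded h.measurable_lamInv h.ae_lamInv h.memLp_err_pres.integrable_sq⟩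

theorem integrable_energy (h : IsSetting fe Emin Emax m k Ω ΓD ΓN E T μh ν κ u Gu p uh ph) :
    IntegrableOn (energyDensity E ν Gu p uh ph) Ω :=
  (h.integrable_energy_parts.1.add h.integrable_energy_parts.2.1).add h.integrable_energy_parts.2.2

theorem energy_nonneg (h : IsSetting fe Emin Emax m k Ω ΓD ΓN E T μh ν κ u Gu p uh ph)
    {x : Pt (n + 1)} (hx : x ∈ Ω) : 0 ≤ energyDensity E ν Gu p uh ph x := by
  have h1 := (h.mu_mem hx).1
  have h2 := h.lamInv_nonneg hx
  have h3 := ddot_self_nonneg (Gu x - grad uh x)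
  unfold energyDensity
  positivity

theorem tripleNorm_sq (h : IsSetting fe Emin Emax m k Ω ΓD ΓN E T μh ν κ u Gu p uh ph) :
    tripleNorm Ω E ν (fun x => Gu x - grad uh x) (fun x => p x - ph x) ^ 2 =
      ∫ x in Ω, energyDensity E ν Gu p uh ph x := by
  obtain ⟨h1, h2, h3⟩ := h.integrable_energy_parts
  have h4 : ∫ x in Ω, energyDensity E ν Gu p uh ph x =
      (∫ x in Ω, mu E x * ddot (Gu x - grad uh x) (Gu x - grad uh x))
      + (∫ x in Ω, (mu E x)⁻¹ * (p x - ph x) ^ 2) + ∫ x in Ω, lamInv E ν x * (p x - ph x) ^ 2 := by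
    have h12 : IntegrableOn (fun x => mu E x * ddot (Gu x - grad uh x) (Gu x - grad uh x)
        + (mu E x)⁻¹ * (p x - ph x) ^ 2) Ω := h1.add h2
    rw [← integral_add h1 h2, ← integral_add h12 h3]; rfl
  rw [tripleNorm, ← h4, Real.sq_sqrt]
  exact setIntegral_nonneg h.isOpen.measurableSet fun x hx => h.energy_nonneg hx

theorem exists_localData (h : IsSetting fe Emin Emax m k Ω ΓD ΓN E T μh ν κ u Gu p uh ph)
    {s : Finset (Pt (n + 1))} (hs : s ∈ T) :
    ∃ U P Mh, IsLocalData (k + n + 4) s μh uh ph U P Mh :=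
  exists_isLocalData h.mesh h.memHh h.memQh h.proj hs

/-- Almost every point of a simplex is interior. There the global classical gradient agrees with the
one-sided gradient, and the bounds known on `Ω` apply. -/
theorem ae_good (h : IsSetting fe Emin Emax m k Ω ΓD ΓN E T μh ν κ u Gu p uh ph)
    {s : Finset (Pt (n + 1))} (hs : s ∈ T) :
    ∀ᵐ x ∂(volume.restrict (hull s)), x ∈ hull s ∧ x ∈ Ω ∧ grad uh x = gradOn (hull s) uh x := by
  filter_upwards [ae_mem_interior_hull s] with x hx
  exact ⟨interior_subset hx, interior_hull_subset h.isOpen h.lipschitz h.mesh hs hx,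
    grad_eq_gradOn hx⟩

theorem osc_nonneg (h : IsSetting fe Emin Emax m k Ω ΓD ΓN E T μh ν κ u Gu p uh ph)
    {s : Finset (Pt (n + 1))} (hs : s ∈ T) {x : Pt (n + 1)} (hx : x ∈ hull s) :
    0 ≤ oscDensity E μh uh s x := by
  have h1 := h.lower s hs x hx
  have h2 := h.m_pos
  have h3 : 0 < μh s x := by linarith
  have h4 := ddot_self_nonneg (strain (gradOn (hull s) uh x))
  unfold oscDensity
  positivity

theorem memLp_hull_of_memLp (h : IsSetting fe Emin Emax m k Ω ΓD ΓN E T μh ν κ u Gu p uh ph)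
    {s : Finset (Pt (n + 1))} (hs : s ∈ T) {V : Type*} [NormedAddCommGroup V]
    {g : Pt (n + 1) → V} (hg : MemLp g 2 (volume.restrict Ω)) :
    MemLp g 2 (volume.restrict (hull s)) :=
  hg.mono_measure (restrict_hull_le h.isOpen h.lipschitz h.mesh hs)

theorem integrableOn_hull_of_integrableOn
    (h : IsSetting fe Emin Emax m k Ω ΓD ΓN E T μh ν κ u Gu p uh ph)
    {s : Finset (Pt (n + 1))} (hs : s ∈ T) {g : Pt (n + 1) → ℝ} (hg : IntegrableOn g Ω) :
    IntegrableOn g (hull s) :=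
  Integrable.mono_measure hg (restrict_hull_le h.isOpen h.lipschitz h.mesh hs)

theorem ae_hull_of_ae (h : IsSetting fe Emin Emax m k Ω ΓD ΓN E T μh ν κ u Gu p uh ph)
    {s : Finset (Pt (n + 1))} (hs : s ∈ T) {q : Pt (n + 1) → Prop}
    (hq : ∀ᵐ x ∂(volume.restrict Ω), q x) : ∀ᵐ x ∂(volume.restrict (hull s)), q x :=
  (Measure.absolutelyContinuous_of_le
    (restrict_hull_le h.isOpen h.lipschitz h.mesh hs)).ae_le hq

theorem integrable_osc (h : IsSetting fe Emin Emax m k Ω ΓD ΓN E T μh ν κ u Gu p uh ph)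
    {s : Finset (Pt (n + 1))} (hs : s ∈ T) : IntegrableOn (oscDensity E μh uh s) (hull s) := by
  obtain ⟨U, P, Mh, hd⟩ := h.exists_localData hs
  have hK : IsCompact (hull s) := s.finite_toSet.isCompact_convexHull ℝ
  have hfin : IsFiniteMeasure (volume.restrict (hull s) : Measure (Pt (n + 1))) :=
    isFiniteMeasure_restrict.2 hK.measure_lt_top.ne
  have h1 : MemLp (mu E) 2 (volume.restrict (hull s)) :=
    MemLp.of_bound h.measurable_mu.aestronglyMeasurable (Emax / 2) (h.ae_hull_of_ae hs h.ae_mu)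
  have h2 : IntegrableOn (fun x => (mu E x - evalPt Mh x) ^ 2) (hull s) :=
    (h1.sub (memLp_hull (continuous_evalPt Mh) s)).integrable_sq
  have hc : ContinuousOn (fun x => (2 * evalPt Mh x)⁻¹ *
      ∑ i, ∑ j, evalPt (strainPoly U i j) x * evalPt (strainPoly U i j) x) (hull s) := by
    refine ContinuousOn.mul (ContinuousOn.inv₀ (by
      exact (continuous_const.mul (continuous_evalPt Mh)).continuousOn) fun x hx => ?_) ?_
    · have := h.lower s hs x hx
      rw [hd.coef x hx] at this
      have := h.m_pos
      exact mul_ne_zero two_ne_zero (by linarith)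
    · exact (continuous_finsetSum _ fun i _ => continuous_finsetSum _ fun j _ =>
        (continuous_evalPt _).mul (continuous_evalPt _)).continuousOn
  refine (h2.mul_continuousOn hc hK).congr_fun (fun x hx => ?_) hK.measurableSet
  simp only [oscDensity, ddot, hd.strain_eq hx, hd.coef x hx]
  ring

theorem integrable_alpha (h : IsSetting fe Emin Emax m k Ω ΓD ΓN E T μh ν κ u Gu p uh ph)
    {s : Finset (Pt (n + 1))} (hs : s ∈ T) :
    IntegrableOn (fun x => energyDensity E ν Gu p uh ph x + oscDensity E μh uh s x) (hull s) :=
  (h.integrableOn_hull_of_integrableOn hs h.integrable_energy).add (h.integrable_osc hs)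

theorem ae_alpha_nonneg (h : IsSetting fe Emin Emax m k Ω ΓD ΓN E T μh ν κ u Gu p uh ph)
    {s : Finset (Pt (n + 1))} (hs : s ∈ T) :
    ∀ᵐ x ∂(volume.restrict (hull s)),
      0 ≤ energyDensity E ν Gu p uh ph x + oscDensity E μh uh s x := by
  filter_upwards [h.ae_good hs] with x hx
  exact add_nonneg (h.energy_nonneg hx.2.1) (h.osc_nonneg hs hx.1)

theorem localErrSq_nonneg (h : IsSetting fe Emin Emax m k Ω ΓD ΓN E T μh ν κ u Gu p uh ph)
    {s : Finset (Pt (n + 1))} (hs : s ∈ T) : 0 ≤ localErrSq E ν Gu p uh ph μh s :=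
  integral_nonneg_of_ae (h.ae_alpha_nonneg hs)

theorem integrable_momentumInt (h : IsSetting fe Emin Emax m k Ω ΓD ΓN E T μh ν κ u Gu p uh ph)
    {s : Finset (Pt (n + 1))} (hs : s ∈ T) {w : Fin (n + 1) → Pt (n + 1) → ℝ}
    (hw : ∀ i, ContDiff ℝ ∞ (w i)) : IntegrableOn (momentumInt E κ u Gu p w) (hull s) := by
  have hG : ∀ i j, MemLp (fun x => compGrad w x i j) 2 (volume.restrict (hull s)) := fun i j =>
    memLp_hull (continuous_pd (hw i) j) s
  have hGu : ∀ i j, MemLp (fun x => Gu x i j) 2 (volume.restrict (hull s)) := fun i j =>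
    h.memLp_hull_of_memLp hs (h.sol.memH.memLp_grad i j)
  refine ((Integrable.const_mul (integrable_mul_of_bounded h.measurable_mu
    (h.ae_hull_of_ae hs h.ae_mu) (integrable_ddot (memLp_strain hGu) (memLp_strain hG))) 2).sub
    ((h.memLp_hull_of_memLp hs h.sol.memQ).integrable_mul (memLp_trace hG))).sub
    (Integrable.const_mul (integrable_finsetSum _ fun i _ => ?_) κ)
  exact (memLp_apply (h.memLp_hull_of_memLp hs h.sol.memH.memLp) i).integrable_mul
    (memLp_hull (hw i).continuous s)

/-- The patch field is an admissible test function, so this is the exact momentum equation,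
localized to the patch. -/
theorem sum_momentumInt (h : IsSetting fe Emin Emax m k Ω ΓD ΓN E T μh ν κ u Gu p uh ph)
    (hS : S ⊆ T) {w : Finset (Pt (n + 1)) → Fin (n + 1) → Pt (n + 1) → ℝ}
    (hw : ∀ t ∈ S, ∀ i, ContDiff ℝ ∞ (w t i))
    (hz : ∀ φ : Pt (n + 1) → ℝ, ContDiff ℝ ∞ φ → HasCompactSupport φ → Disjoint (tsupport φ) ΓN →
      ∀ i j, ∑ t ∈ S, ∫ x in hull t, pd (fun y => w t i y * φ y) j x = 0) :
    ∑ t ∈ S, ∫ x in hull t, momentumInt E κ u Gu p (w t) x = 0 := by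
  classical
  have hmem := memH_patch h.isOpen h.lipschitz h.mesh hS h.disjoint_ΓN hw hz
  have hmom := h.sol.momentum _ _ hmem
  have hA : IntegrableOn (fun x => mu E x *
      ddot (strain (Gu x)) (strain (patchGrad S w x))) Ω :=
    integrable_mul_of_bounded h.measurable_mu h.ae_mu
      (integrable_ddot (memLp_strain h.sol.memH.memLp_grad) (memLp_strain hmem.memLp_grad))
  have hB : IntegrableOn (fun x => p x * (patchGrad S w x).trace) Ω :=
    MemLp.integrable_mul (p := 2) (q := 2) h.sol.memQ (memLp_trace hmem.memLp_grad)
  have hD : IntegrableOn (fun x => ∑ i, u x i * patchField S w x i) Ω :=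
    integrable_dot h.sol.memH.memLp hmem.memLp
  have hzero : ∫ x in Ω, (2 * (mu E x * ddot (strain (Gu x)) (strain (patchGrad S w x)))
      - p x * (patchGrad S w x).trace - κ * ∑ i, u x i * patchField S w x i) = 0 := by
    have hAB : IntegrableOn (fun x => 2 * (mu E x * ddot (strain (Gu x))
        (strain (patchGrad S w x))) - p x * (patchGrad S w x).trace) Ω := (hA.const_mul 2).sub hB
    rw [integral_sub hAB (hD.const_mul κ), integral_sub (hA.const_mul 2) hB,
      integral_const_mul, integral_const_mul]
    simp only [formA, formB, formD] at hmom
    linarith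
  rw [← hzero]
  symm
  refine setIntegral_patch h.isOpen h.lipschitz h.mesh hS
    (((hA.const_mul 2).sub hB).sub (hD.const_mul κ)) ?_ ?_
  · intro t ht x hx
    have e1 : patchGrad S w x = compGrad (w t) x := by
      rw [patchGrad, sum_indicator_eq h.mesh hS _ (hS ht) hx, if_pos ht]
    have e2 : ∀ i, patchField S w x i = w t i x := fun i => by
      rw [patchField, sum_indicator_eq h.mesh hS _ (hS ht) hx, if_pos ht]
    simp only [Pi.sub_apply, e1, e2, momentumInt]
  · intro t ht htS x hx
    have e1 : patchGrad S w x = 0 := by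
      rw [patchGrad, sum_indicator_eq h.mesh hS _ ht hx, if_neg htS]
    have e2 : ∀ i, patchField S w x i = 0 := fun i => by
      rw [patchField, sum_indicator_eq h.mesh hS _ ht hx, if_neg htS]; rfl
    simp [e1, e2, ddot, strain]

/-- The residual tested with a smooth field on one simplex. -/
theorem errorInt_eq (h : IsSetting fe Emin Emax m k Ω ΓD ΓN E T μh ν κ u Gu p uh ph)
    {s : Finset (Pt (n + 1))} (hs : s ∈ T) {N : ℕ} {U : Fin (n + 1) → MvPolynomial (Fin (n + 1)) ℝ}
    {P Mh : MvPolynomial (Fin (n + 1)) ℝ} (hd : IsLocalData N s μh uh ph U P Mh) (κR : ℝ)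
    {w : Fin (n + 1) → Pt (n + 1) → ℝ} (hw : ∀ i, ContDiff ℝ ∞ (w i)) :
    IntegrableOn (errorInt E κ κR u Gu p uh ph μh s w) (hull s) ∧
    ∫ x in hull s, errorInt E κ κR u Gu p uh ph μh s w x =
      (∫ x in hull s, momentumInt E κ u Gu p w x)
      + ((∫ x in hull s, ∑ i, R1 μh κR uh ph s x i * w i x)
      - ∑ i, ∑ j, ∫ x in hull s, pd (fun y => evalPt (stressPoly U P Mh i j) y * w i y) j x) := by
  have hcS : ∀ i j, ContDiff ℝ ∞ fun y => evalPt (stressPoly U P Mh i j) y * w i y := fun i j =>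
    (contDiff_evalPt _).mul (hw i)
  have h1 : IntegrableOn (fun x => ∑ i, evalPt (residualPoly κR U P Mh i) x * w i x) (hull s) :=
    integrableOn_hull (continuous_finsetSum _ fun i _ =>
      (continuous_evalPt _).mul (hw i).continuous) s
  have h2 : ∀ i j, IntegrableOn (pd (fun y => evalPt (stressPoly U P Mh i j) y * w i y) j) (hull s) :=
    fun i j => integrableOn_hull (continuous_pd (hcS i j) j) s
  have h3 : IntegrableOn (fun x => ∑ i, ∑ j,
      pd (fun y => evalPt (stressPoly U P Mh i j) y * w i y) j x) (hull s) :=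
    integrable_finsetSum _ fun i _ => integrable_finsetSum _ fun j _ => h2 i j
  -- The product rule splits the divergence of stress times `w` into stress against the gradient of
  -- `w` and the divergence of the stress against `w`. The latter cancels within the residual, and
  -- the former combines with the exact equation into differences.
  have hae : ∀ᵐ x ∂(volume.restrict (hull s)), momentumInt E κ u Gu p w x
      + ((∑ i, evalPt (residualPoly κR U P Mh i) x * w i x)
      - ∑ i, ∑ j, pd (fun y => evalPt (stressPoly U P Mh i j) y * w i y) j x) =
      errorInt E κ κR u Gu p uh ph μh s w x := by
    filter_upwards [h.ae_good hs] with x hx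
    obtain ⟨hxs, -, hxg⟩ := hx
    have e1 : ∀ i j, pd (fun y => evalPt (stressPoly U P Mh i j) y * w i y) j x =
        evalPt (stressPoly U P Mh i j) x * compGrad w x i j +
          evalPt (MvPolynomial.pderiv j (stressPoly U P Mh i j)) x * w i x := fun i j => by
      rw [pd_mul (contDiff_evalPt _) (hw i), pd_evalPt]; rfl
    have e2 : ∀ i, evalPt (residualPoly κR U P Mh i) x =
        (∑ j, evalPt (MvPolynomial.pderiv j (stressPoly U P Mh i j)) x) + κR * uh x i := fun i => by
      rw [hd.vel x hxs, residualPoly]; simp [evalPt]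
    have e3 : ∑ i, ∑ j, evalPt (stressPoly U P Mh i j) x * compGrad w x i j =
        2 * μh s x * ddot (strain (gradOn (hull s) uh x)) (strain (compGrad w x))
          - ph x * (compGrad w x).trace := by
      simp only [← hd.stress_eq hxs, sub_mul, Finset.sum_sub_distrib, ddot_strain_right]
      congr 1
      · simp only [ddot, Finset.mul_sum]
        refine Finset.sum_congr rfl fun i _ => Finset.sum_congr rfl fun j _ => ?_
        ring
      · simp [Matrix.trace, Finset.mul_sum]
    have e4 : (∑ i, evalPt (residualPoly κR U P Mh i) x * w i x)
        - ∑ i, ∑ j, pd (fun y => evalPt (stressPoly U P Mh i j) y * w i y) j x =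
        (∑ i, κR * uh x i * w i x)
        - (2 * μh s x * ddot (strain (gradOn (hull s) uh x)) (strain (compGrad w x))
          - ph x * (compGrad w x).trace) := by
      rw [← e3]
      simp only [e1, e2, add_mul, Finset.sum_add_distrib, Finset.sum_mul]
      ring
    rw [e4, momentumInt, errorInt, hxg, strain_sub, ddot_sub]
    simp only [sub_mul, Finset.sum_sub_distrib, Finset.mul_sum, mul_assoc]
    ring
  have h13 : IntegrableOn (fun x => (∑ i, evalPt (residualPoly κR U P Mh i) x * w i x)
      - ∑ i, ∑ j, pd (fun y => evalPt (stressPoly U P Mh i j) y * w i y) j x) (hull s) := h1.sub h3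
  have hint := (h.integrable_momentumInt hs hw).add h13
  refine ⟨hint.congr hae, ?_⟩
  rw [← integral_congr_ae hae, integral_add (h.integrable_momentumInt hs hw) h13,
    integral_sub h1 h3]
  congr 2
  · refine setIntegral_congr_fun (measurableSet_hull s) fun x hx => ?_
    simp only [hd.R1_eq κR hx]
  · rw [integral_finsetSum _ fun i _ => integrable_finsetSum _ fun j _ => h2 i j]
    refine Finset.sum_congr rfl fun i _ => ?_
    rw [integral_finsetSum _ fun j _ => h2 i j]

theorem l2norm_integral (h : IsSetting fe Emin Emax m k Ω ΓD ΓN E T μh ν κ u Gu p uh ph)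
    {s : Finset (Pt (n + 1))} (hs : s ∈ T) {v : Pt (n + 1) → Pt (n + 1)}
    (hv : MemLp v 2 (volume.restrict Ω)) :
    IntegrableOn (fun x => √(∑ i, v x i ^ 2)) (hull s) ∧
    ∫ x in hull s, √(∑ i, v x i ^ 2) ≤ √(volume.real (hull s)) * l2norm (hull s) v := by
  have hK : IsCompact (hull s) := s.finite_toSet.isCompact_convexHull ℝ
  have hfin : IsFiniteMeasure (volume.restrict (hull s) : Measure (Pt (n + 1))) :=
    isFiniteMeasure_restrict.2 hK.measure_lt_top.ne
  have h1 := integral_sqrt_le (μ := volume.restrict (hull s)) (α := fun x => ∑ i, v x i ^ 2)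
    (integrable_finsetSum _ fun i _ =>
      (memLp_apply (h.memLp_hull_of_memLp hs hv) i).integrable_sq)
    (Filter.Eventually.of_forall fun x => Finset.sum_nonneg fun i _ => sq_nonneg _)
  rw [measureReal_restrict_apply_univ] at h1
  exact h1

/-- Each of the first three terms is a coefficient times a root of a part of the energy or
oscillation density, and the root of the coefficient is at most `√(Emax + 2 * Mmax)`. Since the
density contains the λ-term only as a nonnegative summand, the bound does not depend on `ν`. -/
theorem abs_errorInt_le (h : IsSetting fe Emin Emax m k Ω ΓD ΓN E T μh ν κ u Gu p uh ph)
    {s : Finset (Pt (n + 1))} (hs : s ∈ T) {Mmax κh κR : ℝ}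
    (hκ : κR = κh ∨ κR = κ)
    {w : Fin (n + 1) → Pt (n + 1) → ℝ} {b g : ℝ} {x : Pt (n + 1)}
    (hx : x ∈ hull s ∧ x ∈ Ω ∧ grad uh x = gradOn (hull s) uh x)
    (hM : μh s x ≤ Mmax)
    (hb : ∀ i, |w i x| ≤ b) (hg : ∀ i j, |pd (w i) j x| ≤ g) :
    |errorInt E κ κR u Gu p uh ph μh s w x| ≤
      g * (5 * ((n : ℝ) + 1) ^ 2 * √(Emax + 2 * Mmax)) *
        √(energyDensity E ν Gu p uh ph x + oscDensity E μh uh s x)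
      + b * ((n : ℝ) + 1) * (|κ - κh| * √(∑ i, uh x i ^ 2)
        + |κ| * √(∑ i, (u x - uh x) i ^ 2)) := by
  obtain ⟨hxs, hxΩ, hxg⟩ := hx
  set D : ℝ := (n : ℝ) + 1 with hD
  have hD1 : 1 ≤ D := by simp [hD]
  have hg0 : 0 ≤ g := (abs_nonneg _).trans (hg 0 0)
  have hb0 : 0 ≤ b := (abs_nonneg _).trans (hb 0)
  obtain ⟨hmu0, -, hmuE⟩ := h.mu_mem hxΩ
  have hlam := h.lamInv_nonneg hxΩ
  have hμ0 : 0 < μh s x := h.m_pos.trans_le (h.lower s hs x hxs)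
  set α := energyDensity E ν Gu p uh ph x + oscDensity E μh uh s x with hα
  have hG0 := ddot_self_nonneg (Gu x - grad uh x)
  have hS0 := ddot_self_nonneg (strain (gradOn (hull s) uh x))
  have hosc := h.osc_nonneg hs hxs (uh := uh)
  have hB : ∀ i j, |compGrad w x i j| ≤ g := hg
  have hBs := abs_strain_le hB
  set R := √(Emax + 2 * Mmax) with hR
  have hcast : (((n + 1 : ℕ) : ℝ)) = D := by push_cast; rfl
  -- The common form of the three estimates: `c` is the coefficient, either `mu` or `2 μh`, and `q`
  -- the part of the density with weight.
  have hterm : ∀ {c q z : ℝ}, 0 < c → c ≤ Emax + 2 * Mmax → 0 ≤ z → z ^ 2 ≤ c * q → q ≤ α →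
      z ≤ R * √α := by
    intro c q z hc hcE hz hzq hqα
    rw [hR, ← Real.sqrt_mul (hc.le.trans hcE)]
    refine Real.le_sqrt_of_sq_le (hzq.trans ?_)
    have hq : 0 ≤ q := by
      by_contra hneg
      have := mul_neg_of_pos_of_neg hc (not_le.1 hneg)
      nlinarith [sq_nonneg z]
    exact mul_le_mul hcE hqα hq (hc.le.trans hcE)
  have hα1 : mu E x * ddot (Gu x - grad uh x) (Gu x - grad uh x) ≤ α := by
    rw [hα, energyDensity]
    have : 0 ≤ (mu E x)⁻¹ * (p x - ph x) ^ 2 := by positivity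
    have : 0 ≤ lamInv E ν x * (p x - ph x) ^ 2 := by positivity
    linarith
  have hα2 : (mu E x)⁻¹ * (p x - ph x) ^ 2 ≤ α := by
    rw [hα, energyDensity]
    have : 0 ≤ mu E x * ddot (Gu x - grad uh x) (Gu x - grad uh x) := by positivity
    have : 0 ≤ lamInv E ν x * (p x - ph x) ^ 2 := by positivity
    linarith
  have hα3 : oscDensity E μh uh s x ≤ α := by
    rw [hα]; linarith [h.energy_nonneg hxΩ]
  have t1 : |mu E x * ddot (strain (Gu x - grad uh x)) (strain (compGrad w x))| ≤
      D ^ 2 * g * (R * √α) := by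
    rw [abs_mul, abs_of_pos hmu0]
    have h1 := abs_ddot_le (A := strain (Gu x - grad uh x)) hBs
    rw [hcast] at h1
    have h2 : mu E x * √(ddot (strain (Gu x - grad uh x)) (strain (Gu x - grad uh x))) ≤ R * √α := by
      refine hterm hmu0 (by linarith) (by positivity) (?_ : _ ≤ mu E x * (mu E x *
        ddot (Gu x - grad uh x) (Gu x - grad uh x))) hα1
      rw [mul_pow, Real.sq_sqrt (ddot_self_nonneg _), sq, mul_assoc]
      gcongr
      exact ddot_strain_le _
    calc _ ≤ mu E x * (D ^ 2 * (g * √(ddot (strain (Gu x - grad uh x))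
          (strain (Gu x - grad uh x))))) := by gcongr
      _ = D ^ 2 * g * (mu E x * √(ddot (strain (Gu x - grad uh x))
          (strain (Gu x - grad uh x)))) := by ring
      _ ≤ _ := by gcongr
  have t2 : |(p x - ph x) * (compGrad w x).trace| ≤ D ^ 2 * g * (R * √α) := by
    rw [abs_mul]
    have h1 := abs_trace_le hB
    rw [hcast] at h1
    have h2 : |p x - ph x| ≤ R * √α := by
      refine hterm hmu0 (by linarith) (abs_nonneg _) (le_of_eq ?_) hα2
      rw [sq_abs]; field_simp
    calc _ ≤ (R * √α) * (D * g) := by gcongr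
      _ = D * g * (R * √α) := by ring
      _ ≤ D ^ 2 * g * (R * √α) := by
        have : D ≤ D ^ 2 := by nlinarith
        gcongr
  have t3 : |(mu E x - μh s x) * ddot (strain (gradOn (hull s) uh x)) (strain (compGrad w x))| ≤
      D ^ 2 * g * (R * √α) := by
    rw [abs_mul]
    have h1 := abs_ddot_le (A := strain (gradOn (hull s) uh x)) hBs
    rw [hcast] at h1
    have h2 : |mu E x - μh s x| * √(ddot (strain (gradOn (hull s) uh x))
        (strain (gradOn (hull s) uh x))) ≤ R * √α := by
      refine hterm (c := 2 * μh s x) (by positivity) (by linarith) (by positivity)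
        (le_of_eq ?_) hα3
      rw [mul_pow, Real.sq_sqrt hS0, sq_abs, oscDensity]
      field_simp
    calc _ ≤ |mu E x - μh s x| * (D ^ 2 * (g * √(ddot (strain (gradOn (hull s) uh x))
          (strain (gradOn (hull s) uh x))))) := by gcongr
      _ = D ^ 2 * g * (|mu E x - μh s x| * √(ddot (strain (gradOn (hull s) uh x))
          (strain (gradOn (hull s) uh x)))) := by ring
      _ ≤ _ := by gcongr
  have t4 : |∑ i, (κ * u x i - κR * uh x i) * w i x| ≤
      b * D * (|κ - κh| * √(∑ i, uh x i ^ 2) + |κ| * √(∑ i, (u x - uh x) i ^ 2)) := by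
    have h1 : ∀ i, |(κ * u x i - κR * uh x i) * w i x| ≤
        b * (|κ - κh| * √(∑ i, uh x i ^ 2) + |κ| * √(∑ i, (u x - uh x) i ^ 2)) := fun i => by
      -- The splitting into a multiple of `uh` and a multiple of `u - uh`; for `κR = κ` the first
      -- part is absent.
      have h2 : |κ * u x i - κR * uh x i| ≤ |κ - κh| * |uh x i| + |κ| * |(u x - uh x) i| := by
        rcases hκ with rfl | rfl
        · have : κ * u x i - κR * uh x i = (κ - κR) * uh x i + κ * (u x - uh x) i := by
            simp; ring
          rw [this]
          refine (abs_add_le _ _).trans ?_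
          rw [abs_mul, abs_mul]
        · have : κR * u x i - κR * uh x i = κR * (u x - uh x) i := by simp; ring
          rw [this, abs_mul]
          exact le_add_of_nonneg_left (by positivity)
      rw [abs_mul, mul_comm]
      refine mul_le_mul (hb i) (h2.trans ?_) (abs_nonneg _) hb0
      gcongr
      · exact abs_apply_le (fun i => uh x i) i
      · exact abs_apply_le (fun i => (u x - uh x) i) i
    refine (Finset.abs_sum_le_sum_abs _ _).trans ((Finset.sum_le_sum fun i _ => h1 i).trans
      (le_of_eq ?_))
    simp only [Finset.sum_const, Finset.card_univ, Fintype.card_fin, nsmul_eq_mul, hcast]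
    ring
  rw [errorInt]
  have a1 := abs_le.1 t1
  have a2 := abs_le.1 t2
  have a3 := abs_le.1 t3
  have a4 := abs_le.1 t4
  -- The factor 5 counts the three terms with their weights 2, 1 and 2.
  have hfin : g * (5 * D ^ 2 * R) * √α = 5 * (D ^ 2 * g * (R * √α)) := by ring
  rw [hfin, abs_le]
  constructor <;> linarith [a1.1, a1.2, a2.1, a2.2, a3.1, a3.2, a4.1, a4.2]

/-- The test field enters through uniform bounds only, so Cauchy-Schwarz against the constant
function one produces the root of the volume. -/
theorem abs_integral_errorInt_le (h : IsSetting fe Emin Emax m k Ω ΓD ΓN E T μh ν κ u Gu p uh ph)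
    {s : Finset (Pt (n + 1))} (hs : s ∈ T) {Mmax κh κR : ℝ} (hκ : κR = κh ∨ κR = κ)
    {w : Fin (n + 1) → Pt (n + 1) → ℝ} {b g : ℝ} (hM : ∀ x ∈ hull s, μh s x ≤ Mmax)
    (hb0 : 0 ≤ b) (hg0 : 0 ≤ g)
    (hb : ∀ x ∈ hull s, ∀ i, |w i x| ≤ b) (hg : ∀ x ∈ hull s, ∀ i j, |pd (w i) j x| ≤ g) :
    |∫ x in hull s, errorInt E κ κR u Gu p uh ph μh s w x| ≤
      √(volume.real (hull s)) * (g * (5 * ((n : ℝ) + 1) ^ 2 * √(Emax + 2 * Mmax)) *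
        √(localErrSq E ν Gu p uh ph μh s) + b * ((n : ℝ) + 1) * eigTerm κ κh u uh s) := by
  have hK : IsCompact (hull s) := s.finite_toSet.isCompact_convexHull ℝ
  have hfin : IsFiniteMeasure (volume.restrict (hull s) : Measure (Pt (n + 1))) :=
    isFiniteMeasure_restrict.2 hK.measure_lt_top.ne
  obtain ⟨i1, b1⟩ := integral_sqrt_le (h.integrable_alpha hs) (h.ae_alpha_nonneg hs)
  rw [measureReal_restrict_apply_univ] at b1
  obtain ⟨i2, b2⟩ := h.l2norm_integral hs h.memHh.memH.memLp
  obtain ⟨i3, b3⟩ := h.l2norm_integral hs (v := fun x => u x - uh x)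
    (h.sol.memH.memLp.sub h.memHh.memH.memLp)
  set K := 5 * ((n : ℝ) + 1) ^ 2 * √(Emax + 2 * Mmax)
  have j1 := i1.const_mul (g * K)
  have j23 : IntegrableOn (fun x => |κ - κh| * √(∑ i, uh x i ^ 2)
      + |κ| * √(∑ i, (u x - uh x) i ^ 2)) (hull s) := (i2.const_mul |κ - κh|).add (i3.const_mul |κ|)
  have j2 := j23.const_mul (b * ((n : ℝ) + 1))
  have hbd : |∫ x in hull s, errorInt E κ κR u Gu p uh ph μh s w x| ≤
      ∫ x in hull s, (g * K * √(energyDensity E ν Gu p uh ph x + oscDensity E μh uh s x)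
      + b * ((n : ℝ) + 1) * (|κ - κh| * √(∑ i, uh x i ^ 2)
        + |κ| * √(∑ i, (u x - uh x) i ^ 2))) := by
    rw [← Real.norm_eq_abs]
    refine norm_integral_le_of_norm_le (j1.add j2) ?_
    filter_upwards [h.ae_good hs] with x hx
    exact h.abs_errorInt_le hs hκ hx (hM x hx.1) (hb x hx.1) (hg x hx.1)
  refine hbd.trans ?_
  rw [integral_add j1 j2, integral_const_mul, integral_const_mul,
    integral_add (i2.const_mul _) (i3.const_mul _), integral_const_mul, integral_const_mul]
  have hK0 : 0 ≤ K := by positivity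
  calc _ ≤ g * K * (√(volume.real (hull s)) * √(localErrSq E ν Gu p uh ph μh s))
      + b * ((n : ℝ) + 1) * (|κ - κh| * (√(volume.real (hull s)) * l2norm (hull s) uh)
        + |κ| * (√(volume.real (hull s)) * l2norm (hull s) (fun x => u x - uh x))) := by
        gcongr
        exact b1
    _ = _ := by rw [eigTerm]; ring

/-- The residual tested with a field on a patch is the sum of the local errors. -/
theorem sum_residual_eq (h : IsSetting fe Emin Emax m k Ω ΓD ΓN E T μh ν κ u Gu p uh ph)
    (hS : S ⊆ T) {w : Finset (Pt (n + 1)) → Fin (n + 1) → Pt (n + 1) → ℝ}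
    (hw : ∀ t ∈ S, ∀ i, ContDiff ℝ ∞ (w t i))
    (hz : ∀ φ : Pt (n + 1) → ℝ, ContDiff ℝ ∞ φ → HasCompactSupport φ → Disjoint (tsupport φ) ΓN →
      ∀ i j, ∑ t ∈ S, ∫ x in hull t, pd (fun y => w t i y * φ y) j x = 0)
    {N : ℕ} {U : Finset (Pt (n + 1)) → Fin (n + 1) → MvPolynomial (Fin (n + 1)) ℝ}
    {P Mh : Finset (Pt (n + 1)) → MvPolynomial (Fin (n + 1)) ℝ}
    (hd : ∀ t ∈ S, IsLocalData N t μh uh ph (U t) (P t) (Mh t)) (κR : ℝ) :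
    ∑ t ∈ S, ((∫ x in hull t, ∑ i, R1 μh κR uh ph t x i * w t i x)
      - ∑ i, ∑ j, ∫ x in hull t,
          pd (fun y => evalPt (stressPoly (U t) (P t) (Mh t) i j) y * w t i y) j x) =
      ∑ t ∈ S, ∫ x in hull t, errorInt E κ κR u Gu p uh ph μh t (w t) x := by
  have h1 := h.sum_momentumInt hS hw hz
  have h2 : ∀ t ∈ S, _ := fun t ht => (h.errorInt_eq (hS ht) (hd t ht) κR (hw t ht)).2
  rw [Finset.sum_congr rfl h2, Finset.sum_add_distrib, h1, zero_add]

end IsSetting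

/-! ### Polynomials in local coordinates and bubble functions -/

section Local
open MvPolynomial
variable {n : ℕ} {s F : Finset (Pt (n + 1))} {a : Pt (n + 1)} {f : Fin (n + 1) → Pt (n + 1)}
  {M : (Fin (n + 1) → ℝ) ≃L[ℝ] Pt (n + 1)}

theorem IsFrame.exists_pullback (h : IsFrame s F a f M) (P : MvPolynomial (Fin (n + 1)) ℝ) :
    ∃ Q : MvPolynomial (Fin (n + 1)) ℝ, Q.totalDegree ≤ P.totalDegree ∧
      ∀ y, eval y Q = evalPt P (a + M y) := by
  obtain ⟨Q, h1, h2⟩ := exists_eval_affine (fun i => a i) (fun i j => (f j - a) i) P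
  refine ⟨Q, h1, fun y => ?_⟩
  rw [h2, evalPt]
  congr 1
  refine congrArg _ (funext fun i => ?_)
  rw [h.map_eq, PiLp.add_apply, WithLp.ofLp_sum, Finset.sum_apply]
  congr 1
  exact Finset.sum_congr rfl fun j _ => by simp [mul_comm]

theorem exists_facet_pullback (f : Fin (n + 1) → Pt (n + 1)) (P : MvPolynomial (Fin (n + 1)) ℝ) :
    ∃ Q : MvPolynomial (Fin n) ℝ, Q.totalDegree ≤ P.totalDegree ∧
      ∀ y, eval y Q = evalPt P (facetPt f y) := by
  obtain ⟨Q, h1, h2⟩ := exists_eval_affine (fun i => f 0 i) (fun i j => (f (Fin.succ j) - f 0) i) P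
  refine ⟨Q, h1, fun y => ?_⟩
  rw [h2, evalPt]
  congr 1
  refine congrArg _ (funext fun i => ?_)
  have : facetPt f y = f 0 + ∑ j, y j • (f j.succ - f 0) := by
    simp only [facetPt, smul_sub, Finset.sum_sub_distrib, ← Finset.sum_smul, sub_smul, one_smul]
    abel
  rw [this, PiLp.add_apply, WithLp.ofLp_sum, Finset.sum_apply]
  congr 1
  exact Finset.sum_congr rfl fun j _ => by simp [mul_comm]

/-- The function with the polynomial `W` in the coordinates of a simplex. -/
def coordFn (a : Pt (n + 1)) (M : (Fin (n + 1) → ℝ) ≃L[ℝ] Pt (n + 1))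
    (W : MvPolynomial (Fin (n + 1)) ℝ) (x : Pt (n + 1)) : ℝ :=
  eval (fun i => M.symm (x - a) i) W

theorem hasFDerivAt_coord (a : Pt (n + 1)) (M : (Fin (n + 1) → ℝ) ≃L[ℝ] Pt (n + 1))
    (i : Fin (n + 1)) (x : Pt (n + 1)) : HasFDerivAt (fun x => M.symm (x - a) i)
      ((ContinuousLinearMap.proj i).comp (M.symm : Pt (n + 1) →L[ℝ] (Fin (n + 1) → ℝ))) x := by
  have h1 : HasFDerivAt (fun x => x - a) (ContinuousLinearMap.id ℝ (Pt (n + 1))) x :=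
    (hasFDerivAt_id x).sub_const a
  exact ((ContinuousLinearMap.proj i).comp
    (M.symm : Pt (n + 1) →L[ℝ] (Fin (n + 1) → ℝ))).hasFDerivAt.comp x h1

theorem contDiff_coordFn (a : Pt (n + 1)) (M : (Fin (n + 1) → ℝ) ≃L[ℝ] Pt (n + 1))
    (W : MvPolynomial (Fin (n + 1)) ℝ) : ContDiff ℝ ∞ (coordFn a M W) :=
  contDiff_eval (ℓ := fun i x => M.symm (x - a) i) (fun i =>
    ((ContinuousLinearMap.proj i).comp
      (M.symm : Pt (n + 1) →L[ℝ] (Fin (n + 1) → ℝ))).contDiff.comp (contDiff_id.sub contDiff_const)) W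

theorem pd_coordFn (a : Pt (n + 1)) (M : (Fin (n + 1) → ℝ) ≃L[ℝ] Pt (n + 1))
    (W : MvPolynomial (Fin (n + 1)) ℝ) (j : Fin (n + 1)) (x : Pt (n + 1)) :
    pd (coordFn a M W) j x =
      ∑ l, coordFn a M (pderiv l W) x * M.symm (EuclideanSpace.single j 1) l := by
  have h1 := hasFDerivAt_eval (ℓ := fun i x => M.symm (x - a) i)
    (fun i => hasFDerivAt_coord a M i x) W
  have h2 : HasFDerivAt (coordFn a M W) _ x := h1
  rw [pd, h2.fderiv]
  simp [coordFn]

theorem coordFn_add_map (a : Pt (n + 1)) (M : (Fin (n + 1) → ℝ) ≃L[ℝ] Pt (n + 1))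
    (W : MvPolynomial (Fin (n + 1)) ℝ) (y : Fin (n + 1) → ℝ) :
    coordFn a M W (a + M y) = eval y W := by
  simp [coordFn]

/-- The chain rule with `n + 1` local coordinates, each with derivatives at most `1 / r`: the
inverse estimate on the actual simplex. -/
theorem IsFrame.coordFn_bounds (h : IsFrame s F a f M) {W : MvPolynomial (Fin (n + 1)) ℝ} {β : ℝ}
    {c : Pt (n + 1)} {r : ℝ} (hr : 0 < r) (hb : Metric.closedBall c r ⊆ hull s)
    (h1 : ∀ y ∈ refSimplex (n + 1), |eval y W| ≤ β)
    (h2 : ∀ y ∈ refSimplex (n + 1), ∀ l, |eval y (pderiv l W)| ≤ β) {x : Pt (n + 1)}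
    (hx : x ∈ hull s) :
    |coordFn a M W x| ≤ β ∧ ∀ j, |pd (coordFn a M W) j x| ≤ ((n : ℝ) + 1) * β / r := by
  have hy := h.mem_hull.1 hx
  refine ⟨h1 _ hy, fun j => ?_⟩
  rw [pd_coordFn]
  refine (Finset.abs_sum_le_sum_abs _ _).trans ?_
  have h3 : ∀ l ∈ Finset.univ, |coordFn a M (pderiv l W) x *
      M.symm (EuclideanSpace.single j 1) l| ≤ β * (1 / r) := fun l _ => by
    rw [abs_mul]
    have h4 := h.abs_symm_le hr hb (EuclideanSpace.single j 1) l
    rw [PiLp.norm_single, norm_one] at h4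
    exact mul_le_mul (h2 _ hy l) h4 (abs_nonneg _) ((abs_nonneg _).trans (h2 _ hy l))
  refine (Finset.sum_le_sum h3).trans (le_of_eq ?_)
  simp
  ring

/-- The element bubble on the reference simplex. -/
def bubblePoly (n : ℕ) : MvPolynomial (Fin n) ℝ := (1 - ∑ i, X i) * ∏ i, X i

theorem eval_bubblePoly (y : Fin n → ℝ) : eval y (bubblePoly n) = refBubble y := by
  simp [bubblePoly, refBubble]

/-- The product of the coordinates: the bubble of the facet opposite to the origin. -/
def facetBubblePoly (n : ℕ) : MvPolynomial (Fin n) ℝ := ∏ i, X i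

theorem eval_facetBubblePoly (y : Fin n → ℝ) : eval y (facetBubblePoly n) = ∏ i, y i := by
  simp [facetBubblePoly]

theorem isCompact_cube (n : ℕ) : IsCompact {y : Fin n → ℝ | ∀ i, |y i| ≤ 1} := by
  convert isCompact_Icc (a := fun _ : Fin n => (-1 : ℝ)) (b := fun _ => 1) using 1
  ext y; simp [abs_le, Set.mem_Icc, Pi.le_def, forall_and]

theorem exists_cube_bound (B : MvPolynomial (Fin n) ℝ) : ∃ K : ℝ, 0 < K ∧ ∀ y : Fin n → ℝ,
    (∀ i, |y i| ≤ 1) → |eval y B| ≤ K ∧ ∀ l, |eval y (pderiv l B)| ≤ K := by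
  have hb : ∀ Q : MvPolynomial (Fin n) ℝ, ∃ K : ℝ, 0 ≤ K ∧ ∀ y : Fin n → ℝ, (∀ i, |y i| ≤ 1) →
      |eval y Q| ≤ K := fun Q => by
    obtain ⟨K, hK⟩ := (isCompact_cube n).exists_bound_of_continuousOn
      (MvPolynomial.continuous_eval Q).continuousOn
    exact ⟨max K 0, le_max_right _ _, fun y hy => (hK y hy).trans (le_max_left _ _)⟩
  choose K hK0 hK using hb
  refine ⟨K B + ∑ l, K (pderiv l B) + 1, ?_, fun y hy => ⟨?_, fun l => ?_⟩⟩
  · have := hK0 B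
    have := Finset.sum_nonneg fun l (_ : l ∈ Finset.univ) => hK0 (pderiv l B)
    linarith
  · have := hK B y hy
    have := Finset.sum_nonneg fun l (_ : l ∈ Finset.univ) => hK0 (pderiv l B)
    linarith
  · have h1 := hK (pderiv l B) y hy
    have h2 := Finset.single_le_sum (f := fun l => K (pderiv l B)) (fun l _ => hK0 _)
      (Finset.mem_univ l)
    have := hK0 B
    linarith

theorem abs_eval_mul_le {B Q : MvPolynomial (Fin n) ℝ} {K ρ : ℝ} {y : Fin n → ℝ} (hK0 : 0 ≤ K)
    (hB : |eval y B| ≤ K ∧ ∀ l, |eval y (pderiv l B)| ≤ K)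
    (hQ : |eval y Q| ≤ ρ ∧ ∀ l, |eval y (pderiv l Q)| ≤ ρ) :
    |eval y (B * Q)| ≤ 2 * K * ρ ∧ ∀ l, |eval y (pderiv l (B * Q))| ≤ 2 * K * ρ := by
  have hρ : 0 ≤ ρ := (abs_nonneg _).trans hQ.1
  refine ⟨?_, fun l => ?_⟩
  · rw [map_mul, abs_mul]
    have := mul_le_mul hB.1 hQ.1 (abs_nonneg _) hK0
    have := mul_nonneg hK0 hρ
    linarith
  · rw [Derivation.leibniz, map_add, smul_eq_mul, smul_eq_mul, map_mul, map_mul]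
    refine (abs_add_le _ _).trans ?_
    rw [abs_mul, abs_mul]
    have h1 := mul_le_mul hB.1 (hQ.2 l) (abs_nonneg _) hK0
    have h2 := mul_le_mul (hB.2 l) hQ.1 (abs_nonneg _) hK0
    linarith

theorem refBubble_le_one {y : Fin n → ℝ} (hy : y ∈ refSimplex n) : refBubble y ≤ 1 := by
  have h1 : 0 ≤ ∑ i, y i := Finset.sum_nonneg fun i _ => hy.1 i
  have h2 : ∏ i, y i ≤ 1 := Finset.prod_le_one (fun i _ => hy.1 i) fun i _ => refSimplex_coord_le hy i
  have h3 : 0 ≤ ∏ i, y i := Finset.prod_nonneg fun i _ => hy.1 i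
  rw [refBubble]
  have h4 := hy.2
  nlinarith

end Local

/-! ### Bounds on one simplex -/

namespace IsSetting

variable {n : ℕ} {fe : FEFamily} {Emin Emax m : ℝ} {k : ℕ} {Ω ΓD ΓN : Set (Pt (n + 1))}
  {E : Pt (n + 1) → ℝ} {T S : Finset (Finset (Pt (n + 1)))}
  {μh : Finset (Pt (n + 1)) → Pt (n + 1) → ℝ} {ν κ : ℝ} {u : Pt (n + 1) → Pt (n + 1)}
  {Gu : Pt (n + 1) → Matrix (Fin (n + 1)) (Fin (n + 1)) ℝ} {p : Pt (n + 1) → ℝ}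
  {uh : Pt (n + 1) → Pt (n + 1)} {ph : Pt (n + 1) → ℝ}

theorem Emax_pos (h : IsSetting fe Emin Emax m k Ω ΓD ΓN E T μh ν κ u Gu p uh ph)
    {s : Finset (Pt (n + 1))} (hs : s ∈ T) : 0 < Emax := by
  obtain ⟨F, a, f, M, hf⟩ := exists_frame h.mesh hs
  obtain ⟨x, hx⟩ := hf.interior_hull_nonempty
  have := h.bounds x (interior_hull_subset h.isOpen h.lipschitz h.mesh hs hx)
  have := h.Emin_pos
  linarith

/-- The projected coefficient is bounded from above. -/
theorem coef_le (h : IsSetting fe Emin Emax m k Ω ΓD ΓN E T μh ν κ u Gu p uh ph)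
    {s : Finset (Pt (n + 1))} (hs : s ∈ T) {C : ℝ} (hC0 : 0 < C)
    (hC : ∀ P : MvPolynomial (Fin (n + 1)) ℝ, P.totalDegree ≤ k → ∀ y : Fin (n + 1) → ℝ,
      (∀ i, |y i| ≤ 1) → (MvPolynomial.eval y P) ^ 2 ≤
        C * ∫ z in refSimplex (n + 1), refBubble z * (MvPolynomial.eval z P) ^ 2)
    {x : Pt (n + 1)} (hx : x ∈ hull s) : μh s x ≤ (C + 1) * Emax := by
  obtain ⟨F, a, f, M, hf⟩ := exists_frame h.mesh hs
  obtain ⟨hpoly, horth⟩ := h.proj s hs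
  obtain ⟨Mh, hM1, hM2⟩ := hpoly.exists_evalPt
  obtain ⟨Q, hQ1, hQ2⟩ := hf.exists_pullback Mh
  have hK : IsCompact (hull s) := s.finite_toSet.isCompact_convexHull ℝ
  have hfin : IsFiniteMeasure (volume.restrict (hull s) : Measure (Pt (n + 1))) :=
    isFiniteMeasure_restrict.2 hK.measure_lt_top.ne
  have hmu : MemLp (mu E) 2 (volume.restrict (hull s)) :=
    MemLp.of_bound h.measurable_mu.aestronglyMeasurable (Emax / 2) (h.ae_hull_of_ae hs h.ae_mu)
  have hMh := memLp_hull (continuous_evalPt Mh) s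
  have hE := h.Emax_pos hs
  have i1 : IntegrableOn (fun x => evalPt Mh x ^ 2) (hull s) := hMh.integrable_sq
  have i2 : IntegrableOn (fun x => (mu E x - evalPt Mh x) * evalPt Mh x) (hull s) :=
    (hmu.sub hMh).integrable_mul hMh
  have horth' : ∫ x in hull s, (mu E x - evalPt Mh x) * evalPt Mh x = 0 := by
    rw [← horth _ hpoly]
    refine setIntegral_congr_fun (measurableSet_hull s) fun x hx => ?_
    simp only [hM2 x hx]
  have hle : ∫ x in hull s, (evalPt Mh x ^ 2 - 2 * ((mu E x - evalPt Mh x) * evalPt Mh x)) ≤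
      ∫ _x in hull s, 2 * (Emax / 2) ^ 2 := by
    have : ∫ x in hull s, (evalPt Mh x ^ 2 - 2 * ((mu E x - evalPt Mh x) * evalPt Mh x)) =
        ∫ x in hull s, (evalPt Mh x ^ 2) := by
      rw [integral_sub i1 (i2.const_mul 2), integral_const_mul, horth']; ring
    -- By orthogonality the squared norm of the projection `a` of `b = mu E` is the integral of `2ab
    -- - a²`, which is at most `b²`: stability of the projection in $L^2$, obtained by testing with
    -- the projection itself.
    have h2 : ∫ x in hull s, evalPt Mh x ^ 2 =
        ∫ x in hull s, (2 * (evalPt Mh x * mu E x) - evalPt Mh x ^ 2) := by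
      have e : ∀ x, 2 * (evalPt Mh x * mu E x) - evalPt Mh x ^ 2 =
          evalPt Mh x ^ 2 + 2 * ((mu E x - evalPt Mh x) * evalPt Mh x) := fun x => by ring
      simp only [e]
      rw [integral_add i1 (i2.const_mul 2), integral_const_mul, horth']; ring
    rw [this, h2]
    refine integral_mono_ae (((hMh.integrable_mul hmu).const_mul 2).sub i1)
      (integrable_const _) ?_
    filter_upwards [h.ae_hull_of_ae hs h.ae_mu] with x hx
    have h3 := sq_le_sq' (abs_le.1 hx).1 (abs_le.1 hx).2
    nlinarith [sq_nonneg (evalPt Mh x - mu E x), sq_nonneg Emax]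
  have hsq : ∫ x in hull s, evalPt Mh x ^ 2 ≤ volume.real (hull s) * (2 * (Emax / 2) ^ 2) := by
    rw [integral_sub i1 (i2.const_mul 2), integral_const_mul, horth'] at hle
    simpa using hle
  rw [hf.setIntegral_hull, hf.hull_real_eq, mul_assoc] at hsq
  have hsq2 := le_of_mul_le_mul_left hsq (jac_pos M)
  simp only [← hQ2] at hsq2
  have hbub : ∫ z in refSimplex (n + 1), refBubble z * (MvPolynomial.eval z Q) ^ 2 ≤
      ∫ z in refSimplex (n + 1), (MvPolynomial.eval z Q) ^ 2 := by
    refine setIntegral_mono_on ?_ ?_ (measurableSet_refSimplex _) fun z hz => ?_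
    · exact (continuous_refBubble.mul ((MvPolynomial.continuous_eval Q).pow 2)).continuousOn.integrableOn_compact
        (isCompact_refSimplex _)
    · exact ((MvPolynomial.continuous_eval Q).pow 2).continuousOn.integrableOn_compact
        (isCompact_refSimplex _)
    · exact mul_le_of_le_one_left (sq_nonneg _) (refBubble_le_one hz)
  have hy := hf.mem_hull.1 hx
  -- The norm equivalence on the reference simplex turns the $L^2$ bound into a pointwise one; the
  -- volume factor has already cancelled.
  have h1 := hC Q (hQ1.trans hM1) _ (fun i => refSimplex_abs_le hy i)
  rw [hQ2] at h1
  simp only [ContinuousLinearEquiv.apply_symm_apply, add_sub_cancel] at h1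
  rw [← hM2 x hx] at h1
  have hvol := refSimplex_real_le_one (n + 1)
  have h2 : (μh s x) ^ 2 ≤ C * (1 * (2 * (Emax / 2) ^ 2)) := by
    refine h1.trans (mul_le_mul_of_nonneg_left ?_ hC0.le)
    exact (hbub.trans hsq2).trans (by gcongr)
  -- The bound obtained is `C * Emax ^ 2 / 2`; the cruder form avoids a square root of `C`.
  refine abs_le_of_sq_le_sq' (h2.trans ?_) (by positivity) |>.2
  have : C ≤ (C + 1) ^ 2 := by nlinarith
  nlinarith [sq_nonneg Emax, mul_le_mul_of_nonneg_right this (sq_nonneg Emax)]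

end IsSetting

/-! ### The element residual -/

section Bubbles
open MvPolynomial
variable {n : ℕ} {s F : Finset (Pt (n + 1))} {a : Pt (n + 1)} {f : Fin (n + 1) → Pt (n + 1)}
  {M : (Fin (n + 1) → ℝ) ≃L[ℝ] Pt (n + 1)}

/-- The element bubble vanishes on every facet. The factor `g` is free: smooth test functions show
that the bubble field is admissible, and stress components remove the facet terms from the residual.
-/
theorem IsFrame.integral_pd_bubble (h : IsFrame s F a f M) {g : Pt (n + 1) → ℝ}
    (hg : ContDiff ℝ ∞ g) (Q : MvPolynomial (Fin (n + 1)) ℝ) (j : Fin (n + 1)) :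
    ∫ x in hull s, pd (fun y => g y * coordFn a M (bubblePoly (n + 1) * Q) y) j x = 0 := by
  rw [h.divergence (((hg.mul (contDiff_coordFn a M _)).of_le (by exact_mod_cast le_top)))]
  · have : facetInt f (fun y => g y * coordFn a M (bubblePoly (n + 1) * Q) y) = 0 := by
      refine integral_eq_zero_of_ae (Filter.Eventually.of_forall fun y => ?_)
      simp [coordFn, eval_bubblePoly, h.symm_facetPt, refBubble, Fin.sum_univ_succ]
    rw [this, mul_zero]
  · intro x _ j hj
    simp only [coordFn, map_mul, eval_bubblePoly, refBubble]
    rw [Finset.prod_eq_zero (Finset.mem_univ j) hj]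
    ring

/-- The product of all coordinates vanishes on every facet but `F`, where the first coordinate is
one minus the sum of the others and the product becomes the bubble of the parameters. `Q` is
extended off the facet by ignoring the first coordinate. -/
theorem IsFrame.integral_pd_facetBubble (h : IsFrame s F a f M) {g : Pt (n + 1) → ℝ}
    (hg : ContDiff ℝ ∞ g) (Q : MvPolynomial (Fin n) ℝ) (j : Fin (n + 1)) :
    ∫ x in hull s, pd (fun y => g y *
        coordFn a M (facetBubblePoly (n + 1) * rename Fin.succ Q) y) j x =
      outerNormal s F j * facetJac s F a f M *
        ∫ y in refSimplex n, g (facetPt f y) * (refBubble y * eval y Q) := by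
  rw [h.divergence (((hg.mul (contDiff_coordFn a M _)).of_le (by exact_mod_cast le_top)))]
  · congr 1
    refine integral_congr_ae (Filter.Eventually.of_forall fun y => ?_)
    simp only [coordFn, map_mul, eval_facetBubblePoly, h.symm_facetPt, Fin.prod_univ_succ,
      eval_rename, refBubble]
    simp [Function.comp_def]
  · intro x _ j hj
    simp only [coordFn, map_mul, eval_facetBubblePoly]
    rw [Finset.prod_eq_zero (Finset.mem_univ j) hj]
    ring

end Bubbles

/-- `C` bounds polynomials of degree at most `N` and their derivatives on the unit cube through
their bubble-weighted norm. -/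
def IsPolyBound (n N : ℕ) (C : ℝ) : Prop := ∀ P : MvPolynomial (Fin n) ℝ,
    P.totalDegree ≤ N → ∀ y : Fin n → ℝ, (∀ i, |y i| ≤ 1) →
      (MvPolynomial.eval y P) ^ 2 ≤
          C * ∫ z in refSimplex n, refBubble z * (MvPolynomial.eval z P) ^ 2 ∧
      ∀ i, (MvPolynomial.eval y (MvPolynomial.pderiv i P)) ^ 2 ≤
          C * ∫ z in refSimplex n, refBubble z * (MvPolynomial.eval z P) ^ 2

/-- `K` bounds the polynomial `B` and its derivatives on the unit cube. -/
def IsCubeBound {n : ℕ} (B : MvPolynomial (Fin n) ℝ) (K : ℝ) : Prop :=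
  ∀ y : Fin n → ℝ, (∀ i, |y i| ≤ 1) → |MvPolynomial.eval y B| ≤ K ∧
    ∀ l, |MvPolynomial.eval y (MvPolynomial.pderiv l B)| ≤ K

theorem integral_bubble_sq_nonneg {n : ℕ} (P : MvPolynomial (Fin n) ℝ) :
    0 ≤ ∫ z in refSimplex n, refBubble z * (MvPolynomial.eval z P) ^ 2 :=
  setIntegral_nonneg (measurableSet_refSimplex n) fun _ hz =>
    mul_nonneg (refBubble_nonneg hz) (sq_nonneg _)

/-- Bounds for a family of polynomials through the sum of their bubble-weighted norms. -/
theorem IsPolyBound.abs_le {n N : ℕ} {C : ℝ} (hC : IsPolyBound n N C) (hC0 : 0 ≤ C) {ι : Type*}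
    [Fintype ι] {Q : ι → MvPolynomial (Fin n) ℝ} (hQ : ∀ i, (Q i).totalDegree ≤ N) (i : ι)
    {y : Fin n → ℝ} (hy : ∀ i, |y i| ≤ 1) :
    |MvPolynomial.eval y (Q i)| ≤
      √(C * ∑ i, ∫ z in refSimplex n, refBubble z * (MvPolynomial.eval z (Q i)) ^ 2) ∧
    ∀ l, |MvPolynomial.eval y (MvPolynomial.pderiv l (Q i))| ≤
      √(C * ∑ i, ∫ z in refSimplex n, refBubble z * (MvPolynomial.eval z (Q i)) ^ 2) := by
  have h1 := Finset.single_le_sum (f := fun i => ∫ z in refSimplex n, refBubble z *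
    (MvPolynomial.eval z (Q i)) ^ 2) (fun i _ => integral_bubble_sq_nonneg (Q i)) (Finset.mem_univ i)
  have h2 := mul_le_mul_of_nonneg_left h1 hC0
  exact ⟨Real.abs_le_sqrt (((hC _ (hQ i) y hy).1).trans h2),
    fun l => Real.abs_le_sqrt (((hC _ (hQ i) y hy).2 l).trans h2)⟩

/-- The square of the local error, including data oscillation and higher order terms. -/
def elemErrSq {d : ℕ} (E : Pt d → ℝ) (ν : ℝ) (Gu : Pt d → Matrix (Fin d) (Fin d) ℝ)
    (p : Pt d → ℝ) (uh : Pt d → Pt d) (ph : Pt d → ℝ) (μh : Finset (Pt d) → Pt d → ℝ)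
    (κ κh : ℝ) (u : Pt d → Pt d) (s : Finset (Pt d)) : ℝ :=
  localErrSq E ν Gu p uh ph μh s + (Metric.diam (hull s) * eigTerm κ κh u uh s) ^ 2

theorem eigTerm_nonneg {d : ℕ} (κ κh : ℝ) (u uh : Pt d → Pt d) (s : Finset (Pt d)) :
    0 ≤ eigTerm κ κh u uh s := by
  unfold eigTerm l2norm; positivity

namespace IsSetting

variable {n : ℕ} {fe : FEFamily} {Emin Emax m : ℝ} {k : ℕ} {Ω ΓD ΓN : Set (Pt (n + 1))}
  {E : Pt (n + 1) → ℝ} {T S : Finset (Finset (Pt (n + 1)))}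
  {μh : Finset (Pt (n + 1)) → Pt (n + 1) → ℝ} {ν κ : ℝ} {u : Pt (n + 1) → Pt (n + 1)}
  {Gu : Pt (n + 1) → Matrix (Fin (n + 1)) (Fin (n + 1)) ℝ} {p : Pt (n + 1) → ℝ}
  {uh : Pt (n + 1) → Pt (n + 1)} {ph : Pt (n + 1) → ℝ}

/-- The error functional tested with a field which is bounded in terms of `β`. -/
theorem abs_integral_errorInt_le_elemErr
    (h : IsSetting fe Emin Emax m k Ω ΓD ΓN E T μh ν κ u Gu p uh ph)
    {s : Finset (Pt (n + 1))} (hs : s ∈ T) {Mmax κh κR σ r : ℝ} (hκ : κR = κh ∨ κR = κ)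
    (hM : ∀ x ∈ hull s, μh s x ≤ Mmax) {w : Fin (n + 1) → Pt (n + 1) → ℝ} {β : ℝ} (hβ : 0 ≤ β)
    (hr : 0 < r) (hσ : Metric.diam (hull s) ≤ σ * r)
    (hb : ∀ x ∈ hull s, ∀ i, |w i x| ≤ β ∧ ∀ j, |pd (w i) j x| ≤ ((n : ℝ) + 1) * β / r) :
    Metric.diam (hull s) * |∫ x in hull s, errorInt E κ κR u Gu p uh ph μh s w x| ≤
      β * √(volume.real (hull s)) * (((n : ℝ) + 1) *
        (5 * ((n : ℝ) + 1) ^ 2 * √(Emax + 2 * Mmax) * σ + 1)) *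
        √(elemErrSq E ν Gu p uh ph μh κ κh u s) := by
  have h1 := h.abs_integral_errorInt_le hs hκ (w := w) hM hβ
    (g := ((n : ℝ) + 1) * β / r) (by positivity) (fun x hx i => (hb x hx i).1)
    (fun x hx i j => (hb x hx i).2 j)
  have hd0 : 0 ≤ Metric.diam (hull s) := Metric.diam_nonneg
  have hσ0 : 0 ≤ σ := by
    by_contra hneg
    have := mul_neg_of_neg_of_pos (not_le.1 hneg) hr
    linarith
  have he := eigTerm_nonneg κ κh u uh s
  have hL := h.localErrSq_nonneg hs
  have h2 : √(localErrSq E ν Gu p uh ph μh s) ≤ √(elemErrSq E ν Gu p uh ph μh κ κh u s) :=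
    Real.sqrt_le_sqrt (by rw [elemErrSq]; linarith [sq_nonneg (Metric.diam (hull s) *
      eigTerm κ κh u uh s)])
  have h3 : Metric.diam (hull s) * eigTerm κ κh u uh s ≤
      √(elemErrSq E ν Gu p uh ph μh κ κh u s) :=
    Real.le_sqrt_of_sq_le (by rw [elemErrSq]; linarith)
  set X := √(elemErrSq E ν Gu p uh ph μh κ κh u s)
  set A := 5 * ((n : ℝ) + 1) ^ 2 * √(Emax + 2 * Mmax) with hA
  have hA0 : 0 ≤ A := by positivity
  -- Shape regularity absorbs the factor `1 / r` from differentiating the test field.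
  have h4 : Metric.diam (hull s) / r ≤ σ := by rwa [div_le_iff₀ hr]
  calc _ ≤ Metric.diam (hull s) * (√(volume.real (hull s)) * (((n : ℝ) + 1) * β / r * A *
        √(localErrSq E ν Gu p uh ph μh s) + β * ((n : ℝ) + 1) * eigTerm κ κh u uh s)) := by
        gcongr
    _ = √(volume.real (hull s)) * (((n : ℝ) + 1) * β * A * (Metric.diam (hull s) / r) *
        √(localErrSq E ν Gu p uh ph μh s) + β * ((n : ℝ) + 1) * (Metric.diam (hull s) *
          eigTerm κ κh u uh s)) := by ring
    _ ≤ √(volume.real (hull s)) * (((n : ℝ) + 1) * β * A * σ * X + β * ((n : ℝ) + 1) * X) := by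
        gcongr
    _ = _ := by ring

/-- The element residual is bounded by the local error. -/
theorem element_residual_le (h : IsSetting fe Emin Emax m k Ω ΓD ΓN E T μh ν κ u Gu p uh ph)
    {s : Finset (Pt (n + 1))} (hs : s ∈ T) {C K Mmax κh κR σ r : ℝ} {c : Pt (n + 1)}
    (hκ : κR = κh ∨ κR = κ) (hC0 : 0 < C) (hC : IsPolyBound (n + 1) (2 * (k + n + 4)) C)
    (hK0 : 0 < K) (hK : IsCubeBound (bubblePoly (n + 1)) K)
    (hM : ∀ x ∈ hull s, μh s x ≤ Mmax) (hr : 0 < r) (hball : Metric.closedBall c r ⊆ hull s)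
    (hσ : Metric.diam (hull s) ≤ σ * r) :
    ∃ ρ, 0 ≤ ρ ∧ (∀ x ∈ hull s, ∀ i, |R1 μh κR uh ph s x i| ≤ ρ) ∧
      Metric.diam (hull s) * √(volume.real (hull s)) * ρ ≤ 2 * C * K * (((n : ℝ) + 1) *
        (5 * ((n : ℝ) + 1) ^ 2 * √(Emax + 2 * Mmax) * σ + 1)) *
        √(elemErrSq E ν Gu p uh ph μh κ κh u s) := by
  obtain ⟨F, a, f, M, hf⟩ := exists_frame h.mesh hs
  obtain ⟨U, P, Mh, hd⟩ := h.exists_localData hs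
  choose Q hQdeg hQ using fun i => hf.exists_pullback (residualPoly κR U P Mh i)
  have hdeg : ∀ i, (Q i).totalDegree ≤ 2 * (k + n + 4) := fun i =>
    (hQdeg i).trans (hd.totalDegree_residual_le κR i)
  set I := ∑ i, ∫ z in refSimplex (n + 1), refBubble z * (MvPolynomial.eval z (Q i)) ^ 2 with hI
  have hI0 : 0 ≤ I := Finset.sum_nonneg fun i _ => integral_bubble_sq_nonneg (Q i)
  -- The norm equivalence makes `ρ` a uniform bound for all components of the residual and for their
  -- derivatives in local coordinates.
  set ρ := √(C * I) with hρ
  have hρ2 : ρ ^ 2 = C * I := Real.sq_sqrt (by positivity)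
  have hρ0 : 0 ≤ ρ := Real.sqrt_nonneg _
  have hQb : ∀ i, ∀ y ∈ refSimplex (n + 1), |MvPolynomial.eval y (Q i)| ≤ ρ ∧
      ∀ l, |MvPolynomial.eval y (MvPolynomial.pderiv l (Q i))| ≤ ρ := fun i y hy =>
    hC.abs_le hC0.le hdeg i fun i => refSimplex_abs_le hy i
  have hR1 : ∀ x ∈ hull s, ∀ i, R1 μh κR uh ph s x i =
      MvPolynomial.eval (M.symm (x - a)) (Q i) := fun x hx i => by
    rw [hd.R1_eq κR hx, hQ]; simp
  -- Bubble times residual: testing with it produces `jac M * I`, comparable to the squared norm of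
  -- the residual.
  set w : Fin (n + 1) → Pt (n + 1) → ℝ := fun i => coordFn a M (bubblePoly (n + 1) * Q i) with hw
  have hwb : ∀ x ∈ hull s, ∀ i, |w i x| ≤ 2 * K * ρ ∧
      ∀ j, |pd (w i) j x| ≤ ((n : ℝ) + 1) * (2 * K * ρ) / r := fun x hx i =>
    hf.coordFn_bounds hr hball
      (fun y hy => (abs_eval_mul_le hK0.le (hK y fun i => refSimplex_abs_le hy i) (hQb i y hy)).1)
      (fun y hy => (abs_eval_mul_le hK0.le (hK y fun i => refSimplex_abs_le hy i) (hQb i y hy)).2) hx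
  have hid := h.sum_residual_eq (S := {s}) (Finset.singleton_subset_iff.2 hs) (w := fun _ => w)
    (fun _ _ i => contDiff_coordFn _ _ _)
    (fun φ hφ _ _ i j => by
      rw [Finset.sum_singleton]
      simp only [mul_comm _ (φ _)]
      exact hf.integral_pd_bubble hφ _ _)
    (U := fun _ => U) (P := fun _ => P) (Mh := fun _ => Mh)
    (fun t ht => by rw [Finset.mem_singleton.1 ht]; exact hd) κR
  rw [Finset.sum_singleton, Finset.sum_singleton] at hid
  have hz : ∀ i j, ∫ x in hull s, pd (fun y => evalPt (stressPoly U P Mh i j) y * w i y) j x = 0 :=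
    fun i j => hf.integral_pd_bubble (contDiff_evalPt _) _ _
  simp only [hz, Finset.sum_const_zero, sub_zero] at hid
  have hres : ∫ x in hull s, ∑ i, R1 μh κR uh ph s x i * w i x = jac M * I := by
    have e1 : ∫ x in hull s, ∑ i, R1 μh κR uh ph s x i * w i x =
        ∫ x in hull s, ∑ i, MvPolynomial.eval (M.symm (x - a)) (Q i) * w i x :=
      setIntegral_congr_fun (measurableSet_hull s) fun x hx => by simp only [hR1 x hx]
    rw [e1, hf.setIntegral_hull, hI, ← integral_finsetSum]
    · congr 1
      refine integral_congr_ae (Filter.Eventually.of_forall fun y => ?_)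
      refine Finset.sum_congr rfl fun i _ => ?_
      simp only [hw, coordFn_add_map, map_mul, eval_bubblePoly, add_sub_cancel_left,
        ContinuousLinearEquiv.symm_apply_apply]
      ring
    · intro i _
      exact (continuous_refBubble.mul
        ((MvPolynomial.continuous_eval (Q i)).pow 2)).continuousOn.integrableOn_compact
        (isCompact_refSimplex _)
  rw [hres] at hid
  have hb := h.abs_integral_errorInt_le_elemErr hs hκ hM (β := 2 * K * ρ) (by positivity) hr hσ hwb
  rw [← hid, abs_of_nonneg (mul_nonneg (jac_pos M).le hI0)] at hb
  refine ⟨ρ, hρ0, fun x hx i => ?_, ?_⟩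
  · rw [hR1 x hx]; exact (hQb i _ (hf.mem_hull.1 hx)).1
  have hd0 : 0 ≤ Metric.diam (hull s) := Metric.diam_nonneg
  set v := √(volume.real (hull s)) with hv
  set B := ((n : ℝ) + 1) * (5 * ((n : ℝ) + 1) ^ 2 * √(Emax + 2 * Mmax) * σ + 1)
  set X := √(elemErrSq E ν Gu p uh ph μh κ κh u s)
  have hv2 : v ^ 2 ≤ jac M := by
    rw [hv, Real.sq_sqrt measureReal_nonneg, hf.hull_real_eq]
    exact mul_le_of_le_one_right (jac_pos M).le (refSimplex_real_le_one _)
  have hv0 : 0 ≤ v := Real.sqrt_nonneg _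
  have hσ0 : 0 ≤ σ := by
    by_contra hneg
    have := mul_neg_of_neg_of_pos (not_le.1 hneg) hr
    linarith
  -- The residual appears quadratically on the left and linearly on the right, so one factor `v * ρ`
  -- cancels.
  have hmain : (Metric.diam (hull s) * v * ρ) * (v * ρ) ≤ (2 * C * K * B * X) * (v * ρ) := by
    calc _ = Metric.diam (hull s) * (v ^ 2 * ρ ^ 2) := by ring
      _ ≤ Metric.diam (hull s) * (jac M * ρ ^ 2) := by gcongr
      _ = C * (Metric.diam (hull s) * (jac M * I)) := by rw [hρ2]; ring
      _ ≤ C * (2 * K * ρ * v * B * X) := by gcongr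
      _ = _ := by ring
  -- If the factor to be cancelled is zero, so is the left side of the claim.
  rcases (mul_nonneg hv0 hρ0).eq_or_lt with h0 | h0
  · have h1 : Metric.diam (hull s) * v * ρ = 0 := by rw [mul_assoc, ← h0, mul_zero]
    have hB0 : 0 ≤ B := by positivity
    rw [h1]; positivity
  · exact le_of_mul_le_mul_right hmain h0

end IsSetting

/-! ### The facet residual -/

theorem abs_eval_rename_succ_le {n : ℕ} {Q : MvPolynomial (Fin n) ℝ} {ρ : ℝ} {y : Fin (n + 1) → ℝ}
    (hQ : |MvPolynomial.eval (fun i => y i.succ) Q| ≤ ρ ∧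
      ∀ l, |MvPolynomial.eval (fun i => y i.succ) (MvPolynomial.pderiv l Q)| ≤ ρ) :
    |MvPolynomial.eval y (MvPolynomial.rename Fin.succ Q)| ≤ ρ ∧
      ∀ l, |MvPolynomial.eval y (MvPolynomial.pderiv l (MvPolynomial.rename Fin.succ Q))| ≤ ρ := by
  classical
  refine ⟨by rw [MvPolynomial.eval_rename]; exact hQ.1, fun l => ?_⟩
  induction l using Fin.cases with
  | zero =>
    have : MvPolynomial.pderiv 0 (MvPolynomial.rename Fin.succ Q) = 0 := by
      refine MvPolynomial.pderiv_eq_zero_of_notMem_vars fun hmem => ?_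
      obtain ⟨i, -, hi⟩ := Finset.mem_image.1 (MvPolynomial.vars_rename _ _ hmem)
      exact Fin.succ_ne_zero i hi
    rw [this, map_zero, abs_zero]
    exact (abs_nonneg _).trans hQ.1
  | succ l =>
    rw [MvPolynomial.pderiv_rename (Fin.succ_injective _), MvPolynomial.eval_rename]
    exact hQ.2 l

namespace IsSetting

variable {n : ℕ} {fe : FEFamily} {Emin Emax m : ℝ} {k : ℕ} {Ω ΓD ΓN : Set (Pt (n + 1))}
  {E : Pt (n + 1) → ℝ} {T S : Finset (Finset (Pt (n + 1)))}
  {μh : Finset (Pt (n + 1)) → Pt (n + 1) → ℝ} {ν κ : ℝ} {u : Pt (n + 1) → Pt (n + 1)}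
  {Gu : Pt (n + 1) → Matrix (Fin (n + 1)) (Fin (n + 1)) ℝ} {p : Pt (n + 1) → ℝ}
  {uh : Pt (n + 1) → Pt (n + 1)} {ph : Pt (n + 1) → ℝ}

/-- The residual tested with a field which is bounded in terms of `β`. -/
theorem abs_residual_sub_errorInt_le
    (h : IsSetting fe Emin Emax m k Ω ΓD ΓN E T μh ν κ u Gu p uh ph)
    {t : Finset (Pt (n + 1))} (ht : t ∈ T) {C K Mmax κh κR σ r β : ℝ} {c : Pt (n + 1)}
    (hκ : κR = κh ∨ κR = κ) (hC0 : 0 < C) (hC : IsPolyBound (n + 1) (2 * (k + n + 4)) C)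
    (hK0 : 0 < K) (hK : IsCubeBound (bubblePoly (n + 1)) K)
    (hM : ∀ x ∈ hull t, μh t x ≤ Mmax) (hr : 0 < r) (hball : Metric.closedBall c r ⊆ hull t)
    (hσ : Metric.diam (hull t) ≤ σ * r) {w : Fin (n + 1) → Pt (n + 1) → ℝ} (hβ : 0 ≤ β)
    (hb : ∀ x ∈ hull t, ∀ i, |w i x| ≤ β ∧ ∀ j, |pd (w i) j x| ≤ ((n : ℝ) + 1) * β / r) :
    Metric.diam (hull t) * |(∫ x in hull t, ∑ i, R1 μh κR uh ph t x i * w i x)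
        - ∫ x in hull t, errorInt E κ κR u Gu p uh ph μh t w x| ≤
      β * √(volume.real (hull t)) * ((2 * C * K * ((n : ℝ) + 1) + 1) * (((n : ℝ) + 1) *
        (5 * ((n : ℝ) + 1) ^ 2 * √(Emax + 2 * Mmax) * σ + 1))) *
        √(elemErrSq E ν Gu p uh ph μh κ κh u t) := by
  have h1 := h.abs_integral_errorInt_le_elemErr ht hκ hM hβ hr hσ hb
  obtain ⟨ρ, hρ0, hρ, h2⟩ := h.element_residual_le ht hκ hC0 hC hK0 hK hM hr hball hσ
  set B := ((n : ℝ) + 1) * (5 * ((n : ℝ) + 1) ^ 2 * √(Emax + 2 * Mmax) * σ + 1)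
  set X := √(elemErrSq E ν Gu p uh ph μh κ κh u t)
  set v := √(volume.real (hull t)) with hv
  have hv0 : 0 ≤ v := Real.sqrt_nonneg _
  have hd0 : 0 ≤ Metric.diam (hull t) := Metric.diam_nonneg
  have hK' : IsCompact (hull t) := t.finite_toSet.isCompact_convexHull ℝ
  have h3 : |∫ x in hull t, ∑ i, R1 μh κR uh ph t x i * w i x| ≤
      (((n : ℝ) + 1) * (ρ * β)) * v ^ 2 := by
    rw [hv, Real.sq_sqrt measureReal_nonneg, ← Real.norm_eq_abs]
    refine norm_setIntegral_le_of_norm_le_const hK'.measure_lt_top fun x hx => ?_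
    rw [Real.norm_eq_abs]
    refine (Finset.abs_sum_le_sum_abs _ _).trans ((Finset.sum_le_sum fun i _ =>
      (?_ : _ ≤ ρ * β)).trans (le_of_eq ?_))
    · rw [abs_mul]
      exact mul_le_mul (hρ x hx i) (hb x hx i).1 (abs_nonneg _) hρ0
    · simp
  calc _ ≤ Metric.diam (hull t) * (|∫ x in hull t, ∑ i, R1 μh κR uh ph t x i * w i x|
        + |∫ x in hull t, errorInt E κ κR u Gu p uh ph μh t w x|) := by
        gcongr; exact abs_sub _ _
    _ = Metric.diam (hull t) * |∫ x in hull t, ∑ i, R1 μh κR uh ph t x i * w i x|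
        + Metric.diam (hull t) * |∫ x in hull t, errorInt E κ κR u Gu p uh ph μh t w x| := by ring
    _ ≤ Metric.diam (hull t) * ((((n : ℝ) + 1) * (ρ * β)) * v ^ 2) + β * v * B * X := by
        gcongr
    _ = ((n : ℝ) + 1) * β * v * (Metric.diam (hull t) * v * ρ) + β * v * B * X := by ring
    _ ≤ ((n : ℝ) + 1) * β * v * (2 * C * K * B * X) + β * v * B * X := by gcongr
    _ = _ := by ring

theorem elemErrSq_nonneg (h : IsSetting fe Emin Emax m k Ω ΓD ΓN E T μh ν κ u Gu p uh ph)
    {s : Finset (Pt (n + 1))} (hs : s ∈ T) {κh : ℝ} :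
    0 ≤ elemErrSq E ν Gu p uh ph μh κ κh u s :=
  add_nonneg (h.localErrSq_nonneg hs) (sq_nonneg _)

/-- Each facet residual is bounded by the local errors on the adjacent elements. -/
theorem facet_residual_le (h : IsSetting fe Emin Emax m k Ω ΓD ΓN E T μh ν κ u Gu p uh ph)
    {s F : Finset (Pt (n + 1))} (hs : s ∈ facetPatch T F)
    (hF : ¬ hull F ⊆ frontier Ω ∨ hull F ⊆ ΓN) {C K C' K' H Mmax κh κR σ : ℝ}
    (hκ : κR = κh ∨ κR = κ) (hC0 : 0 < C) (hC : IsPolyBound (n + 1) (2 * (k + n + 4)) C)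
    (hK0 : 0 < K) (hK : IsCubeBound (bubblePoly (n + 1)) K)
    (hC0' : 0 < C') (hC' : IsPolyBound n (2 * (k + n + 4)) C')
    (hK0' : 0 < K') (hK' : IsCubeBound (facetBubblePoly (n + 1)) K')
    (hM : ∀ t ∈ T, ∀ x ∈ hull t, μh t x ≤ Mmax) (hσ0 : 0 ≤ σ) (hσ : ShapeRegular σ T)
    (hH0 : 0 < H) (hH : (μHE[n] : Measure (Pt (n + 1))).real (hull F) ≤
      H * Metric.diam (hull F) ^ n) :
    ∃ ρ, 0 ≤ ρ ∧ (∀ x ∈ hull F, ∀ i, |tractionSum T μh uh ph F x i| ≤ ρ) ∧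
      Metric.diam (hull F) * (μHE[n] : Measure (Pt (n + 1))).real (hull F) * ρ ^ 2 ≤
        H * σ ^ (n + 1) / volume.real (Metric.closedBall (0 : Pt (n + 1)) 1) *
        (2 * (2 * C' * K' * ((2 * C * K * ((n : ℝ) + 1) + 1) * (((n : ℝ) + 1) *
          (5 * ((n : ℝ) + 1) ^ 2 * √(Emax + 2 * Mmax) * σ + 1)))) ^ 2) *
        ∑ t ∈ facetPatch T F, elemErrSq E ν Gu p uh ph μh κ κh u t := by
  obtain ⟨hsT, hsF⟩ := mem_facetPatch.1 hs
  obtain ⟨a, f, M, hf⟩ := exists_isFrame (h.mesh.card_eq s hsT) (h.mesh.affineIndependent s hsT) hsF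
  -- Gives a default value for the chosen frames of simplices outside the patch.
  have : Nonempty ((Fin (n + 1) → ℝ) ≃L[ℝ] Pt (n + 1)) := ⟨M⟩
  choose! a' M' hfr using fun t ht => exists_frame_of_mem_facetPatch h.mesh (t := t) hf ht
  choose! U P Mh hd using fun t ht => h.exists_localData (s := t) ht
  choose! c r hr hball hdiam using hσ
  have hpT : ∀ t ∈ facetPatch T F, t ∈ T := fun t ht => (mem_facetPatch.1 ht).1
  -- The traction sum as a polynomial in the common facet parameters, one for each component.
  obtain ⟨Q, hQdeg, hQ⟩ : ∃ Q : Fin (n + 1) → MvPolynomial (Fin n) ℝ,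
      (∀ i, (Q i).totalDegree ≤ 2 * (k + n + 4)) ∧ ∀ i y, MvPolynomial.eval y (Q i) =
        ∑ t ∈ facetPatch T F, ∑ j,
          evalPt (stressPoly (U t) (P t) (Mh t) i j) (facetPt f y) * outerNormal t F j := by
    choose Q hQ1 hQ2 using fun i => exists_facet_pullback f (∑ t ∈ facetPatch T F, ∑ j,
      stressPoly (U t) (P t) (Mh t) i j * MvPolynomial.C (outerNormal t F j))
    refine ⟨Q, fun i => (hQ1 i).trans ?_, fun i y => ?_⟩
    · refine MvPolynomial.totalDegree_finsetSum_le fun t ht =>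
        MvPolynomial.totalDegree_finsetSum_le fun j _ => (MvPolynomial.totalDegree_mul _ _).trans ?_
      rw [MvPolynomial.totalDegree_C, add_zero]
      exact (hd t (hpT t ht)).totalDegree_stress_le i j
    · rw [hQ2]; simp [evalPt]
  have htr : ∀ y ∈ refSimplex n, ∀ i, tractionSum T μh uh ph F (facetPt f y) i =
      MvPolynomial.eval y (Q i) := fun y hy i => by
    have hx : facetPt f y ∈ hull F := by rw [hf.hull_facet_eq]; exact ⟨y, hy, rfl⟩
    have e1 : tractionSum T μh uh ph F (facetPt f y) i =
        (∑ t ∈ facetPatch T F, traction μh uh ph t F (facetPt f y)) i := rfl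
    rw [e1, Finset.sum_apply, hQ]
    exact Finset.sum_congr rfl fun t ht =>
      (hd t (hpT t ht)).traction_eq F ((hfr t ht).hull_facet_subset hx) i
  set I := ∑ i, ∫ z in refSimplex n, refBubble z * (MvPolynomial.eval z (Q i)) ^ 2 with hI
  have hI0 : 0 ≤ I := Finset.sum_nonneg fun i _ => integral_bubble_sq_nonneg (Q i)
  set ρ := √(C' * I) with hρ
  have hρ2 : ρ ^ 2 = C' * I := Real.sq_sqrt (by positivity)
  have hρ0 : 0 ≤ ρ := Real.sqrt_nonneg _
  have hQb : ∀ i, ∀ y : Fin n → ℝ, (∀ i, |y i| ≤ 1) → |MvPolynomial.eval y (Q i)| ≤ ρ ∧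
      ∀ l, |MvPolynomial.eval y (MvPolynomial.pderiv l (Q i))| ≤ ρ := fun i y hy =>
    hC'.abs_le hC0'.le hQdeg i hy
  -- The same polynomial `Q i` is extended into every simplex of the patch, so the fields agree on
  -- the common facet.
  set w : Finset (Pt (n + 1)) → Fin (n + 1) → Pt (n + 1) → ℝ := fun t i =>
    coordFn (a' t) (M' t) (facetBubblePoly (n + 1) * MvPolynomial.rename Fin.succ (Q i)) with hw
  have hwb : ∀ t ∈ facetPatch T F, ∀ x ∈ hull t, ∀ i, |w t i x| ≤ 2 * K' * ρ ∧
      ∀ j, |pd (w t i) j x| ≤ ((n : ℝ) + 1) * (2 * K' * ρ) / r t := fun t ht x hx i => by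
    have h1 : ∀ y ∈ refSimplex (n + 1), _ := fun y hy => abs_eval_mul_le hK0'.le
      (hK' y fun i => refSimplex_abs_le hy i)
      (abs_eval_rename_succ_le (hQb i (fun i => y i.succ) fun l => refSimplex_abs_le hy l.succ))
    exact (hfr t ht).coordFn_bounds (hr t (hpT t ht)) (hball t (hpT t ht))
      (fun y hy => (h1 y hy).1) (fun y hy => (h1 y hy).2) hx
  set j₀ := IsFrame.facetJac s F a f M with hj₀
  have hj₀pos : 0 < j₀ := hf.facetJac_pos
  have hpd : ∀ t ∈ facetPatch T F, ∀ g : Pt (n + 1) → ℝ, ContDiff ℝ ∞ g → ∀ i j,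
      ∫ x in hull t, pd (fun y => g y * w t i y) j x = outerNormal t F j * j₀ *
        ∫ y in refSimplex n, g (facetPt f y) * (refBubble y * MvPolynomial.eval y (Q i)) :=
    fun t ht g hg i j => by
      rw [hj₀, ← hf.facetJac_eq (hfr t ht)]
      exact (hfr t ht).integral_pd_facetBubble hg (Q i) j
  have hid := h.sum_residual_eq (S := facetPatch T F) hpT (w := w)
    (fun _ _ i => contDiff_coordFn _ _ _)
    (fun φ hφ _ hdis i j => by
      simp only [mul_comm _ (φ _)]
      rw [Finset.sum_congr rfl fun t ht => hpd t ht φ hφ i j, ← Finset.sum_mul, ← Finset.sum_mul]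
      -- Admissibility of the test field: across an interior facet the opposite normals cancel the
      -- flux, and on a facet in `ΓN` the test function `φ` vanishes.
      rcases hF with hF | hF
      · have := congrArg (fun v : Pt (n + 1) => v j) (sum_outerNormal_eq_zero h.isOpen h.mesh hs hF)
        simp only [WithLp.ofLp_sum, Finset.sum_apply] at this
        rw [this]; simp
      · rw [setIntegral_eq_zero_of_forall_eq_zero, mul_zero]
        intro y hy
        have hx : facetPt f y ∈ hull F := by rw [hf.hull_facet_eq]; exact ⟨y, hy, rfl⟩
        rw [image_eq_zero_of_notMem_tsupport (Set.disjoint_right.1 hdis (hF hx)), zero_mul])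
    (fun t ht => hd t (hpT t ht)) κR
  -- The facet terms from all simplices share the density `j₀`. Summed against the normals, the
  -- stresses reproduce the traction sum, leaving its bubble-weighted squared norm.
  have hstress : ∑ t ∈ facetPatch T F, ∑ i, ∑ j, ∫ x in hull t,
      pd (fun y => evalPt (stressPoly (U t) (P t) (Mh t) i j) y * w t i y) j x = j₀ * I := by
    have hint : ∀ t i j, IntegrableOn (fun y : Fin n → ℝ =>
        outerNormal t F j * (evalPt (stressPoly (U t) (P t) (Mh t) i j) (facetPt f y) *
          (refBubble y * MvPolynomial.eval y (Q i)))) (refSimplex n) := fun t i j => by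
      refine ContinuousOn.integrableOn_compact (isCompact_refSimplex n) ?_
      have : Continuous (facetPt f) := by unfold facetPt; fun_prop
      exact (continuous_const.mul (((continuous_evalPt _).comp this).mul
        (continuous_refBubble.mul (MvPolynomial.continuous_eval _)))).continuousOn
    have e1 : ∀ t ∈ facetPatch T F, ∑ i, ∑ j, ∫ x in hull t,
        pd (fun y => evalPt (stressPoly (U t) (P t) (Mh t) i j) y * w t i y) j x =
        j₀ * ∑ i, ∑ j, ∫ y in refSimplex n, outerNormal t F j *
          (evalPt (stressPoly (U t) (P t) (Mh t) i j) (facetPt f y) *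
          (refBubble y * MvPolynomial.eval y (Q i))) := fun t ht => by
      simp only [Finset.mul_sum]
      refine Finset.sum_congr rfl fun i _ => Finset.sum_congr rfl fun j _ => ?_
      rw [hpd t ht _ (contDiff_evalPt _), integral_const_mul]; ring
    rw [Finset.sum_congr rfl e1, ← Finset.mul_sum, hI]
    congr 1
    rw [Finset.sum_comm]
    refine Finset.sum_congr rfl fun i _ => ?_
    rw [Finset.sum_congr rfl fun t _ => (integral_finsetSum _ fun j _ => hint t i j).symm,
      ← integral_finsetSum _ fun t _ => integrable_finsetSum _ fun j _ => hint t i j]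
    refine integral_congr_ae (Filter.Eventually.of_forall fun y => ?_)
    simp only
    have e2 : refBubble y * MvPolynomial.eval y (Q i) ^ 2 = (∑ t ∈ facetPatch T F, ∑ j,
        evalPt (stressPoly (U t) (P t) (Mh t) i j) (facetPt f y) * outerNormal t F j) *
        (refBubble y * MvPolynomial.eval y (Q i)) := by rw [← hQ]; ring
    rw [e2, Finset.sum_mul]
    refine Finset.sum_congr rfl fun t _ => ?_
    rw [Finset.sum_mul]
    refine Finset.sum_congr rfl fun j _ => ?_
    ring
  rw [Finset.sum_sub_distrib, hstress] at hid
  set A := (2 * C * K * ((n : ℝ) + 1) + 1) * (((n : ℝ) + 1) *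
        (5 * ((n : ℝ) + 1) ^ 2 * √(Emax + 2 * Mmax) * σ + 1)) with hA
  have hA0 : 0 ≤ A := by positivity
  set X : Finset (Pt (n + 1)) → ℝ := fun t => √(elemErrSq E ν Gu p uh ph μh κ κh u t) with hX
  have hX0 : ∀ t, 0 ≤ X t := fun t => Real.sqrt_nonneg _
  -- The volume of `t` is at most `j₀` times its diameter, as the height is at most the diameter.
  -- One root of the diameter therefore cancels, and the facet carries only half a power of its
  -- size.
  have hterm : ∀ t ∈ facetPatch T F, √(Metric.diam (hull F)) *
      |(∫ x in hull t, ∑ i, R1 μh κR uh ph t x i * w t i x)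
        - ∫ x in hull t, errorInt E κ κR u Gu p uh ph μh t (w t) x| ≤
      2 * K' * ρ * √j₀ * A * X t := fun t ht => by
    have htT := hpT t ht
    have hft := hfr t ht
    have h1 := h.abs_residual_sub_errorInt_le htT hκ hC0 hC hK0 hK (hM t htT) (hr t htT)
      (hball t htT) (hdiam t htT) (β := 2 * K' * ρ) (by positivity) (hwb t ht)
    have hdpos : 0 < Metric.diam (hull t) := hft.height_pos.trans_le hft.height_le
    have hFt : √(Metric.diam (hull F)) ≤ √(Metric.diam (hull t)) :=
      Real.sqrt_le_sqrt (Metric.diam_mono hft.hull_facet_subset (t.finite_toSet.isCompact_convexHull ℝ).isBounded)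
    have hv : √(volume.real (hull t)) ≤ √j₀ * √(Metric.diam (hull t)) := by
      rw [← Real.sqrt_mul hj₀pos.le]
      refine Real.sqrt_le_sqrt ?_
      rw [hft.hull_real_eq]
      refine (mul_le_of_le_one_right (jac_pos _).le (refSimplex_real_le_one _)).trans ?_
      rw [hj₀, ← hf.facetJac_eq hft, IsFrame.facetJac, div_mul_eq_mul_div, le_div_iff₀ hft.height_pos]
      exact mul_le_mul_of_nonneg_left hft.height_le (jac_pos _).le
    set q := √(Metric.diam (hull t)) with hq
    have hq0 : 0 < q := Real.sqrt_pos.2 hdpos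
    have hq2 : Metric.diam (hull t) = q * q := (Real.mul_self_sqrt hdpos.le).symm
    set Z := |(∫ x in hull t, ∑ i, R1 μh κR uh ph t x i * w t i x)
        - ∫ x in hull t, errorInt E κ κR u Gu p uh ph μh t (w t) x|
    have hZ0 : 0 ≤ Z := abs_nonneg _
    refine (mul_le_mul_of_nonneg_right hFt hZ0).trans (le_of_mul_le_mul_left ?_ hq0)
    calc q * (q * Z) = Metric.diam (hull t) * Z := by rw [hq2]; ring
      _ ≤ 2 * K' * ρ * √(volume.real (hull t)) * A * X t := h1
      _ ≤ 2 * K' * ρ * (√j₀ * q) * A * X t := by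
        have := hX0 t
        gcongr
      _ = q * (2 * K' * ρ * √j₀ * A * X t) := by ring
  have hsum : √(Metric.diam (hull F)) * (j₀ * I) ≤
      2 * K' * ρ * √j₀ * A * ∑ t ∈ facetPatch T F, X t := by
    have e1 : j₀ * I = ∑ t ∈ facetPatch T F, ((∫ x in hull t, ∑ i, R1 μh κR uh ph t x i * w t i x)
        - ∫ x in hull t, errorInt E κ κR u Gu p uh ph μh t (w t) x) := by
      rw [Finset.sum_sub_distrib]; linarith
    rw [e1, Finset.mul_sum, Finset.mul_sum]
    exact Finset.sum_le_sum fun t ht => (mul_le_mul_of_nonneg_left (le_abs_self _)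
      (Real.sqrt_nonneg _)).trans (hterm t ht)
  refine ⟨ρ, hρ0, fun x hx i => ?_, ?_⟩
  · rw [hf.hull_facet_eq] at hx
    obtain ⟨y, hy, rfl⟩ := hx
    rw [htr y hy]; exact (hQb i y fun l => refSimplex_abs_le hy l).1
  have hsX0 : 0 ≤ ∑ t ∈ facetPatch T F, X t := Finset.sum_nonneg fun t _ => hX0 t
  have hkey : √(Metric.diam (hull F)) * √j₀ * ρ ≤ 2 * C' * K' * A * ∑ t ∈ facetPatch T F, X t := by
    have hmain : (√(Metric.diam (hull F)) * √j₀ * ρ) * (√j₀ * ρ) ≤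
        (2 * C' * K' * A * ∑ t ∈ facetPatch T F, X t) * (√j₀ * ρ) := by
      calc _ = √(Metric.diam (hull F)) * ((√j₀ * √j₀) * ρ ^ 2) := by ring
        _ = C' * (√(Metric.diam (hull F)) * (j₀ * I)) := by
          rw [Real.mul_self_sqrt hj₀pos.le, hρ2]; ring
        _ ≤ C' * (2 * K' * ρ * √j₀ * A * ∑ t ∈ facetPatch T F, X t) := by gcongr
        _ = _ := by ring
    rcases hρ0.eq_or_lt with h0 | h0
    · rw [← h0, mul_zero]; positivity
    · exact le_of_mul_le_mul_right hmain (mul_pos (Real.sqrt_pos.2 hj₀pos) h0)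
  have hsq : Metric.diam (hull F) * j₀ * ρ ^ 2 ≤ 2 * (2 * C' * K' * A) ^ 2 *
      ∑ t ∈ facetPatch T F, elemErrSq E ν Gu p uh ph μh κ κh u t := by
    have h1 : Metric.diam (hull F) * j₀ * ρ ^ 2 = (√(Metric.diam (hull F)) * √j₀ * ρ) ^ 2 := by
      rw [mul_pow, mul_pow, Real.sq_sqrt Metric.diam_nonneg, Real.sq_sqrt hj₀pos.le]
    have h2 : (∑ t ∈ facetPatch T F, X t) ^ 2 ≤
        2 * ∑ t ∈ facetPatch T F, elemErrSq E ν Gu p uh ph μh κ κh u t := by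
      refine sq_sum_le_card_mul_sum_sq.trans ?_
      have h3 : ∀ t ∈ facetPatch T F, X t ^ 2 = elemErrSq E ν Gu p uh ph μh κ κh u t :=
        fun t ht => Real.sq_sqrt (h.elemErrSq_nonneg (hpT t ht))
      rw [Finset.sum_congr rfl h3]
      refine mul_le_mul_of_nonneg_right ?_
        (Finset.sum_nonneg fun t ht => h.elemErrSq_nonneg (hpT t ht))
      exact_mod_cast card_facetPatch_le h.mesh F
    rw [h1]
    calc _ ≤ (2 * C' * K' * A * ∑ t ∈ facetPatch T F, X t) ^ 2 := by gcongr
      _ = (2 * C' * K' * A) ^ 2 * (∑ t ∈ facetPatch T F, X t) ^ 2 := by ring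
      _ ≤ (2 * C' * K' * A) ^ 2 * (2 * ∑ t ∈ facetPatch T F,
          elemErrSq E ν Gu p uh ph μh κ κh u t) := by gcongr
      _ = _ := by ring
  set V₁ := volume.real (Metric.closedBall (0 : Pt (n + 1)) 1) with hV
  have hV0 : 0 < V₁ := by
    rw [hV, measureReal_def]
    exact ENNReal.toReal_pos (Metric.measure_closedBall_pos _ _ one_pos).ne'
      measure_closedBall_lt_top.ne
  -- The surface measure is compared with `j₀` through sizes only: the `n + 1`-st power of the
  -- diameter is at most a multiple of the volume by shape regularity, and the volume is at most
  -- `j₀` times the diameter.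
  have hmeas : (μHE[n] : Measure (Pt (n + 1))).real (hull F) ≤ H * σ ^ (n + 1) / V₁ * j₀ := by
    refine hH.trans ?_
    rw [mul_div_assoc, mul_assoc]
    refine mul_le_mul_of_nonneg_left ?_ hH0.le
    have hFs : Metric.diam (hull F) ≤ Metric.diam (hull s) :=
      Metric.diam_mono hf.hull_facet_subset (s.finite_toSet.isCompact_convexHull ℝ).isBounded
    have hdpos : 0 < Metric.diam (hull s) := hf.height_pos.trans_le hf.height_le
    refine (pow_le_pow_left₀ Metric.diam_nonneg hFs n).trans ?_
    rw [div_mul_eq_mul_div, le_div_iff₀ hV0]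
    refine le_of_mul_le_mul_right ?_ hdpos
    calc _ = Metric.diam (hull s) ^ (n + 1) * V₁ := by ring
      _ ≤ (σ * r s) ^ (n + 1) * V₁ := by gcongr; exact hdiam s hsT
      _ = σ ^ (n + 1) * (r s ^ (n + 1) * V₁) := by ring
      _ ≤ σ ^ (n + 1) * volume.real (hull s) := by
        gcongr; exact le_hull_real (hr s hsT) (hball s hsT)
      _ ≤ σ ^ (n + 1) * (j₀ * Metric.diam (hull s)) := by
        gcongr
        rw [hf.hull_real_eq]
        refine (mul_le_of_le_one_right (jac_pos _).le (refSimplex_real_le_one _)).trans ?_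
        rw [hj₀, IsFrame.facetJac, div_mul_eq_mul_div, le_div_iff₀ hf.height_pos]
        exact mul_le_mul_of_nonneg_left hf.height_le (jac_pos _).le
      _ = _ := by ring
  calc _ ≤ Metric.diam (hull F) * (H * σ ^ (n + 1) / V₁ * j₀) * ρ ^ 2 := by gcongr
    _ = H * σ ^ (n + 1) / V₁ * (Metric.diam (hull F) * j₀ * ρ ^ 2) := by ring
    _ ≤ H * σ ^ (n + 1) / V₁ * (2 * (2 * C' * K' * A) ^ 2 *
      ∑ t ∈ facetPatch T F, elemErrSq E ν Gu p uh ph μh κ κh u t) := by gcongr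
    _ = _ := by ring

end IsSetting

/-! ### The efficiency estimate -/

theorem trace_sq_le {d : ℕ} (A : Matrix (Fin d) (Fin d) ℝ) :
    A.trace ^ 2 ≤ (d : ℝ) ^ 2 * ddot A A := by
  have h1 := abs_trace_le (abs_entry_le A)
  have h2 := pow_le_pow_left₀ (abs_nonneg _) h1 2
  rwa [sq_abs, mul_pow, Real.sq_sqrt (ddot_self_nonneg A)] at h2

namespace IsSetting

variable {n : ℕ} {fe : FEFamily} {Emin Emax m : ℝ} {k : ℕ} {Ω ΓD ΓN : Set (Pt (n + 1))}
  {E : Pt (n + 1) → ℝ} {T S : Finset (Finset (Pt (n + 1)))}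
  {μh : Finset (Pt (n + 1)) → Pt (n + 1) → ℝ} {ν κ : ℝ} {u : Pt (n + 1) → Pt (n + 1)}
  {Gu : Pt (n + 1) → Matrix (Fin (n + 1)) (Fin (n + 1)) ℝ} {p : Pt (n + 1) → ℝ}
  {uh : Pt (n + 1) → Pt (n + 1)} {ph : Pt (n + 1) → ℝ}

/-- The mass equation holds almost everywhere. -/
theorem ae_mass (h : IsSetting fe Emin Emax m k Ω ΓD ΓN E T μh ν κ u Gu p uh ph) :
    ∀ᵐ x ∂(volume.restrict Ω), (Gu x).trace + lamInv E ν x * p x = 0 := by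
  have h1 : MemLp (fun x => (Gu x).trace) 2 (volume.restrict Ω) := memLp_trace h.sol.memH.memLp_grad
  have h2 : MemLp (fun x => lamInv E ν x * p x) 2 (volume.restrict Ω) :=
    memLp_mul_of_bounded h.measurable_lamInv h.ae_lamInv h.sol.memQ
  have hq : MemLp (fun x => (Gu x).trace + lamInv E ν x * p x) 2 (volume.restrict Ω) := h1.add h2
  -- The mass equation is tested with its own strong residual, which is square integrable.
  have h3 := h.sol.mass _ hq
  have i1 : IntegrableOn (fun x => ((Gu x).trace + lamInv E ν x * p x) * (Gu x).trace) Ω :=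
    hq.integrable_mul h1
  have i2 : IntegrableOn (fun x => lamInv E ν x * (p x * ((Gu x).trace + lamInv E ν x * p x))) Ω := by
    have : IntegrableOn (fun x => (lamInv E ν x * p x) * ((Gu x).trace + lamInv E ν x * p x)) Ω :=
      h2.integrable_mul hq
    simpa only [mul_assoc] using this
  have h4 : ∫ x in Ω, ((Gu x).trace + lamInv E ν x * p x) ^ 2 = 0 := by
    rw [formB, formC] at h3
    have e : ∀ x, ((Gu x).trace + lamInv E ν x * p x) ^ 2 =
        ((Gu x).trace + lamInv E ν x * p x) * (Gu x).trace +
          lamInv E ν x * (p x * ((Gu x).trace + lamInv E ν x * p x)) := fun x => by ring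
    simp only [e]
    rw [integral_add i1 i2]
    linarith
  rw [integral_eq_zero_iff_of_nonneg (fun x => sq_nonneg _) hq.integrable_sq] at h4
  filter_upwards [h4] with x hx
  exact pow_eq_zero_iff two_ne_zero |>.1 hx

/-- Subtracting the exact mass equation writes `R2` through the divergence error and the weighted
pressure error. The weight is at most `2 * μh`, which handles the first, and its product with
`lamInv` is at most 1, which reduces the second to a term of the energy density. Both facts hold
uniformly in `ν`. -/
theorem residual_two_le (h : IsSetting fe Emin Emax m k Ω ΓD ΓN E T μh ν κ u Gu p uh ph)
    {s : Finset (Pt (n + 1))} (hs : s ∈ T) {Mmax : ℝ} (hM : ∀ x ∈ hull s, μh s x ≤ Mmax) :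
    ∫ x in hull s, ((2 * μh s x)⁻¹ + lamInv E ν x)⁻¹ * (R2 E ν uh ph s x) ^ 2 ≤
      (8 * Mmax * ((n : ℝ) + 1) ^ 2 / Emin + 2) * localErrSq E ν Gu p uh ph μh s := by
  rw [localErrSq, ← integral_const_mul]
  refine integral_mono_of_nonneg ?_ ((h.integrable_alpha hs).const_mul _) ?_
  · filter_upwards [h.ae_good hs] with x hx
    have h1 := h.lamInv_nonneg hx.2.1
    have h2 := h.m_pos.trans_le (h.lower s hs x hx.1)
    simp only [Pi.zero_apply]
    positivity
  · filter_upwards [h.ae_good hs, h.ae_hull_of_ae hs h.ae_mass] with x hx hmass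
    obtain ⟨hxs, hxΩ, hxg⟩ := hx
    have hlam := h.lamInv_nonneg hxΩ
    have hμ := h.m_pos.trans_le (h.lower s hs x hxs)
    have hEmin := h.Emin_pos
    have hmu := h.mu_mem hxΩ
    have hosc := h.osc_nonneg hs hxs
    have hMx := hM x hxs
    have hM0 : 0 < Mmax := hμ.trans_le hMx
    have hG0 := ddot_self_nonneg (Gu x - grad uh x)
    have htr := trace_sq_le (Gu x - grad uh x)
    rw [Matrix.trace_sub] at htr
    push_cast at htr
    set W := ((2 * μh s x)⁻¹ + lamInv E ν x)⁻¹ with hW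
    have hW0 : 0 ≤ W := by positivity
    have hW1 : W ≤ 2 * Mmax := by
      refine le_trans ?_ (by linarith : 2 * μh s x ≤ 2 * Mmax)
      rw [hW, inv_le_comm₀ (by positivity) (by positivity)]
      linarith
    have hW2 : W * lamInv E ν x ≤ 1 := by
      rw [hW, inv_mul_le_iff₀ (by positivity), mul_one]
      have : 0 < (2 * μh s x)⁻¹ := by positivity
      linarith
    have hR : R2 E ν uh ph s x = -(((Gu x).trace - (grad uh x).trace)
        + lamInv E ν x * (p x - ph x)) := by
      rw [R2, ← hxg]; linarith
    have hR2 : (R2 E ν uh ph s x) ^ 2 ≤ 2 * ((Gu x).trace - (grad uh x).trace) ^ 2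
        + 2 * (lamInv E ν x * (p x - ph x)) ^ 2 := by
      rw [hR]
      nlinarith [sq_nonneg (((Gu x).trace - (grad uh x).trace) - lamInv E ν x * (p x - ph x))]
    set g := ddot (Gu x - grad uh x) (Gu x - grad uh x)
    have t1 : W * ((Gu x).trace - (grad uh x).trace) ^ 2 ≤
        4 * Mmax * ((n : ℝ) + 1) ^ 2 / Emin * (mu E x * g) := by
      calc _ ≤ (2 * Mmax) * (((n : ℝ) + 1) ^ 2 * g) := by gcongr
        _ = 4 * Mmax * ((n : ℝ) + 1) ^ 2 / Emin * (Emin / 2 * g) := by field_simp; ring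
        _ ≤ _ := by gcongr; exact hmu.2.1
    have t2 : W * (lamInv E ν x * (p x - ph x)) ^ 2 ≤ lamInv E ν x * (p x - ph x) ^ 2 := by
      calc _ = (W * lamInv E ν x) * (lamInv E ν x * (p x - ph x) ^ 2) := by ring
        _ ≤ 1 * (lamInv E ν x * (p x - ph x) ^ 2) := by gcongr
        _ = _ := one_mul _
    have e0 : 0 ≤ (mu E x)⁻¹ * (p x - ph x) ^ 2 := mul_nonneg (inv_nonneg.2 hmu.1.le) (sq_nonneg _)
    have e1 : 0 ≤ mu E x * g := mul_nonneg hmu.1.le hG0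
    have e2 : 0 ≤ lamInv E ν x * (p x - ph x) ^ 2 := mul_nonneg hlam (sq_nonneg _)
    have hK : 0 ≤ 4 * Mmax * ((n : ℝ) + 1) ^ 2 / Emin := by positivity
    have hK2 : 8 * Mmax * ((n : ℝ) + 1) ^ 2 / Emin = 2 * (4 * Mmax * ((n : ℝ) + 1) ^ 2 / Emin) := by
      ring
    rw [energyDensity, hK2]
    set K := 4 * Mmax * ((n : ℝ) + 1) ^ 2 / Emin
    calc W * (R2 E ν uh ph s x) ^ 2 ≤ W * (2 * ((Gu x).trace - (grad uh x).trace) ^ 2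
        + 2 * (lamInv E ν x * (p x - ph x)) ^ 2) := by gcongr
      _ = 2 * (W * ((Gu x).trace - (grad uh x).trace) ^ 2)
        + 2 * (W * (lamInv E ν x * (p x - ph x)) ^ 2) := by ring
      _ ≤ 2 * (K * (mu E x * g)) + 2 * (lamInv E ν x * (p x - ph x) ^ 2) := by gcongr
      _ ≤ _ := by
        nlinarith [mul_nonneg hK e0, mul_nonneg hK e2, mul_nonneg hK hosc]

/-- The element part of the estimator is bounded by the local error. -/
theorem etaElemSq_le (h : IsSetting fe Emin Emax m k Ω ΓD ΓN E T μh ν κ u Gu p uh ph)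
    {s : Finset (Pt (n + 1))} (hs : s ∈ T) {C K Mmax κh κR σ : ℝ}
    (hκ : κR = κh ∨ κR = κ) (hC0 : 0 < C) (hC : IsPolyBound (n + 1) (2 * (k + n + 4)) C)
    (hK0 : 0 < K) (hK : IsCubeBound (bubblePoly (n + 1)) K)
    (hM : ∀ x ∈ hull s, μh s x ≤ Mmax) (hM0 : 0 ≤ Mmax) (hσ : ShapeRegular σ T) :
    etaElemSq E ν μh κR uh ph s ≤ (((n : ℝ) + 1) * (2 * m)⁻¹ * (2 * C * K * (((n : ℝ) + 1) *
        (5 * ((n : ℝ) + 1) ^ 2 * √(Emax + 2 * Mmax) * σ + 1))) ^ 2 +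
        (8 * Mmax * ((n : ℝ) + 1) ^ 2 / Emin + 2)) * elemErrSq E ν Gu p uh ph μh κ κh u s := by
  obtain ⟨c, r, hr, hball, hdiam⟩ := hσ s hs
  obtain ⟨ρ, hρ0, hρ, h1⟩ := h.element_residual_le hs hκ hC0 hC hK0 hK hM hr hball hdiam
  set A := 2 * C * K * (((n : ℝ) + 1) * (5 * ((n : ℝ) + 1) ^ 2 * √(Emax + 2 * Mmax) * σ + 1))
  have hm := h.m_pos
  have hEmin := h.Emin_pos
  have hK' : IsCompact (hull s) := s.finite_toSet.isCompact_convexHull ℝ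
  have h2 : ∫ x in hull s, (2 * μh s x)⁻¹ * ∑ i, (R1 μh κR uh ph s x i) ^ 2 ≤
      ((2 * m)⁻¹ * (((n : ℝ) + 1) * ρ ^ 2)) * volume.real (hull s) := by
    refine (le_abs_self _).trans ?_
    rw [← Real.norm_eq_abs]
    refine norm_setIntegral_le_of_norm_le_const hK'.measure_lt_top fun x hx => ?_
    have hμ := h.lower s hs x hx
    have hμ0 := hm.trans_le hμ
    rw [Real.norm_eq_abs, abs_of_nonneg (mul_nonneg (by positivity)
      (Finset.sum_nonneg fun i _ => sq_nonneg _))]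
    gcongr
    refine (Finset.sum_le_sum fun i _ => (?_ : _ ≤ ρ ^ 2)).trans (le_of_eq (by simp))
    rw [← sq_abs]
    exact pow_le_pow_left₀ (abs_nonneg _) (hρ x hx i) 2
  have h3 : (Metric.diam (hull s) * √(volume.real (hull s)) * ρ) ^ 2 ≤
      (A * √(elemErrSq E ν Gu p uh ph μh κ κh u s)) ^ 2 := by
    refine pow_le_pow_left₀ ?_ h1 2
    have := Metric.diam_nonneg (s := hull s)
    positivity
  rw [mul_pow, mul_pow, mul_pow, Real.sq_sqrt measureReal_nonneg,
    Real.sq_sqrt (h.elemErrSq_nonneg hs)] at h3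
  have h4 : localErrSq E ν Gu p uh ph μh s ≤ elemErrSq E ν Gu p uh ph μh κ κh u s := by
    rw [elemErrSq]; linarith [sq_nonneg (Metric.diam (hull s) * eigTerm κ κh u uh s)]
  rw [etaElemSq, add_mul]
  refine add_le_add ?_ ((h.residual_two_le hs hM).trans ?_)
  · calc _ ≤ Metric.diam (hull s) ^ 2 *
        (((2 * m)⁻¹ * (((n : ℝ) + 1) * ρ ^ 2)) * volume.real (hull s)) := by gcongr
      _ = ((n : ℝ) + 1) * (2 * m)⁻¹ * (Metric.diam (hull s) ^ 2 * volume.real (hull s) * ρ ^ 2) := by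
        ring
      _ ≤ ((n : ℝ) + 1) * (2 * m)⁻¹ * (A ^ 2 * elemErrSq E ν Gu p uh ph μh κ κh u s) := by gcongr
      _ = _ := by ring
  · gcongr

/-- The facet part of the estimator is bounded by the local errors on the adjacent elements. -/
theorem etaFacetSq_le (h : IsSetting fe Emin Emax m k Ω ΓD ΓN E T μh ν κ u Gu p uh ph)
    {s F : Finset (Pt (n + 1))} (hs : s ∈ T) (hF : F ∈ facets s) {A κh : ℝ}
    (hA0 : 0 ≤ A)
    (hH : (μHE[n] : Measure (Pt (n + 1))) (hull F) < ⊤)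
    (hA : (¬ hull F ⊆ frontier Ω ∨ hull F ⊆ ΓN) →
      ∃ ρ, 0 ≤ ρ ∧ (∀ x ∈ hull F, ∀ i, |tractionSum T μh uh ph F x i| ≤ ρ) ∧
      Metric.diam (hull F) * (μHE[n] : Measure (Pt (n + 1))).real (hull F) * ρ ^ 2 ≤
        A * ∑ t ∈ facetPatch T F, elemErrSq E ν Gu p uh ph μh κ κh u t) :
    etaFacetSq Ω ΓN T μh uh ph s F ≤ ((n : ℝ) + 1) * (2 * m)⁻¹ * A *
      ∑ t ∈ facetPatch T F, elemErrSq E ν Gu p uh ph μh κ κh u t := by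
  classical
  have hm := h.m_pos
  have hX0 : 0 ≤ ∑ t ∈ facetPatch T F, elemErrSq E ν Gu p uh ph μh κ κh u t :=
    Finset.sum_nonneg fun t ht => h.elemErrSq_nonneg (mem_facetPatch.1 ht).1
  by_cases hcase : ¬ hull F ⊆ frontier Ω ∨ hull F ⊆ ΓN
  · obtain ⟨ρ, hρ0, hρ, h1⟩ := hA hcase
    -- On interior facets the factor one half only helps, and elsewhere the residual is the traction
    -- sum or zero.
    have h2 : ∀ x ∈ hull F, ∀ i, |facetResidual Ω ΓN T μh uh ph F x i| ≤ ρ := fun x hx i => by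
      have h3 := hρ x hx i
      rw [facetResidual]
      split_ifs
      · exact h3
      · simpa using hρ0
      · rw [Pi.smul_apply, smul_eq_mul, abs_mul]
        norm_num
        linarith [abs_nonneg (tractionSum T μh uh ph F x i)]
    obtain ⟨a, f, M, hf⟩ := exists_isFrame (h.mesh.card_eq s hs) (h.mesh.affineIndependent s hs) hF
    have h4 : ∫ x in hull F, (2 * μh s x)⁻¹ / 2 * ∑ i, (facetResidual Ω ΓN T μh uh ph F x i) ^ 2
        ∂(μHE[n] : Measure (Pt (n + 1))) ≤
        ((2 * m)⁻¹ * (((n : ℝ) + 1) * ρ ^ 2)) * (μHE[n] : Measure (Pt (n + 1))).real (hull F) := by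
      refine (le_abs_self _).trans ?_
      rw [← Real.norm_eq_abs]
      refine norm_setIntegral_le_of_norm_le_const hH fun x hx => ?_
      have hμ := h.lower s hs x (hf.hull_facet_subset hx)
      have hμ0 := hm.trans_le hμ
      rw [Real.norm_eq_abs, abs_of_nonneg (mul_nonneg (by positivity)
        (Finset.sum_nonneg fun i _ => sq_nonneg _))]
      gcongr
      · refine (half_le_self (by positivity)).trans ?_
        gcongr
      · refine (Finset.sum_le_sum fun i _ => (?_ : _ ≤ ρ ^ 2)).trans (le_of_eq (by simp))
        rw [← sq_abs]
        exact pow_le_pow_left₀ (abs_nonneg _) (h2 x hx i) 2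
    have hd0 : 0 ≤ Metric.diam (hull F) := Metric.diam_nonneg
    calc etaFacetSq Ω ΓN T μh uh ph s F ≤ Metric.diam (hull F) * (((2 * m)⁻¹ *
          (((n : ℝ) + 1) * ρ ^ 2)) * (μHE[n] : Measure (Pt (n + 1))).real (hull F)) :=
          mul_le_mul_of_nonneg_left h4 hd0
      _ = ((n : ℝ) + 1) * (2 * m)⁻¹ * (Metric.diam (hull F) *
          (μHE[n] : Measure (Pt (n + 1))).real (hull F) * ρ ^ 2) := by ring
      _ ≤ ((n : ℝ) + 1) * (2 * m)⁻¹ * (A *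
          ∑ t ∈ facetPatch T F, elemErrSq E ν Gu p uh ph μh κ κh u t) := by gcongr
      _ = _ := by ring
  -- A boundary facet not in `ΓN` has zero facet residual by definition.
  · push Not at hcase
    have h0 : etaFacetSq Ω ΓN T μh uh ph s F = 0 := by
      simp [etaFacetSq, facetResidual, hcase.1, hcase.2]
    rw [h0]; positivity

/-- Finite overlap: reordering by facets, each local error is counted once for every facet of its
simplex and every simplex at that facet, that is at most `n + 2` times at most two. -/
theorem sum_facetPatch_le (hT : IsMesh Ω T) {X : Finset (Pt (n + 1)) → ℝ}
    (hX : ∀ t ∈ T, 0 ≤ X t) :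
    ∑ s ∈ T, ∑ F ∈ facets s, ∑ t ∈ facetPatch T F, X t ≤ 2 * ((n : ℝ) + 2) * ∑ t ∈ T, X t := by
  classical
  have hcomm : ∀ G : Finset (Pt (n + 1)) → Finset (Pt (n + 1)) → ℝ,
      ∑ s ∈ T, ∑ F ∈ facets s, G s F = ∑ F ∈ T.biUnion facets, ∑ s ∈ facetPatch T F, G s F :=
    fun G => Finset.sum_comm' fun s F => by
      rw [mem_facetPatch, Finset.mem_biUnion]
      exact ⟨fun hsF => ⟨hsF, s, hsF⟩, fun hsF => hsF.1⟩
  have h1 : ∀ F, 0 ≤ ∑ t ∈ facetPatch T F, X t := fun F =>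
    Finset.sum_nonneg fun t ht => hX t (mem_facetPatch.1 ht).1
  have h2 : ∀ t ∈ T, ((facets t).card : ℝ) ≤ (n : ℝ) + 2 := fun t ht => by
    have h3 : (facets t).card ≤ n + 2 := Finset.card_image_le.trans (hT.card_eq t ht).le
    exact_mod_cast h3
  calc _ = ∑ F ∈ T.biUnion facets, ((facetPatch T F).card : ℝ) * ∑ t ∈ facetPatch T F, X t := by
        rw [hcomm]; simp
    _ ≤ ∑ F ∈ T.biUnion facets, 2 * ∑ t ∈ facetPatch T F, X t :=
        Finset.sum_le_sum fun F _ => mul_le_mul_of_nonneg_right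
          (by exact_mod_cast card_facetPatch_le hT F) (h1 F)
    _ = 2 * ∑ t ∈ T, ((facets t).card : ℝ) * X t := by
        rw [← Finset.mul_sum, ← hcomm fun t _ => X t]; simp
    _ ≤ 2 * ∑ t ∈ T, ((n : ℝ) + 2) * X t := by
        gcongr with t ht
        · exact hX t ht
        · exact h2 t ht
    _ = _ := by rw [← Finset.mul_sum]; ring

/-- The local errors sum up to the global error. -/
theorem sum_elemErrSq_le (h : IsSetting fe Emin Emax m k Ω ΓD ΓN E T μh ν κ u Gu p uh ph)
    {κh : ℝ} : ∑ s ∈ T, elemErrSq E ν Gu p uh ph μh κ κh u s ≤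
      (tripleNorm Ω E ν (fun x => Gu x - grad uh x) (fun x => p x - ph x)
        + oscillation T E μh uh + higherOrder T κ κh u uh) ^ 2 := by
  have h1 : ∑ s ∈ T, ∫ x in hull s, energyDensity E ν Gu p uh ph x ≤
      tripleNorm Ω E ν (fun x => Gu x - grad uh x) (fun x => p x - ph x) ^ 2 := by
    rw [h.tripleNorm_sq]
    exact sum_setIntegral_hull_le h.isOpen h.lipschitz h.mesh h.integrable_energy
      fun x hx => h.energy_nonneg hx
  have h2 : ∑ s ∈ T, ∫ x in hull s, oscDensity E μh uh s x = oscillation T E μh uh ^ 2 := by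
    rw [oscillation, Real.sq_sqrt]
    · rfl
    · exact Finset.sum_nonneg fun s hs => setIntegral_nonneg (measurableSet_hull s)
        fun x hx => h.osc_nonneg hs hx
  have h3 : ∑ s ∈ T, (Metric.diam (hull s) * eigTerm κ κh u uh s) ^ 2 =
      higherOrder T κ κh u uh ^ 2 := by
    rw [higherOrder, Real.sq_sqrt (Finset.sum_nonneg fun s _ => by positivity)]
    exact Finset.sum_congr rfl fun s _ => by rw [mul_pow, eigTerm]
  have h4 : ∀ s ∈ T, elemErrSq E ν Gu p uh ph μh κ κh u s =
      (∫ x in hull s, energyDensity E ν Gu p uh ph x) + (∫ x in hull s, oscDensity E μh uh s x)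
        + (Metric.diam (hull s) * eigTerm κ κh u uh s) ^ 2 := fun s hs => by
    rw [elemErrSq, localErrSq, integral_add
      (h.integrableOn_hull_of_integrableOn hs h.integrable_energy) (h.integrable_osc hs)]
  rw [Finset.sum_congr rfl h4, Finset.sum_add_distrib, Finset.sum_add_distrib, h2, h3]
  have a1 : 0 ≤ tripleNorm Ω E ν (fun x => Gu x - grad uh x) (fun x => p x - ph x) :=
    Real.sqrt_nonneg _
  have a2 : 0 ≤ oscillation T E μh uh := Real.sqrt_nonneg _
  have a3 : 0 ≤ higherOrder T κ κh u uh := Real.sqrt_nonneg _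
  nlinarith [mul_nonneg a1 a2, mul_nonneg a1 a3, mul_nonneg a2 a3]

end IsSetting

/-- Efficiency of the residual estimator. -/
theorem exists_eta_le (n : ℕ) (fe : FEFamily) (Emin Emax m σ : ℝ) (k : ℕ) :
    ∃ C : ℝ, 0 < C ∧ ∀ {Ω ΓD ΓN : Set (Pt (n + 1))} {E : Pt (n + 1) → ℝ}
      {T : Finset (Finset (Pt (n + 1)))} {μh : Finset (Pt (n + 1)) → Pt (n + 1) → ℝ} {ν κ : ℝ}
      {u : Pt (n + 1) → Pt (n + 1)}
      {Gu : Pt (n + 1) → Matrix (Fin (n + 1)) (Fin (n + 1)) ℝ} {p : Pt (n + 1) → ℝ}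
      {uh : Pt (n + 1) → Pt (n + 1)} {ph : Pt (n + 1) → ℝ},
      IsSetting fe Emin Emax m k Ω ΓD ΓN E T μh ν κ u Gu p uh ph → ShapeRegular σ T →
      ∀ {κh κR : ℝ}, (κR = κh ∨ κR = κ) → eta Ω ΓN T E ν μh κR uh ph ≤
        C * (tripleNorm Ω E ν (fun x => Gu x - grad uh x) (fun x => p x - ph x)
          + oscillation T E μh uh + higherOrder T κ κh u uh) := by
  -- The stress is a product of the coefficient and the strain, hence the doubled degree. The bound
  -- is needed on simplices and, one dimension lower, on facets.
  obtain ⟨C, hC0, hC⟩ := exists_poly_bound (n + 1) (2 * (k + n + 4))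
  obtain ⟨C', hC0', hC'⟩ := exists_poly_bound n (2 * (k + n + 4))
  obtain ⟨K, hK0, hK⟩ := exists_cube_bound (bubblePoly (n + 1))
  obtain ⟨K', hK0', hK'⟩ := exists_cube_bound (facetBubblePoly (n + 1))
  obtain ⟨H, hH0, hH⟩ := exists_facet_measure_le n
  set Mmax := (C + 1) * Emax with hMmax
  set B := 5 * ((n : ℝ) + 1) ^ 2 * √(Emax + 2 * Mmax) * σ + 1
  set A₁ := ((n : ℝ) + 1) * (2 * m)⁻¹ * (2 * C * K * (((n : ℝ) + 1) * B)) ^ 2 +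
        (8 * Mmax * ((n : ℝ) + 1) ^ 2 / Emin + 2) with hA₁
  set A₂ := H * σ ^ (n + 1) / volume.real (Metric.closedBall (0 : Pt (n + 1)) 1) *
        (2 * (2 * C' * K' * ((2 * C * K * ((n : ℝ) + 1) + 1) * (((n : ℝ) + 1) * B))) ^ 2) with hA₂
  set A := A₁ + ((n : ℝ) + 1) * (2 * m)⁻¹ * A₂ * (2 * ((n : ℝ) + 2)) with hA
  -- The constant is fixed before any data, when nothing is known about the sign of `A`; adding one
  -- makes it positive in any case.
  refine ⟨√A + 1, by positivity, ?_⟩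
  intro Ω ΓD ΓN E T μh ν κ u Gu p uh ph h hσ κh κR hκ
  set Z := tripleNorm Ω E ν (fun x => Gu x - grad uh x) (fun x => p x - ph x)
          + oscillation T E μh uh + higherOrder T κ κh u uh with hZ
  have hZ0 : 0 ≤ Z := add_nonneg (add_nonneg (Real.sqrt_nonneg _) (Real.sqrt_nonneg _))
    (Real.sqrt_nonneg _)
  -- The signs of `Emax` and `σ` are deduced from an actual simplex, so the empty mesh is treated
  -- separately.
  rcases T.eq_empty_or_nonempty with rfl | ⟨s₀, hs₀⟩
  · have : eta Ω ΓN ∅ E ν μh κR uh ph = 0 := by simp [eta]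
    rw [this]; positivity
  have hE := h.Emax_pos hs₀
  have hm := h.m_pos
  have hEmin := h.Emin_pos
  have hσ0 : 0 ≤ σ := by
    obtain ⟨c, r, hr, -, hd⟩ := hσ s₀ hs₀
    by_contra hneg
    have := mul_neg_of_neg_of_pos (not_le.1 hneg) hr
    linarith [Metric.diam_nonneg (s := hull s₀)]
  have hM0 : 0 ≤ Mmax := by positivity
  have hM : ∀ t ∈ T, ∀ x ∈ hull t, μh t x ≤ Mmax := fun t ht x hx =>
    h.coef_le ht hC0 (fun P hP y hy => (hC P (by omega) y hy).1) hx
  have hX0 : ∀ t ∈ T, 0 ≤ elemErrSq E ν Gu p uh ph μh κ κh u t := fun t ht => h.elemErrSq_nonneg ht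
  have hA₂0 : 0 ≤ A₂ := by positivity
  have hA₁0 : 0 ≤ A₁ := by positivity
  have h1 : ∀ s ∈ T, ∀ F ∈ facets s, etaFacetSq Ω ΓN T μh uh ph s F ≤
      ((n : ℝ) + 1) * (2 * m)⁻¹ * A₂ *
        ∑ t ∈ facetPatch T F, elemErrSq E ν Gu p uh ph μh κ κh u t := fun s hs F hF => by
    obtain ⟨a, f, M, hf⟩ := exists_isFrame (h.mesh.card_eq s hs) (h.mesh.affineIndependent s hs) hF
    obtain ⟨hH1, hH2⟩ := hH s F a f M hf
    exact h.etaFacetSq_le hs hF hA₂0 hH1 fun hcase =>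
      h.facet_residual_le (mem_facetPatch.2 ⟨hs, hF⟩) hcase hκ hC0 hC hK0 hK hC0' hC' hK0' hK' hM
        hσ0 hσ hH0 hH2
  have h2 : ∑ s ∈ T, (etaElemSq E ν μh κR uh ph s + ∑ F ∈ facets s, etaFacetSq Ω ΓN T μh uh ph s F)
      ≤ A * Z ^ 2 := by
    calc _ ≤ ∑ s ∈ T, (A₁ * elemErrSq E ν Gu p uh ph μh κ κh u s +
          ∑ F ∈ facets s, ((n : ℝ) + 1) * (2 * m)⁻¹ * A₂ *
            ∑ t ∈ facetPatch T F, elemErrSq E ν Gu p uh ph μh κ κh u t) :=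
          Finset.sum_le_sum fun s hs => add_le_add
            (h.etaElemSq_le hs hκ hC0 hC hK0 hK (hM s hs) hM0 hσ)
            (Finset.sum_le_sum fun F hF => h1 s hs F hF)
      _ = A₁ * ∑ s ∈ T, elemErrSq E ν Gu p uh ph μh κ κh u s + ((n : ℝ) + 1) * (2 * m)⁻¹ * A₂ *
          ∑ s ∈ T, ∑ F ∈ facets s, ∑ t ∈ facetPatch T F, elemErrSq E ν Gu p uh ph μh κ κh u t := by
          simp only [Finset.sum_add_distrib, ← Finset.mul_sum]
      _ ≤ A₁ * ∑ s ∈ T, elemErrSq E ν Gu p uh ph μh κ κh u s + ((n : ℝ) + 1) * (2 * m)⁻¹ * A₂ *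
          (2 * ((n : ℝ) + 2) * ∑ t ∈ T, elemErrSq E ν Gu p uh ph μh κ κh u t) := by
          gcongr
          exact IsSetting.sum_facetPatch_le h.mesh hX0
      _ = A * ∑ s ∈ T, elemErrSq E ν Gu p uh ph μh κ κh u s := by rw [hA]; ring
      _ ≤ A * Z ^ 2 := by
          gcongr
          exact h.sum_elemErrSq_le
  calc eta Ω ΓN T E ν μh κR uh ph ≤ √(A * Z ^ 2) := Real.sqrt_le_sqrt h2
    _ = √A * Z := by rw [Real.sqrt_mul' _ (sq_nonneg _), Real.sqrt_sq hZ0]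
    _ ≤ (√A + 1) * Z := by gcongr; linarith

end ElasticityEig

end

theorem mainTheorem5 (d : ℕ) (hd : d = 2 ∨ d = 3) (fe : ElasticityEig.FEFamily)
    (Emin Emax m σ : ℝ) (hEmin : 0 < Emin) (hm : 0 < m) (k : ℕ) :
    ∃ C : ℝ, 0 < C ∧
      ∀ (Ω ΓD ΓN : Set (ElasticityEig.Pt d)), IsOpen Ω → Bornology.IsBounded Ω →
      ElasticityEig.HasLipschitzBoundary Ω →
      ElasticityEig.IsBoundarySplitting Ω ΓD ΓN →
      ∀ (E : ElasticityEig.Pt d → ℝ), Measurable E → (∀ x ∈ Ω, Emin ≤ E x ∧ E x ≤ Emax) →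
      ∀ (T : Finset (Finset (ElasticityEig.Pt d))),
      ElasticityEig.IsMesh Ω T → ElasticityEig.ResolvesBoundary Ω ΓD ΓN T →
      ElasticityEig.ShapeRegular σ T →
      ∀ (μh : Finset (ElasticityEig.Pt d) → ElasticityEig.Pt d → ℝ),
      ElasticityEig.IsL2Projection k T (ElasticityEig.mu E) μh →
      (∀ s ∈ T, ∀ x ∈ ElasticityEig.hull s, m ≤ μh s x) →
      ∀ (ν : ℝ), 0 < ν → ν ≤ 1 / 2 →
      ∀ (κ : ℝ) (u : ElasticityEig.Pt d → ElasticityEig.Pt d)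
        (Gu : ElasticityEig.Pt d → Matrix (Fin d) (Fin d) ℝ) (p : ElasticityEig.Pt d → ℝ),
      ElasticityEig.IsEigenSolution Ω ΓN E ν κ u Gu p →
      ∀ (κh : ℝ) (uh : ElasticityEig.Pt d → ElasticityEig.Pt d) (ph : ElasticityEig.Pt d → ℝ),
      ElasticityEig.IsDiscreteEigenSolution fe Ω ΓN T E ν κh uh ph →
      ∀ κR : ℝ, κR = κh ∨ κR = κ →
        ElasticityEig.eta Ω ΓN T E ν μh κR uh ph ≤
          C * (ElasticityEig.tripleNorm Ω E ν
                (fun x => Gu x - ElasticityEig.grad uh x) (fun x => p x - ph x)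
            + ElasticityEig.oscillation T E μh uh
            + ElasticityEig.higherOrder T κ κh u uh) := by
  -- Facets have dimension `d - 1 = n` and are parametrized by `n` variables.
  obtain ⟨n, rfl⟩ : ∃ n, d = n + 1 := ⟨d - 1, by omega⟩
  obtain ⟨C, hC, hle⟩ := ElasticityEig.exists_eta_le n fe Emin Emax m σ k
  refine ⟨C, hC, ?_⟩
  intro Ω ΓD ΓN hΩ _ hL hsplit E hE hEb T hT _ hσ μh hproj hlow ν hν hν' κ u Gu p hsol κh uh ph
    hdisc κR hκ
  exact hle ⟨hΩ, hL, hsplit, hEmin, hm, hE, hEb, hT, hproj, hlow, hν, hν', hsol, hdisc.memHh,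
    hdisc.memQh⟩ hσ hκ
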